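/- Let $p\ge 2$, $\eta_i\ge 4$ ($3\le i\le p$) and $c_M\ge1$ be fixed. Let $f:\mathbb R^d\to\mathbb R$ be $\mu$-strongly convex ($\mu>0$) and $p$ times differentiable with $\|\nabla^pf(x)-\nabla^pf(y)\|\le L_p\|x-y\|$ for all $x,y$, let $x^*$ be its minimizer, $f^*=f(x^*)$, let $L_p\le M\le c_ML_p$, $\tau\ge0$, $\sigma_1,\dots,\sigma_p\ge 0$, $R>0$ and $\|z_0-x^*\|\le R$. *Inner method.* Given a starting point $x_0$ and a number $\rho>0$, put $y_0=x_0$, $\alpha_t=\frac{p+1}{t+p+1}$, $A_t=\prod_{j=1}^t(1-\alpha_j)$, $\bar\delta_t=a_\delta\big(\sigma_2+\frac{\sigma_1+\tau}{\rho}(t+p+1)^{3/2}\big)$, $\lambda_t=a_\lambda\frac{\sigma_1}{\rho}(t+p+1)^{p+1/2}$, $\bar\kappa_2^t=a_2\frac{\alpha_t^2\bar\delta_t}{A_t}$, $\bar\kappa_i^t=a_i\frac{\alpha_t^i\sigma_i}{A_t}$ for $3\le i\le p$, $\bar\kappa_{p+1}^t=a_{p+1}\frac{\alpha_t^{p+1}M}{A_t}$,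 and $\psi_0(x)=\frac{\lambda_0}2\|x-x_0\|^2+\sum_{i=2}^{p+1}\frac{\bar\kappa_i^0}{i!}\|x-x_0\|^i$. For $t=0,1,\dots$ let $v_t=(1-\alpha_t)x_t+\alpha_ty_t$, and let $x_{t+1}$ be any point with $\|\nabla\omega_t(x_{t+1})\|\le\tau$, where $$\omega_t(y)=f(v_t)+\sum_{i=1}^p\tfrac1{i!}G_i(v_t)[y-v_t]^i+\tfrac{\bar\delta_t}2\|y-v_t\|^2+\sum_{i=3}^p\tfrac{\eta_i\sigma_i}{i!}\|y-v_t\|^i+\tfrac{pM}{(p+1)!}\|y-v_t\|^{p+1},$$ and let $y_{t+1}$ be a minimizer of $$\psi_{t+1}(x)=\psi_t(x)+\tfrac{\lambda_{t+1}-\lambda_t}2\|x-x_0\|^2+\sum_{i=2}^{p+1}\tfrac{\bar\kappa_i^{t+1}-\bar\kappa_i^t}{i!}\|x-x_0\|^i+\tfrac{\alpha_t}{A_t}\big(f(x_{t+1})+\langle g(x_{t+1}),x-x_{t+1}\rangle\big).$$ Conditionally on the history, the stochastic gradients $G_1(v_t)$ and $g(x_{t+1})$ are unbiased estimates of $\nabla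 f(v_t)$ and $\nabla f(x_{t+1})$ with variance at most $\sigma_1^2$. The inexact derivatives $G_i(v_t)$, $2\le i\le p$, are symmetric $i$-linear forms that almost surely satisfy $\|(G_i(v_t)-\nabla^if(v_t))[x_{t+1}-v_t]^{i-1}\|\le\sigma_i\|x_{t+1}-v_t\|^{i-1}$. *Restarts.* For $s=1,2,\dots$ let $r_{s-1}=2^{-(s-1)}R$ and $R_{s-1}=\|z_{s-1}-x^*\|$. Run the inner method from $x_0=z_{s-1}$, with a positive $\rho$ that lies between $R_{s-1}$ and $r_{s-1}$ (for example, either of the two) and depends only on the history, for $$t_s=\Big\lceil C\max\Big\{1,\big(\tfrac{\tau}{\mu r_{s-1}}\big)^2,\big(\tfrac{\sigma_1}{\mu r_{s-1}}\big)^2,\max_{2\le i\le p}\big(\tfrac{\sigma_iR_{s-1}^{i-2}}{\mu}\big)^{1/i},\big(\tfrac{L_pR_{s-1}^{p-1}}{\mu}\big)^{1/(p+1)}\Big\}\Big\rceil$$ iterations, and let $z_s=x_{t_s}$. *Claim.* If the constants $a_\delta,a_\lambda,a_2,\dots,a_{p+1}$ are all at least some $a_0>0$ that depends only on $p$, $(\eta_i)$,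 $c_M$, and if $C$ is at least some $C_0>0$ that depends only on these data and on the constants $a_\delta,a_\lambda,a_i$, then $$\mathbb E\|z_s-x^*\|^2\le4^{-s}R^2\quad(s\ge0),\qquad \mathbb E f(z_s)-f^*\le2^{-2s-1}\mu R^2\quad(s\ge1).$$ Moreover there is a constant $K$ that depends only on $p$, $(\eta_i)$, $c_M$, $a_\delta,a_\lambda,(a_i)$ and $C$ such that, if $\mu R^2\le2(f(z_0)-f^*)$ (which holds when $R=\|z_0-x^*\|$), then for every $\varepsilon>0$ with $\varepsilon\le\mu R^2$ and $2\varepsilon\le f(z_0)-f^*$ there is an $S$ with $\mathbb Ef(z_S)-f^*\le\varepsilon$ for which the total number of iterations satisfies $$\mathbb E\sum_{s=1}^St_s\le K\Big(\tfrac{(\tau+\sigma_1)^2}{\mu\varepsilon}+\Big(\sqrt{\tfrac{\sigma_2}\mu}+1\Big)\log\tfrac{f(z_0)-f^*}{\varepsilon}+\sum_{i=3}^p\big(\tfrac{\sigma_iR^{i-2}}{\mu}\big)^{1/i}+\big(\tfrac{L_pR^{p-1}}\mu\big)^{1/(p+1)}\Big).$$ -/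

import Mathlib

open MeasureTheory

noncomputable section

namespace TensorRestart

/-- The Euclidean space `ℝ^d`. -/
abbrev Vec (d : ℕ) : Type := EuclideanSpace ℝ (Fin d)

/-- `p` times (continuously) differentiable, with an `L`-Lipschitz `p`-th derivative in the
operator norm of `p`-linear forms. -/
def HasLipschitzDeriv {d : ℕ} (p : ℕ) (L : ℝ) (f : Vec d → ℝ) : Prop :=
  ContDiff ℝ (p : ℕ∞) f ∧
    ∀ x y, ‖iteratedFDeriv ℝ p f x - iteratedFDeriv ℝ p f y‖ ≤ L * ‖x - y‖

/-- `α_t = (p + 1) / (t + p + 1)`. -/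
def alpha (p t : ℕ) : ℝ := ((p : ℝ) + 1) / ((t : ℝ) + p + 1)

/-- `A_t = ∏_{j = 1}^t (1 - α_j)`, so that `A_0 = 1`. -/
def bigA (p t : ℕ) : ℝ := ∏ j ∈ Finset.Icc 1 t, (1 - alpha p j)

/-- The numbers that the accelerated stochastic tensor method is run with: the order `p`, the
regularization constant `M`, the tolerance `τ` of the subproblem, the noise level `σ 1` of the
gradients, the inexactness levels `σ i` of the derivatives of order `2 ≤ i ≤ p`, the weights `η i`
of the model, and the constants `aD`, `aL`, `aK i` hidden in the `O(·)` of the parameter choice. -/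
structure Param where
  p : ℕ
  M : ℝ
  τ : ℝ
  σ : ℕ → ℝ
  η : ℕ → ℝ
  aD : ℝ
  aL : ℝ
  aK : ℕ → ℝ

namespace Param

variable (Q : Param)

/-- `δ̄_t = aD (σ_2 + (σ_1 + τ) / ρ · (t + p + 1)^{3/2})`, where `ρ` is the distance parameter. -/
def deltaBar (ρ : ℝ) (t : ℕ) : ℝ :=
  Q.aD * (Q.σ 2 + (Q.σ 1 + Q.τ) / ρ * ((t : ℝ) + Q.p + 1) ^ ((3 : ℝ) / 2))

/-- `λ_t = aL σ_1 / ρ · (t + p + 1)^{p + 1/2}`. -/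
def lam (ρ : ℝ) (t : ℕ) : ℝ :=
  Q.aL * (Q.σ 1 / ρ * ((t : ℝ) + Q.p + 1) ^ ((Q.p : ℝ) + 1 / 2))

/-- `κ̄_2^t = aK_2 δ̄_t α_t^2 / A_t`, `κ̄_i^t = aK_i α_t^i σ_i / A_t` for `3 ≤ i ≤ p`, and
`κ̄_{p+1}^t = aK_{p+1} α_t^{p+1} M / A_t`. -/
def kappa (ρ : ℝ) (i t : ℕ) : ℝ :=
  Q.aK i * (alpha Q.p t ^ i / bigA Q.p t *
    (if i = 2 then Q.deltaBar ρ t else if i = Q.p + 1 then Q.M else Q.σ i))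

/-- The inexact Taylor polynomial `φ_{x,p}(y)` built from an approximate gradient `g` and
approximate derivatives `H i` of order `2 ≤ i ≤ p` at `x`. -/
def taylor {d : ℕ} (f : Vec d → ℝ) (g : Vec d)
    (H : (i : ℕ) → ContinuousMultilinearMap ℝ (fun _ : Fin i => Vec d) ℝ) (x y : Vec d) : ℝ :=
  f x + inner ℝ g (y - x) +
    ∑ i ∈ Finset.Icc 2 Q.p, (1 / (Nat.factorial i : ℝ)) * H i (fun _ => y - x)

/-- The regularized model `ω_{x,p}^{M,δ̄}(y)`. -/
def omega {d : ℕ} (f : Vec d → ℝ) (δbar : ℝ) (g : Vec d)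
    (H : (i : ℕ) → ContinuousMultilinearMap ℝ (fun _ : Fin i => Vec d) ℝ) (x y : Vec d) : ℝ :=
  Q.taylor f g H x y + δbar / 2 * ‖x - y‖ ^ 2
    + ∑ i ∈ Finset.Icc 3 Q.p, Q.η i * Q.σ i / (Nat.factorial i : ℝ) * ‖x - y‖ ^ i
    + (Q.p : ℝ) * Q.M / (Nat.factorial (Q.p + 1) : ℝ) * ‖x - y‖ ^ (Q.p + 1)

/-- The estimating sequence `ψ_t`. Here `x t` are the iterates, `gx t` is the stochastic gradient
obtained at `x (t + 1)`, and `f (x (t + 1)) + ⟨gx t, u - x (t + 1)⟩` is the linear model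
`l(u, x_{t+1})`. -/
def psi {d : ℕ} (f : Vec d → ℝ) (ρ : ℝ) (x₀ : Vec d) (x gx : ℕ → Vec d) : ℕ → Vec d → ℝ
  | 0, u => Q.lam ρ 0 / 2 * ‖u - x₀‖ ^ 2
      + ∑ i ∈ Finset.Icc 2 (Q.p + 1),
          Q.kappa ρ i 0 / (Nat.factorial i : ℝ) * ‖u - x₀‖ ^ i
  | t + 1, u => psi f ρ x₀ x gx t u
      + (Q.lam ρ (t + 1) - Q.lam ρ t) / 2 * ‖u - x₀‖ ^ 2
      + ∑ i ∈ Finset.Icc 2 (Q.p + 1),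
          (Q.kappa ρ i (t + 1) - Q.kappa ρ i t) / (Nat.factorial i : ℝ) * ‖u - x₀‖ ^ i
      + alpha Q.p t / bigA Q.p t * (f (x (t + 1)) + inner ℝ (gx t) (u - x (t + 1)))

/-- `v_t = (1 - α_t) x_t + α_t y_t`. -/
def vPoint {d : ℕ} (x y : ℕ → Vec d) (t : ℕ) : Vec d :=
  (1 - alpha Q.p t) • x t + alpha Q.p t • y t

/-- `(x, y)` is a trajectory of the accelerated stochastic tensor method started at `x₀` with
distance parameter `ρ`; in iteration `t` the oracle has returned the gradient estimate `gv t` and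
the derivative estimates `H t i` at `v_t`, and the gradient estimate `gx t` at `x_{t+1}`. -/
structure IsTrajectory {d : ℕ} (f : Vec d → ℝ) (ρ : ℝ) (x₀ : Vec d) (x y gv gx : ℕ → Vec d)
    (H : ℕ → (i : ℕ) → ContinuousMultilinearMap ℝ (fun _ : Fin i => Vec d) ℝ) : Prop where
  x_zero : x 0 = x₀
  y_zero : y 0 = x₀
  x_step : ∀ t, ‖gradient (Q.omega f (Q.deltaBar ρ t) (gv t) (H t) (Q.vPoint x y t))
    (x (t + 1))‖ ≤ Q.τ
  y_step : ∀ t, IsMinOn (Q.psi f ρ x₀ x gx (t + 1)) Set.univ (y (t + 1))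

/-- The estimates `H i`, `2 ≤ i ≤ p`, of the derivatives of `f` at `v` are symmetric `i`-linear
forms with `‖(H i - ∇^i f(v))[x - v]^{i-1}‖ ≤ σ_i ‖x - v‖^{i-1}` (below, `i = j + 1`). -/
def InexactDerivs {d : ℕ} (f : Vec d → ℝ)
    (H : (i : ℕ) → ContinuousMultilinearMap ℝ (fun _ : Fin i => Vec d) ℝ) (v x : Vec d) : Prop :=
  ∀ j, 1 ≤ j → j + 1 ≤ Q.p →
    (∀ (π : Equiv.Perm (Fin (j + 1))) (w : Fin (j + 1) → Vec d),
      H (j + 1) (fun k => w (π k)) = H (j + 1) w) ∧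
    ‖(H (j + 1) - iteratedFDeriv ℝ (j + 1) f v).curryRight (fun _ => x - v)‖
      ≤ Q.σ (j + 1) * ‖x - v‖ ^ j

/-- The number of inner iterations of a restart, `⌈C · max{…}⌉`, with `r` the prescribed radius
and `Rcur` the distance of the starting point of the restart to the minimizer. -/
def restartLength (μ L C r Rcur : ℝ) : ℕ :=
  ⌈C * max ((Finset.Icc 2 Q.p).fold max 1
              (fun i => (Q.σ i * Rcur ^ (i - 2) / μ) ^ (1 / (i : ℝ))))
        (max ((Q.τ / (μ * r)) ^ 2)
          (max ((Q.σ 1 / (μ * r)) ^ 2)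
            ((L * Rcur ^ (Q.p - 1) / μ) ^ (1 / ((Q.p : ℝ) + 1)))))⌉₊

end Param

/-- Given the history `m`, the random vector `g` is an unbiased estimate of `∇f` at the (random,
`m`-measurable) query point `q`, with conditional variance at most `σ₁²`. The conditional mean is
written for the error `g - ∇f(q)`, because `∇f(q)` itself need not be integrable. -/
def IsStochGrad {d : ℕ} {Ω : Type*} [mΩ : MeasurableSpace Ω] (P : Measure Ω)
    (f : Vec d → ℝ) (σ₁ : ℝ) (m : MeasurableSpace Ω) (q g : Ω → Vec d) : Prop :=
  MemLp (fun w => g w - gradient f (q w)) 2 P ∧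
  P[fun w => g w - gradient f (q w) | m] =ᵐ[P] 0 ∧
  P[fun w => ‖g w - gradient f (q w)‖ ^ 2 | m] ≤ᵐ[P] fun _ => σ₁ ^ 2

/-- The random sequence `z` is generated by the restarted accelerated stochastic tensor method.
Restart `s` (counted from `0`) starts at `z s` and runs the tensor method, whose trajectory is
`x s, y s`; the σ-algebra `F s t` is the history before the oracle is called at `v_t`, and `G s t`
is the history after `x_{t+1}` has been computed, before the oracle is called at `x_{t+1}`.
The distance parameter `ρ s` of restart `s` is a positive number between the two radii of that
restart, `‖z s - x⋆‖` and `R / 2^s` (it may be either of them). -/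
structure IsRestartedRun {d : ℕ} {Ω : Type*} [mΩ : MeasurableSpace Ω] (P : Measure Ω)
    (Q : Param) (f : Vec d → ℝ) (xstar : Vec d) (μ L C R : ℝ) (z₀ : Vec d)
    (z : ℕ → Ω → Vec d) (ρ : ℕ → Ω → ℝ) (x y gv gx : ℕ → ℕ → Ω → Vec d)
    (H : ℕ → ℕ → Ω → (i : ℕ) → ContinuousMultilinearMap ℝ (fun _ : Fin i => Vec d) ℝ)
    (F G : ℕ → ℕ → MeasurableSpace Ω) : Prop where
  F_le : ∀ s t, F s t ≤ mΩ
  G_le : ∀ s t, G s t ≤ mΩ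
  F_le_G : ∀ s t, F s t ≤ G s t
  G_le_F : ∀ s t, G s t ≤ F s (t + 1)
  z_meas : ∀ s, StronglyMeasurable[F s 0] (z s)
  ρ_meas : ∀ s, StronglyMeasurable[F s 0] (ρ s)
  x_meas : ∀ s t, StronglyMeasurable[F s t] (x s t)
  y_meas : ∀ s t, StronglyMeasurable[F s t] (y s t)
  x_succ_meas : ∀ s t, StronglyMeasurable[G s t] (x s (t + 1))
  z_zero : ∀ w, z 0 w = z₀
  ρ_pos : ∀ s, ∀ᵐ w ∂P, 0 < ρ s w
  ρ_mem : ∀ s, ∀ᵐ w ∂P, ρ s w ∈ Set.uIcc ‖z s w - xstar‖ (R / 2 ^ s)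
  trajectory : ∀ s, ∀ᵐ w ∂P, Q.IsTrajectory f (ρ s w) (z s w)
    (fun t => x s t w) (fun t => y s t w) (fun t => gv s t w) (fun t => gx s t w)
    (fun t => H s t w)
  grad_v : ∀ s t, IsStochGrad P f (Q.σ 1) (F s t)
    (fun w => Q.vPoint (fun k => x s k w) (fun k => y s k w) t) (gv s t)
  grad_x : ∀ s t, IsStochGrad P f (Q.σ 1) (G s t) (x s (t + 1)) (gx s t)
  derivs : ∀ s t, ∀ᵐ w ∂P, Q.InexactDerivs f (H s t w)
    (Q.vPoint (fun k => x s k w) (fun k => y s k w) t) (x s (t + 1) w)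
  z_succ : ∀ s, ∀ᵐ w ∂P,
    z (s + 1) w = x s (Q.restartLength μ L C (R / 2 ^ s) ‖z s w - xstar‖) w

end TensorRestart

end

noncomputable section

namespace TensorRestart

/-! ### The weights of the estimating sequence -/

/-! The inner method is an estimating-sequence argument. The weights `α_j / A_j` with `j < t` add up
to `1 / A_{t-1}`, which is of exact order `t^(p+1)`. By induction, this weight times `f(x_t)` is at
most `min ψ_t` plus accumulated errors (`weighted_value_le_psi`).

One step rests on two facts. The Taylor and inexactness errors in the gradient of the model are at
most half the gradient of the regularizer, so an approximate stationary point satisfies `∇f(x) + ζ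
(x - v) ≈ 0`, where `ζ` is the curvature of the regularizer at distance `‖x - v‖`
(`norm_gradient_add_curvature_le`). Squaring this relation shows that the progress `⟨∇f(x), v - x⟩`
pays for `‖∇f(x)‖ q` with any `q ≥ 0`, at the price of `Δ² / δ̄` and of powers `q^i`
(`norm_gradient_mul_le`). With `q = α_t ‖y_{t+1} - y_t‖` these powers are absorbed by the uniform
convexity of `ψ_t` (`psi_growth`); its quadratic part with coefficient `λ_t` absorbs the gradient
noise.

Comparing `min ψ_t` with `ψ_t(x⋆)` leaves the noise in the form `⟨n_j, x⋆ - y_j⟩`, whose mean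
vanishes since `y_j` is known before the oracle call (`weighted_gap_le`, `lintegral_gap_le`).
Dividing by the weight gives an expected gap of order `rate`: a stochastic part of order `T^(-1/2)`,
and parts `σ_i r^i / T^i` and `M r^(p+1) / T^(p+1)`.

A restart length is chosen so that each part of `rate` is a small multiple of `μ (‖z - x⋆‖² + r²)`.
The length depends on the random starting point, so the estimate is proved on each of countably many
events of the initial history on which the length is constant and everything is bounded, and then
summed (`lintegral_restart_le`). Strong convexity turns the small expected gap into a mean squared
distance four times smaller than the prescribed one, and the induction over restarts closes
(`integral_restart_le`).

For the iteration count, the random radius enters each length through powers dominated by `1 + ‖z -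
x⋆‖² / r²`, of mean at most 2. The gradient parts grow like `4^s` and are governed by the last
restart; the order-2 part is the same in each restart and yields the logarithm; all higher parts
decay geometrically. -/

lemma alpha_zero (p : ℕ) : alpha p 0 = 1 := by
  have : (p : ℝ) + 1 ≠ 0 := by positivity
  simp [alpha, this]

lemma alpha_pos (p t : ℕ) : 0 < alpha p t := by
  unfold alpha; positivity

lemma one_sub_alpha (p t : ℕ) : 1 - alpha p t = (t : ℝ) / ((t : ℝ) + p + 1) := by
  have : (t : ℝ) + p + 1 ≠ 0 := by positivity
  unfold alpha; field_simp; ring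

lemma bigA_succ (p t : ℕ) : bigA p (t + 1) = bigA p t * (1 - alpha p (t + 1)) := by
  unfold bigA
  rw [Finset.prod_Icc_succ_top (by omega)]

lemma bigA_zero (p : ℕ) : bigA p 0 = 1 := by simp [bigA]

lemma bigA_pos (p t : ℕ) : 0 < bigA p t := by
  induction t with
  | zero => simp [bigA_zero]
  | succ t ih =>
    rw [bigA_succ, one_sub_alpha]
    exact mul_pos ih (by positivity)

lemma inv_bigA_pos (p t : ℕ) : 0 < (bigA p t)⁻¹ := inv_pos.2 (bigA_pos p t)

lemma inv_bigA_succ (p t : ℕ) :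
    (bigA p (t + 1))⁻¹ = (bigA p t)⁻¹ * (((t : ℝ) + p + 2) / ((t : ℝ) + 1)) := by
  rw [bigA_succ, one_sub_alpha, mul_inv, inv_div]
  push_cast; ring

lemma inv_bigA_succ_mul (p t : ℕ) :
    (bigA p (t + 1))⁻¹ * (1 - alpha p (t + 1)) = (bigA p t)⁻¹ := by
  rw [inv_bigA_succ, one_sub_alpha]
  have : (t : ℝ) + 1 ≠ 0 := by positivity
  have : (t : ℝ) + p + 2 ≠ 0 := by positivity
  push_cast
  field_simp
  ring

lemma inv_bigA_succ_le (p t : ℕ) :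
    (bigA p (t + 1))⁻¹ ≤ ((p : ℝ) + 2) * (bigA p t)⁻¹ := by
  rw [inv_bigA_succ, mul_comm]
  gcongr
  · exact (inv_bigA_pos p t).le
  · rw [div_le_iff₀ (by positivity)]
    nlinarith [mul_nonneg (Nat.cast_nonneg (α := ℝ) t) (Nat.cast_nonneg (α := ℝ) p),
      Nat.cast_nonneg (α := ℝ) t]

/-- The product telescopes to a binomial coefficient, which supplies the upper half of `1 / A_t ≍
t^(p+1)`. -/
lemma inv_bigA_eq_choose (p t : ℕ) :
    (bigA p t)⁻¹ = ((t + p + 1).choose (p + 1) : ℝ) := by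
  induction t with
  | zero => simp [bigA_zero]
  | succ t ih =>
    rw [inv_bigA_succ, ih]
    have h := Nat.choose_mul_succ_eq (t + p + 1) (p + 1)
    have h1 : t + p + 1 + 1 - (p + 1) = t + 1 := by omega
    rw [h1] at h
    have h2 : t + 1 + p + 1 = t + p + 1 + 1 := by omega
    rw [h2, ← mul_div_assoc, div_eq_iff (by positivity)]
    have h3 : (((t + p + 1).choose (p + 1) * (t + p + 1 + 1) : ℕ) : ℝ)
      = (((t + p + 1 + 1).choose (p + 1) * (t + 1) : ℕ) : ℝ) := by exact_mod_cast h
    push_cast at h3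
    rw [← h3]; ring

lemma inv_bigA_le_pow (p t : ℕ) : (bigA p t)⁻¹ ≤ ((t : ℝ) + p + 1) ^ (p + 1) := by
  rw [inv_bigA_eq_choose]
  exact_mod_cast Nat.choose_le_pow (t + p + 1) (p + 1)

/-- Passing from `t` to `t + 1` multiplies `α^i` by `(1 - 1/(t+p+2))^i` and `1/A` by
`(t+p+2)/(t+1)`. Bernoulli's inequality with exponent `p + 1` shows that the product of the two
factors is at least 1. This makes the coefficients `κ̄` nondecreasing. -/
lemma alpha_pow_mul_inv_bigA_mono {p i : ℕ} (hi : i ≤ p + 1) (t : ℕ) :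
    alpha p t ^ i * (bigA p t)⁻¹ ≤ alpha p (t + 1) ^ i * (bigA p (t + 1))⁻¹ := by
  have hN : (0 : ℝ) < (t : ℝ) + p + 1 := by positivity
  have hN2 : (0 : ℝ) < (t : ℝ) + p + 2 := by positivity
  have hα : alpha p (t + 1) = alpha p t * (1 - 1 / ((t : ℝ) + p + 2)) := by
    unfold alpha; push_cast; field_simp; ring
  have hx : 0 ≤ 1 - 1 / ((t : ℝ) + p + 2) := by
    rw [sub_nonneg, div_le_one hN2]; linarith
  have hx1 : 1 - 1 / ((t : ℝ) + p + 2) ≤ 1 := by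
    have : 0 < 1 / ((t : ℝ) + p + 2) := by positivity
    linarith
  have hb : ((t : ℝ) + 1) / ((t : ℝ) + p + 2) ≤ (1 - 1 / ((t : ℝ) + p + 2)) ^ i := by
    have h1 : (1 - 1 / ((t : ℝ) + p + 2)) ^ (p + 1) ≤ (1 - 1 / ((t : ℝ) + p + 2)) ^ i :=
      pow_le_pow_of_le_one hx hx1 hi
    have h2 := one_add_mul_le_pow (a := -(1 / ((t : ℝ) + p + 2))) (by linarith) (p + 1)
    rw [← sub_eq_add_neg] at h2
    refine le_trans (le_of_eq ?_) (h2.trans h1)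
    push_cast; field_simp; ring
  rw [hα, inv_bigA_succ, mul_pow]
  have h3 : 1 ≤ (1 - 1 / ((t : ℝ) + p + 2)) ^ i * (((t : ℝ) + p + 2) / ((t : ℝ) + 1)) := by
    rw [div_le_iff₀ hN2] at hb
    rw [← mul_div_assoc, le_div_iff₀ (by positivity), one_mul]; exact hb
  have h4 : 0 ≤ alpha p t ^ i * (bigA p t)⁻¹ :=
    mul_nonneg (pow_nonneg (alpha_pos p t).le _) (inv_bigA_pos p t).le
  calc alpha p t ^ i * (bigA p t)⁻¹ = alpha p t ^ i * (bigA p t)⁻¹ * 1 := by ring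
    _ ≤ alpha p t ^ i * (bigA p t)⁻¹ *
        ((1 - 1 / ((t : ℝ) + p + 2)) ^ i * (((t : ℝ) + p + 2) / ((t : ℝ) + 1))) := by gcongr
    _ = _ := by ring

lemma one_le_alpha_pow_mul_inv_bigA (p t : ℕ) : 1 ≤ alpha p t ^ (p + 1) * (bigA p t)⁻¹ := by
  induction t with
  | zero => simp [alpha_zero, bigA_zero]
  | succ t ih => exact ih.trans (alpha_pow_mul_inv_bigA_mono le_rfl t)

/-- The case `i = p + 1` of the monotonicity, started from the value 1 at `t = 0`: the lower half of
`1 / A_t ≍ t^(p+1)`. -/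
lemma pow_le_inv_bigA (p t : ℕ) :
    ((t : ℝ) + p + 1) ^ (p + 1) ≤ ((p : ℝ) + 1) ^ (p + 1) * (bigA p t)⁻¹ := by
  have h := one_le_alpha_pow_mul_inv_bigA p t
  have hN : (0 : ℝ) < ((t : ℝ) + p + 1) ^ (p + 1) := by positivity
  unfold alpha at h
  rw [div_pow, div_mul_eq_mul_div, le_div_iff₀ hN, one_mul] at h
  exact h

lemma alpha_div_bigA_eq (p t : ℕ) :
    alpha p t / bigA p t = alpha p t * (bigA p t)⁻¹ := div_eq_mul_inv _ _

lemma alpha_le_div {p t : ℕ} (ht : 1 ≤ t) : alpha p t ≤ ((p : ℝ) + 1) / t := by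
  have : (0 : ℝ) < t := by exact_mod_cast ht
  unfold alpha
  gcongr
  linarith [Nat.cast_nonneg (α := ℝ) p]

/-! ### A Taylor bound for the gradient -/

/-- The family `φ` stands for the successive derivatives of `φ 0`. The induction hypothesis for the
shifted family bounds the derivative of the remainder, and comparison with the derivative of `c
s^(n+1) / (n+1)!` integrates it. Only a Lipschitz-type bound on the last member is needed, not one
more derivative. -/
lemma abs_taylor_sub_le {n : ℕ} {c : ℝ} (φ : ℕ → ℝ → ℝ)
    (hφ : ∀ j < n, ∀ s, HasDerivAt (φ j) (φ (j + 1) s) s)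
    (hL : ∀ s, 0 ≤ s → |φ n s - φ n 0| ≤ c * s) {s : ℝ} (hs : 0 ≤ s) :
    |φ 0 s - ∑ j ∈ Finset.range (n + 1), s ^ j / (j.factorial : ℝ) * φ j 0|
      ≤ c * s ^ (n + 1) / ((n + 1).factorial : ℝ) := by
  induction n generalizing φ s with
  | zero => simpa using hL s hs
  | succ n ih =>
    have key := fun u (hu : 0 ≤ u) => ih (fun j => φ (j + 1))
      (fun j hj u => hφ (j + 1) (by omega) u) hL (s := u) hu
    set g : ℝ → ℝ := fun u => φ 0 u -
      ∑ j ∈ Finset.range (n + 1 + 1), u ^ j / (j.factorial : ℝ) * φ j 0 with hg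
    have hder : ∀ u, HasDerivAt g (φ 1 u -
        ∑ j ∈ Finset.range (n + 1), u ^ j / (j.factorial : ℝ) * φ (j + 1) 0) u := by
      intro u
      have h1 : HasDerivAt (fun u : ℝ =>
          ∑ j ∈ Finset.range (n + 1 + 1), u ^ j / (j.factorial : ℝ) * φ j 0)
          (∑ j ∈ Finset.range (n + 1 + 1), ((j : ℝ) * u ^ (j - 1)) / (j.factorial : ℝ) * φ j 0) u :=
        HasDerivAt.fun_sum fun j _ => ((hasDerivAt_pow j u).div_const _).mul_const _
      rw [Finset.sum_range_succ'] at h1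
      have h2 : ∑ j ∈ Finset.range (n + 1),
          (((j + 1 : ℕ) : ℝ) * u ^ (j + 1 - 1)) / ((j + 1).factorial : ℝ) * φ (j + 1) 0
          = ∑ j ∈ Finset.range (n + 1), u ^ j / (j.factorial : ℝ) * φ (j + 1) 0 := by
        refine Finset.sum_congr rfl fun j _ => ?_
        have : (j.factorial : ℝ) ≠ 0 := by positivity
        rw [Nat.factorial_succ, Nat.add_sub_cancel]
        push_cast
        field_simp
      rw [h2] at h1
      rw [Nat.cast_zero, zero_mul, zero_div, zero_mul, add_zero] at h1
      exact (hφ 0 (by omega) u).sub h1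
    have hB : ∀ u : ℝ, HasDerivAt (fun u => c * u ^ (n + 1 + 1) / ((n + 1 + 1).factorial : ℝ))
        (c * u ^ (n + 1) / ((n + 1).factorial : ℝ)) u := by
      intro u
      have h := (((hasDerivAt_pow (n + 1 + 1) u).const_mul c).div_const
        ((n + 1 + 1).factorial : ℝ))
      refine h.congr_deriv ?_
      have : ((n + 1).factorial : ℝ) ≠ 0 := by positivity
      rw [Nat.factorial_succ (n + 1), Nat.add_sub_cancel]
      push_cast
      field_simp
    have h0 : g 0 = 0 := by
      simp [hg, Finset.sum_range_succ']
    have := image_norm_le_of_norm_deriv_right_le_deriv_boundary (f := g) (a := 0) (b := s)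
      (fun u _ => (hder u).continuousAt.continuousWithinAt)
      (fun u _ => (hder u).hasDerivWithinAt) (by simp [h0]) hB
      (fun u hu => by rw [Real.norm_eq_abs]; exact key u hu.1)
    simpa [Real.norm_eq_abs, hg] using this (Set.right_mem_Icc.2 hs)

lemma cons_snoc_const {E : Type*} (j : ℕ) (h w : E) :
    (Fin.cons h (Fin.snoc (fun _ : Fin j => h) w : Fin (j + 1) → E) : Fin (j + 2) → E)
      = Fin.snoc (fun _ : Fin (j + 1) => h) w := by
  rw [Fin.cons_snoc_eq_snoc_cons]
  congr 1
  ext i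
  refine Fin.cases ?_ (fun k => ?_) i <;> simp

variable {d : ℕ}

/-- Differentiation along the line inserts `h` as a new first argument. Keeping the test vector `w`
in the last slot therefore leads to the next member of the family that `abs_taylor_sub_le` requires.
-/
lemma hasDerivAt_iteratedFDeriv_line {f : Vec d → ℝ} {p j : ℕ} (hf : ContDiff ℝ (p : ℕ∞) f)
    (hj : j + 1 < p) (v h w : Vec d) (s : ℝ) :
    HasDerivAt (fun s : ℝ => iteratedFDeriv ℝ (j + 1) f (v + s • h)
        (Fin.snoc (fun _ : Fin j => h) w))
      (iteratedFDeriv ℝ (j + 2) f (v + s • h) (Fin.snoc (fun _ : Fin (j + 1) => h) w)) s := by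
  have hd : Differentiable ℝ (iteratedFDeriv ℝ (j + 1) f) :=
    hf.differentiable_iteratedFDeriv (by exact_mod_cast hj)
  have hl : HasDerivAt (fun s : ℝ => v + s • h) h s := by
    simpa using ((hasDerivAt_id s).smul_const h).const_add v
  have h1 := (hd (v + s • h)).hasFDerivAt.comp_hasDerivAt s hl
  have h2 := (ContinuousMultilinearMap.apply ℝ (fun _ : Fin (j + 1) => Vec d) ℝ
    (Fin.snoc (fun _ : Fin j => h) w)).hasFDerivAt.comp_hasDerivAt s h1
  refine h2.congr_deriv ?_
  rw [iteratedFDeriv_succ_apply_left, ← cons_snoc_const]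
  simp

lemma snoc_prod_norm (j : ℕ) (h w : Vec d) :
    ∏ i : Fin (j + 1), ‖(Fin.snoc (fun _ : Fin j => h) w : Fin (j + 1) → Vec d) i‖
      = ‖h‖ ^ j * ‖w‖ := by
  rw [Fin.prod_univ_castSucc]
  simp

lemma HasLipschitzDeriv.differentiable {f : Vec d → ℝ} {p : ℕ} {L : ℝ}
    (hf : HasLipschitzDeriv p L f) (hp : 1 ≤ p) : Differentiable ℝ f :=
  hf.1.differentiable (by
    have : p ≠ 0 := by omega
    exact_mod_cast this)

/-- The gradient of a function with `L`-Lipschitz `p`-th derivative is approximated by its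
Taylor polynomial up to `L ‖h‖ ^ p / p!`. -/
lemma HasLipschitzDeriv.abs_inner_gradient_sub_le {f : Vec d → ℝ} {p : ℕ} {L : ℝ}
    (hf : HasLipschitzDeriv p L f) (hp : 1 ≤ p) (v h w : Vec d) :
    |inner ℝ (gradient f (v + h)) w - ∑ j ∈ Finset.range p,
      (1 / (j.factorial : ℝ)) *
        iteratedFDeriv ℝ (j + 1) f v (Fin.snoc (fun _ : Fin j => h) w)|
      ≤ L * ‖h‖ ^ p * ‖w‖ / (p.factorial : ℝ) := by
  obtain ⟨n, rfl⟩ : ∃ n, p = n + 1 := ⟨p - 1, by omega⟩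
  have key := abs_taylor_sub_le (n := n) (c := L * ‖h‖ ^ (n + 1) * ‖w‖)
    (fun j s => iteratedFDeriv ℝ (j + 1) f (v + s • h) (Fin.snoc (fun _ : Fin j => h) w))
    (fun j hj s => hasDerivAt_iteratedFDeriv_line hf.1 (by omega) v h w s)
    (fun s hs => by
      have h1 := (iteratedFDeriv ℝ (n + 1) f (v + s • h) -
        iteratedFDeriv ℝ (n + 1) f (v + (0 : ℝ) • h)).le_opNorm
          (Fin.snoc (fun _ : Fin n => h) w)
      rw [snoc_prod_norm, sub_apply, Real.norm_eq_abs] at h1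
      refine h1.trans ?_
      have h2 := hf.2 (v + s • h) (v + (0 : ℝ) • h)
      have h3 : v + s • h - (v + (0 : ℝ) • h) = s • h := by simp
      rw [h3, norm_smul, Real.norm_eq_abs, abs_of_nonneg hs] at h2
      calc _ ≤ L * (s * ‖h‖) * (‖h‖ ^ n * ‖w‖) := by gcongr
        _ = _ := by ring)
    (s := 1) zero_le_one
  have h1 : inner ℝ (gradient f (v + h)) w
      = iteratedFDeriv ℝ 1 f (v + h) (Fin.snoc (fun _ : Fin 0 => h) w) := by
    rw [iteratedFDeriv_one_apply, gradient, InnerProductSpace.toDual_symm_apply]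
    rfl
  rw [h1]
  simpa using key

/-! ### The gradient of the model -/

lemma sum_Icc_two_eq {A : Type*} [AddCommMonoid A] (F : ℕ → A) (p : ℕ) :
    ∑ i ∈ Finset.Icc 2 p, F i = ∑ j ∈ Finset.Ico 1 p, F (j + 1) := by
  rw [Finset.sum_Ico_add' F 1 p 1]
  refine Finset.sum_congr ?_ fun _ _ => rfl
  ext; simp

lemma sum_Icc_three_eq {A : Type*} [AddCommMonoid A] (F : ℕ → A) (p : ℕ) :
    ∑ i ∈ Finset.Icc 3 p, F i = ∑ j ∈ Finset.Ico 2 p, F (j + 1) := by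
  rw [Finset.sum_Ico_add' F 2 p 1]
  refine Finset.sum_congr ?_ fun _ _ => rfl
  ext; simp

lemma sum_Icc_two_succ {A : Type*} [AddCommMonoid A] (F : ℕ → A) {p : ℕ} (hp : 2 ≤ p) :
    ∑ i ∈ Finset.Icc 2 (p + 1), F i = F 2 + ∑ i ∈ Finset.Icc 3 p, F i + F (p + 1) := by
  rw [Finset.sum_Icc_succ_top (by omega), ← Finset.add_sum_Ioc_eq_sum_Icc hp]
  rfl

lemma hasFDerivAt_norm_sub_pow {i : ℕ} (hi : 2 ≤ i) (v y : Vec d) :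
    HasFDerivAt (fun y : Vec d => ‖v - y‖ ^ i)
      (((i : ℝ) * ‖y - v‖ ^ (i - 2)) • innerSL ℝ (y - v)) y := by
  have h := (hasFDerivAt_norm_rpow (y - v) (p := (i : ℝ)) (by exact_mod_cast hi)).comp y
    ((hasFDerivAt_id y).sub_const v)
  have e : ((i : ℝ) - 2) = ((i - 2 : ℕ) : ℝ) := by push_cast [hi]; ring
  rw [e, Real.rpow_natCast] at h
  refine (h.congr_of_eventuallyEq (Filter.Eventually.of_forall fun z => ?_)).congr_fderiv ?_
  · simp [norm_sub_rev v z]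
  · ext w; simp

/-- Differentiating the diagonal gives one term per slot; symmetry moves each perturbed slot to the
last position, so the `j + 1` terms coincide. -/
lemma hasFDerivAt_symmetric_diagonal {j : ℕ}
    (A : ContinuousMultilinearMap ℝ (fun _ : Fin (j + 1) => Vec d) ℝ)
    (hA : ∀ (π : Equiv.Perm (Fin (j + 1))) (w : Fin (j + 1) → Vec d),
      A (fun k => w (π k)) = A w) (v y : Vec d) :
    HasFDerivAt (fun y : Vec d => A (fun _ => y - v))
      (((j : ℝ) + 1) • A.curryRight (fun _ => y - v)) y := by
  have h := HasFDerivAt.multilinear_comp (f := A) (x := y)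
    (g := fun _ : Fin (j + 1) => fun z : Vec d => z - v)
    (g' := fun _ => ContinuousLinearMap.id ℝ (Vec d))
    (fun _ => (hasFDerivAt_id y).sub_const v)
  refine h.congr_fderiv ?_
  ext w
  have hk : ∀ k : Fin (j + 1), A (Function.update (fun _ => y - v) k w)
      = A (Fin.snoc (fun _ : Fin j => y - v) w) := by
    intro k
    rw [← hA (Equiv.swap k (Fin.last j))]
    congr 1
    ext1 m
    refine Fin.lastCases ?_ (fun m => ?_) m
    · simp
    · rw [Fin.snoc_castSucc]
      apply Function.update_of_ne
      intro hm
      rw [Equiv.swap_apply_eq_iff, Equiv.swap_apply_left] at hm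
      exact (Fin.castSucc_lt_last m).ne hm
  simp [hk]

namespace Param

variable (Q : Param)

/-- The coefficient of `s_i ‖y - v‖^(i-2) (y - v)` in the gradient of the regularizer of the
model. -/
def modelCoeff (i : ℕ) : ℝ :=
  if i = 2 then 1 else if i = Q.p + 1 then (Q.p : ℝ) / (Nat.factorial Q.p : ℝ)
    else Q.η i / (Nat.factorial (i - 1) : ℝ)

/-- The inexactness level of order `i`: `δ` for `i = 2`, `M` for `i = p + 1` and `σ i` otherwise. -/
def level (δ : ℝ) (i : ℕ) : ℝ :=
  if i = 2 then δ else if i = Q.p + 1 then Q.M else Q.σ i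

/-- The curvature of the regularizer of the model at distance `r` from its center. -/
def curvature (δ r : ℝ) : ℝ :=
  ∑ i ∈ Finset.Icc 2 (Q.p + 1), Q.modelCoeff i * Q.level δ i * r ^ (i - 2)

lemma curvature_eq (hp : 2 ≤ Q.p) (δ r : ℝ) :
    Q.curvature δ r = δ
      + ∑ i ∈ Finset.Icc 3 Q.p, Q.η i * Q.σ i / (Nat.factorial (i - 1) : ℝ) * r ^ (i - 2)
      + (Q.p : ℝ) * Q.M / (Nat.factorial Q.p : ℝ) * r ^ (Q.p - 1) := by
  rw [curvature, sum_Icc_two_succ _ hp]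
  have h3 : Q.p + 1 ≠ 2 := by omega
  have h4 : Q.p + 1 - 2 = Q.p - 1 := by omega
  congr 1
  · congr 1
    · simp [modelCoeff, level]
    · refine Finset.sum_congr rfl fun i hi => ?_
      rw [Finset.mem_Icc] at hi
      have h1 : i ≠ 2 := by omega
      have h2 : i ≠ Q.p + 1 := by omega
      simp only [modelCoeff, level, h1, h2, if_false]
      ring
  · simp only [modelCoeff, level, h3, h4, if_false, if_true]
    ring

lemma inner_gradient_omega (hp : 2 ≤ Q.p) (f : Vec d → ℝ) (δ : ℝ) (g : Vec d)
    (H : (i : ℕ) → ContinuousMultilinearMap ℝ (fun _ : Fin i => Vec d) ℝ) (v x w : Vec d)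
    (hH : ∀ j, 1 ≤ j → j + 1 ≤ Q.p → ∀ (π : Equiv.Perm (Fin (j + 1))) (w : Fin (j + 1) → Vec d),
      H (j + 1) (fun k => w (π k)) = H (j + 1) w) :
    inner ℝ (gradient (Q.omega f δ g H v) x) w = inner ℝ g w
      + ∑ j ∈ Finset.Ico 1 Q.p, (1 / (j.factorial : ℝ)) *
          (H (j + 1)).curryRight (fun _ => x - v) w
      + Q.curvature δ ‖x - v‖ * inner ℝ (x - v) w := by
  have h1 : HasFDerivAt (fun y : Vec d => ∑ i ∈ Finset.Icc 2 Q.p,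
      (1 / (Nat.factorial i : ℝ)) * H i (fun _ => y - v))
      (∑ j ∈ Finset.Ico 1 Q.p, (1 / ((j + 1).factorial : ℝ)) •
        (((j : ℝ) + 1) • (H (j + 1)).curryRight (fun _ => x - v))) x := by
    simp only [sum_Icc_two_eq]
    refine HasFDerivAt.fun_sum fun j hj => ?_
    rw [Finset.mem_Ico] at hj
    exact (hasFDerivAt_symmetric_diagonal (H (j + 1)) (hH j hj.1 (by omega)) v x).const_mul _
  have h2 : HasFDerivAt (fun y : Vec d => f v + inner ℝ g (y - v)) (innerSL ℝ g) x := by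
    have := ((innerSL ℝ g).hasFDerivAt (x := x - v)).comp x ((hasFDerivAt_id x).sub_const v)
    exact (this.const_add (f v))
  have h3 : HasFDerivAt (fun y : Vec d => δ / 2 * ‖v - y‖ ^ 2) _ x :=
    (hasFDerivAt_norm_sub_pow le_rfl v x).const_mul _
  have h4 : HasFDerivAt (fun y : Vec d => ∑ i ∈ Finset.Icc 3 Q.p,
      Q.η i * Q.σ i / (Nat.factorial i : ℝ) * ‖v - y‖ ^ i)
      (∑ i ∈ Finset.Icc 3 Q.p, (Q.η i * Q.σ i / (Nat.factorial i : ℝ)) •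
        (((i : ℝ) * ‖x - v‖ ^ (i - 2)) • innerSL ℝ (x - v))) x :=
    HasFDerivAt.fun_sum fun i hi => by
      rw [Finset.mem_Icc] at hi
      exact (hasFDerivAt_norm_sub_pow (by omega) v x).const_mul _
  have h5 : HasFDerivAt (fun y : Vec d =>
      (Q.p : ℝ) * Q.M / (Nat.factorial (Q.p + 1) : ℝ) * ‖v - y‖ ^ (Q.p + 1)) _ x :=
    (hasFDerivAt_norm_sub_pow (by omega) v x).const_mul _
  have h6 : HasFDerivAt (Q.omega f δ g H v) _ x := (((h2.add h1).add h3).add h4).add h5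
  rw [gradient, InnerProductSpace.toDual_symm_apply, h6.fderiv, Q.curvature_eq hp]
  simp only [add_apply, sum_apply,
    smul_apply, innerSL_apply_apply, smul_eq_mul, add_mul, Finset.sum_mul]
  have e1 : ∀ j : ℕ, ∀ c : ℝ, 1 / ((j + 1).factorial : ℝ) * ((j : ℝ) * c + 1 * c)
      = 1 / (j.factorial : ℝ) * c := by
    intro j c
    have : (j.factorial : ℝ) ≠ 0 := by positivity
    rw [Nat.factorial_succ]; push_cast; field_simp
  have e2 : ∀ i ∈ Finset.Icc 3 Q.p, Q.η i * Q.σ i / (Nat.factorial i : ℝ) *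
      ((i : ℝ) * ‖x - v‖ ^ (i - 2) * inner ℝ (x - v) w)
      = Q.η i * Q.σ i / (Nat.factorial (i - 1) : ℝ) * ‖x - v‖ ^ (i - 2) * inner ℝ (x - v) w := by
    intro i hi
    rw [Finset.mem_Icc] at hi
    obtain ⟨j, rfl⟩ : ∃ j, i = j + 1 := ⟨i - 1, by omega⟩
    have : (j.factorial : ℝ) ≠ 0 := by positivity
    rw [Nat.factorial_succ, Nat.add_sub_cancel]; push_cast; field_simp
  have e3 : (Q.p : ℝ) * Q.M / (Nat.factorial (Q.p + 1) : ℝ) *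
      (((Q.p + 1 : ℕ) : ℝ) * ‖x - v‖ ^ (Q.p + 1 - 2) * inner ℝ (x - v) w)
      = (Q.p : ℝ) * Q.M / (Nat.factorial Q.p : ℝ) * ‖x - v‖ ^ (Q.p - 1) * inner ℝ (x - v) w := by
    have : (Q.p.factorial : ℝ) ≠ 0 := by positivity
    have h4 : Q.p + 1 - 2 = Q.p - 1 := by omega
    rw [Nat.factorial_succ, h4]; push_cast; field_simp
  rw [Finset.sum_congr rfl e2, e3]
  simp only [e1]
  norm_num
  ring

end Param

lemma norm_le_of_forall_inner_le {u : Vec d} {c : ℝ} (hc : 0 ≤ c)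
    (h : ∀ w, inner ℝ u w ≤ c * ‖w‖) : ‖u‖ ≤ c := by
  have h1 := h u
  rw [real_inner_self_eq_norm_sq] at h1
  by_contra! h2
  nlinarith [norm_nonneg u]

namespace Param

variable (Q : Param)

lemma level_nonneg {δ : ℝ} (hδ : 0 ≤ δ) (hM : 0 ≤ Q.M)
    (hσ : ∀ i ∈ Finset.Icc 1 Q.p, 0 ≤ Q.σ i) {i : ℕ} (hi : i ∈ Finset.Icc 2 (Q.p + 1)) :
    0 ≤ Q.level δ i := by
  rw [Finset.mem_Icc] at hi
  unfold level
  split_ifs with h1 h2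
  · exact hδ
  · exact hM
  · exact hσ i (Finset.mem_Icc.2 ⟨by omega, by omega⟩)

lemma modelCoeff_nonneg (hη : ∀ i ∈ Finset.Icc 3 Q.p, 4 ≤ Q.η i) {i : ℕ}
    (hi : i ∈ Finset.Icc 2 (Q.p + 1)) : 0 ≤ Q.modelCoeff i := by
  rw [Finset.mem_Icc] at hi
  unfold modelCoeff
  split_ifs with h1 h2
  · exact zero_le_one
  · positivity
  · have := hη i (Finset.mem_Icc.2 ⟨by omega, by omega⟩)
    positivity

lemma curvature_nonneg {δ r : ℝ} (hδ : 0 ≤ δ) (hr : 0 ≤ r) (hM : 0 ≤ Q.M)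
    (hσ : ∀ i ∈ Finset.Icc 1 Q.p, 0 ≤ Q.σ i) (hη : ∀ i ∈ Finset.Icc 3 Q.p, 4 ≤ Q.η i) :
    0 ≤ Q.curvature δ r :=
  Finset.sum_nonneg fun _ hi => mul_nonneg (mul_nonneg (Q.modelCoeff_nonneg hη hi)
    (Q.level_nonneg hδ hM hσ hi)) (pow_nonneg hr _)

lemma le_curvature {δ r : ℝ} (hp : 2 ≤ Q.p) (hr : 0 ≤ r) (hM : 0 ≤ Q.M)
    (hσ : ∀ i ∈ Finset.Icc 1 Q.p, 0 ≤ Q.σ i) (hη : ∀ i ∈ Finset.Icc 3 Q.p, 4 ≤ Q.η i) :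
    δ ≤ Q.curvature δ r := by
  rw [Q.curvature_eq hp]
  have h1 : 0 ≤ ∑ i ∈ Finset.Icc 3 Q.p, Q.η i * Q.σ i / (Nat.factorial (i - 1) : ℝ) * r ^ (i - 2) :=
    Finset.sum_nonneg fun i hi => by
      have h2 := hη i hi
      rw [Finset.mem_Icc] at hi
      have h3 := hσ i (Finset.mem_Icc.2 ⟨by omega, by omega⟩)
      positivity
  have : 0 ≤ (Q.p : ℝ) * Q.M / (Nat.factorial Q.p : ℝ) * r ^ (Q.p - 1) := by positivity
  linarith

/-- An inexact stationary point of the model nearly satisfies the optimality condition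
`∇f(x) + ζ (x - v) = 0`, `ζ` being the curvature of the regularizer. -/
lemma norm_gradient_add_curvature_le (hp : 2 ≤ Q.p) {f : Vec d → ℝ} {L δ : ℝ}
    (hf : HasLipschitzDeriv Q.p L f) (hL : 0 ≤ L) (hLM : L ≤ Q.M)
    (hσ : ∀ i ∈ Finset.Icc 1 Q.p, 0 ≤ Q.σ i) (hη : ∀ i ∈ Finset.Icc 3 Q.p, 4 ≤ Q.η i)
    (hδ : 2 * Q.σ 2 ≤ δ) {g v x : Vec d}
    {H : (i : ℕ) → ContinuousMultilinearMap ℝ (fun _ : Fin i => Vec d) ℝ}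
    (hH : Q.InexactDerivs f H v x) (hx : ‖gradient (Q.omega f δ g H v) x‖ ≤ Q.τ) :
    ‖gradient f x + Q.curvature δ ‖x - v‖ • (x - v)‖
      ≤ Q.τ + ‖g - gradient f v‖ + Q.curvature δ ‖x - v‖ * ‖x - v‖ / 2 := by
  set h := x - v with hh
  set r := ‖h‖ with hr
  have hr0 : 0 ≤ r := norm_nonneg _
  have hM : 0 ≤ Q.M := hL.trans hLM
  have hσ2 : 0 ≤ Q.σ 2 := hσ 2 (Finset.mem_Icc.2 ⟨by omega, hp⟩)
  have hδ0 : 0 ≤ δ := by linarith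
  have hζ := Q.curvature_nonneg hδ0 hr0 hM hσ hη
  have hτ : 0 ≤ Q.τ := (norm_nonneg _).trans hx
  -- The total model error is at most half the gradient of the regularizer, term by term: `σ_2 ≤ δ /
  -- 2`, `1 ≤ η_i / 2`, and `L ≤ p M / 2` because `p ≥ 2`.
  have herr : ∑ j ∈ Finset.Ico 1 Q.p, Q.σ (j + 1) * r ^ j / (j.factorial : ℝ)
      + L * r ^ Q.p / (Q.p.factorial : ℝ) ≤ Q.curvature δ r * r / 2 := by
    rw [Q.curvature_eq hp, ← Finset.add_sum_Ioo_eq_sum_Ico (by omega : 1 < Q.p)]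
    have e0 : Finset.Ioo 1 Q.p = Finset.Ico 2 Q.p := by ext; simp; omega
    rw [e0, sum_Icc_three_eq]
    have e1 : Q.σ (1 + 1) * r ^ 1 / (Nat.factorial 1 : ℝ) ≤ δ * r / 2 := by
      norm_num
      nlinarith
    have e2 : ∑ j ∈ Finset.Ico 2 Q.p, Q.σ (j + 1) * r ^ j / (j.factorial : ℝ)
        ≤ (∑ j ∈ Finset.Ico 2 Q.p, Q.η (j + 1) * Q.σ (j + 1) /
          (Nat.factorial (j + 1 - 1) : ℝ) * r ^ (j + 1 - 2)) * r / 2 := by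
      rw [Finset.sum_mul, Finset.sum_div]
      refine Finset.sum_le_sum fun j hj => ?_
      rw [Finset.mem_Ico] at hj
      have h2 := hη (j + 1) (Finset.mem_Icc.2 ⟨by omega, by omega⟩)
      have h3 := hσ (j + 1) (Finset.mem_Icc.2 ⟨by omega, by omega⟩)
      obtain ⟨k, rfl⟩ : ∃ k, j = k + 2 := ⟨j - 2, by omega⟩
      have e : k + 2 + 1 - 2 = k + 1 := by omega
      rw [Nat.add_sub_cancel, e]
      have h4 : 0 ≤ Q.σ (k + 2 + 1) * r ^ (k + 2) / ((k + 2).factorial : ℝ) := by positivity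
      calc _ ≤ (Q.η (k + 2 + 1) / 2) * (Q.σ (k + 2 + 1) * r ^ (k + 2) / ((k + 2).factorial : ℝ)) := by
            nlinarith
        _ = _ := by ring
    have e3 : L * r ^ Q.p / (Q.p.factorial : ℝ)
        ≤ (Q.p : ℝ) * Q.M / (Nat.factorial Q.p : ℝ) * r ^ (Q.p - 1) * r / 2 := by
      have hp2 : (2 : ℝ) ≤ Q.p := by exact_mod_cast hp
      have e4 : r ^ Q.p = r ^ (Q.p - 1) * r := by
        rw [← pow_succ]; congr 1; omega
      have h4 : 0 ≤ r ^ (Q.p - 1) * r / (Q.p.factorial : ℝ) := by positivity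
      have h5 : L ≤ Q.p * Q.M / 2 := by nlinarith
      calc _ = L * (r ^ (Q.p - 1) * r / (Q.p.factorial : ℝ)) := by rw [e4]; ring
        _ ≤ (Q.p * Q.M / 2) * (r ^ (Q.p - 1) * r / (Q.p.factorial : ℝ)) := by gcongr
        _ = _ := by ring
    linarith
  refine norm_le_of_forall_inner_le (by positivity) fun w => ?_
  have h1 := Q.inner_gradient_omega hp f δ g H v x w (fun j hj hj' => (hH j hj hj').1)
  have h2 := hf.abs_inner_gradient_sub_le (by omega) v h w
  rw [show v + h = x by simp [hh]] at h2
  have h3 : ∑ j ∈ Finset.range Q.p, (1 / (j.factorial : ℝ)) *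
      iteratedFDeriv ℝ (j + 1) f v (Fin.snoc (fun _ : Fin j => h) w)
      = inner ℝ (gradient f v) w + ∑ j ∈ Finset.Ico 1 Q.p, (1 / (j.factorial : ℝ)) *
        (iteratedFDeriv ℝ (j + 1) f v).curryRight (fun _ => h) w := by
    rw [Finset.range_eq_Ico, ← Finset.add_sum_Ioo_eq_sum_Ico (by omega : 0 < Q.p)]
    congr 1
    · rw [iteratedFDeriv_one_apply, gradient, InnerProductSpace.toDual_symm_apply]
      simp [Fin.snoc]
  have h4 : ∀ j ∈ Finset.Ico 1 Q.p,
      (1 / (j.factorial : ℝ)) * (iteratedFDeriv ℝ (j + 1) f v).curryRight (fun _ => h) w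
        - (1 / (j.factorial : ℝ)) * (H (j + 1)).curryRight (fun _ => h) w
      ≤ Q.σ (j + 1) * r ^ j / (j.factorial : ℝ) * ‖w‖ := by
    intro j hj
    rw [Finset.mem_Ico] at hj
    have h5 := (hH j hj.1 (by omega)).2
    have h6 := ((H (j + 1) - iteratedFDeriv ℝ (j + 1) f v).curryRight (fun _ => h)).le_opNorm w
    have h7 := h6.trans (mul_le_mul_of_nonneg_right h5 (norm_nonneg w))
    rw [Real.norm_eq_abs] at h7
    have h8 := neg_le_of_abs_le h7
    rw [ContinuousMultilinearMap.curryRight_apply, sub_apply] at h8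
    rw [ContinuousMultilinearMap.curryRight_apply, ContinuousMultilinearMap.curryRight_apply,
      ← mul_sub]
    have h9 : (0 : ℝ) ≤ 1 / (j.factorial : ℝ) := by positivity
    calc _ ≤ (1 / (j.factorial : ℝ)) * (Q.σ (j + 1) * ‖h‖ ^ j * ‖w‖) := by
          apply mul_le_mul_of_nonneg_left _ h9
          linarith
      _ = _ := by ring
  have h5 := Finset.sum_le_sum h4
  rw [Finset.sum_sub_distrib, ← Finset.sum_mul] at h5
  have h6 := (real_inner_le_norm (gradient (Q.omega f δ g H v) x) w).trans
    (mul_le_mul_of_nonneg_right hx (norm_nonneg w))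
  have h7 := neg_le_of_abs_le (abs_real_inner_le_norm (g - gradient f v) w)
  rw [inner_sub_left] at h7
  have h8 := le_of_abs_le h2
  rw [h3] at h8
  rw [inner_add_left, real_inner_smul_left]
  have h9 := mul_le_mul_of_nonneg_right herr (norm_nonneg w)
  have h10 : L * ‖h‖ ^ Q.p * ‖w‖ / (Q.p.factorial : ℝ) = L * r ^ Q.p / (Q.p.factorial : ℝ) * ‖w‖ := by
    ring
  rw [h10] at h8
  linarith

end Param

/-- Either `q² ≤ r²/2`, and the first term suffices, or `r ≤ 2q`, and the second one does. It trades
the curvature at the unknown distance `r` for a pure power of `q`. -/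
lemma pow_mul_sq_le {r q : ℝ} (hr : 0 ≤ r) (hq : 0 ≤ q) {i : ℕ} (hi : 2 ≤ i) :
    r ^ (i - 2) * q ^ 2 ≤ r ^ (i - 2) * r ^ 2 / 2 + 2 ^ i * q ^ i := by
  obtain ⟨k, rfl⟩ : ∃ k, i = k + 2 := ⟨i - 2, by omega⟩
  rw [Nat.add_sub_cancel]
  rcases le_total (2 * q ^ 2) (r ^ 2) with h | h
  · have h1 : 0 ≤ 2 ^ (k + 2) * q ^ (k + 2) := by positivity
    nlinarith [pow_nonneg hr k]
  · have h2 : r ≤ 2 * q := by nlinarith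
    have h3 : r ^ k ≤ (2 * q) ^ k := pow_le_pow_left₀ hr h2 k
    have h4 : 0 ≤ r ^ k * r ^ 2 / 2 := by positivity
    have h5 : r ^ k * q ^ 2 ≤ (2 * q) ^ k * q ^ 2 := by gcongr
    have h6 : 2 ^ (k + 2) * q ^ (k + 2) = 4 * ((2 * q) ^ k * q ^ 2) := by
      rw [mul_pow]; ring
    have : 0 ≤ (2 * q) ^ k * q ^ 2 := by positivity
    linarith

/-! ### The progress of one step. -/

namespace Param

variable (Q : Param)

/-- One step of the method: the progress `⟨∇f(x), v - x⟩` compensates `q ‖∇f(x)‖` up to the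
error made in the model and powers of `q`. -/
lemma norm_gradient_mul_le (hp : 2 ≤ Q.p) {f : Vec d → ℝ} {L δ Δ : ℝ}
    (hf : HasLipschitzDeriv Q.p L f) (hL : 0 ≤ L) (hLM : L ≤ Q.M)
    (hσ : ∀ i ∈ Finset.Icc 1 Q.p, 0 ≤ Q.σ i) (hη : ∀ i ∈ Finset.Icc 3 Q.p, 4 ≤ Q.η i)
    (hδ : 2 * Q.σ 2 ≤ δ) {g v x : Vec d}
    {H : (i : ℕ) → ContinuousMultilinearMap ℝ (fun _ : Fin i => Vec d) ℝ}
    (hH : Q.InexactDerivs f H v x) (hx : ‖gradient (Q.omega f δ g H v) x‖ ≤ Q.τ)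
    (hΔ : Δ = Q.τ + ‖g - gradient f v‖) (hδΔ : δ = 0 → Δ = 0) {q : ℝ} (hq : 0 ≤ q) :
    ‖gradient f x‖ * q ≤ inner ℝ (gradient f x) (v - x) + Δ ^ 2 / δ +
      ∑ i ∈ Finset.Icc 2 (Q.p + 1), Q.modelCoeff i * Q.level δ i * (2 ^ i * q ^ i) / 2 := by
  have key := Q.norm_gradient_add_curvature_le hp hf hL hLM hσ hη hδ hH hx
  rw [← hΔ] at key
  have hM : 0 ≤ Q.M := hL.trans hLM
  have hσ2 : 0 ≤ Q.σ 2 := hσ 2 (Finset.mem_Icc.2 ⟨by omega, hp⟩)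
  have hδ0 : 0 ≤ δ := by linarith
  have hr0 : 0 ≤ ‖x - v‖ := norm_nonneg _
  have hζδ := Q.le_curvature (δ := δ) hp hr0 hM hσ hη
  have hζ := Q.curvature_nonneg hδ0 hr0 hM hσ hη
  have hsum : Q.curvature δ ‖x - v‖ * q ^ 2 / 2 ≤ Q.curvature δ ‖x - v‖ * ‖x - v‖ ^ 2 / 4
      + ∑ i ∈ Finset.Icc 2 (Q.p + 1), Q.modelCoeff i * Q.level δ i * (2 ^ i * q ^ i) / 2 := by
    simp only [curvature, Finset.sum_mul, Finset.sum_div]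
    rw [← Finset.sum_add_distrib]
    refine Finset.sum_le_sum fun i hi => ?_
    have h1 := mul_nonneg (Q.modelCoeff_nonneg hη hi) (Q.level_nonneg hδ0 hM hσ hi)
    have h2 := mul_le_mul_of_nonneg_left
      (pow_mul_sq_le hr0 hq (Finset.mem_Icc.1 hi).1) h1
    linarith
  set ζ := Q.curvature δ ‖x - v‖
  set h := x - v with hh
  set G := gradient f x
  have hvx : v - x = -h := by simp [hh]
  rw [hvx, inner_neg_right]
  have hΔ0 : 0 ≤ Δ := by
    rw [hΔ]; exact add_nonneg ((norm_nonneg _).trans hx) (norm_nonneg _)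
  -- Zero curvature forces `δ = 0`, hence `Δ = 0` and a vanishing gradient; the convention `Δ² / 0 =
  -- 0` is then harmless.
  rcases hζ.eq_or_lt with hζ0 | hζ0
  · have hδ' : δ = 0 := le_antisymm (hζ0 ▸ hζδ) hδ0
    rw [← hζ0, hδΔ hδ', zero_smul] at key
    have hG : G = 0 := by simpa using key
    rw [← hζ0] at hsum
    rw [hG, hδ']
    rw [hδ'] at hsum
    simpa using hsum
  -- From `(Δ + ζ‖h‖/2)² ≤ 2Δ² + ζ²‖h‖²/2`. The factor one half in the model error leaves `ζ²‖h‖²/2`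
  -- of the expanded square on the left.
  · have h1 : ‖G + ζ • h‖ ^ 2 ≤ 2 * Δ ^ 2 + ζ ^ 2 * ‖h‖ ^ 2 / 2 := by
      have := pow_le_pow_left₀ (norm_nonneg _) key 2
      nlinarith [sq_nonneg (Δ - ζ * ‖h‖ / 2)]
    rw [norm_add_sq_real, norm_smul, real_inner_smul_right, Real.norm_eq_abs,
      abs_of_pos hζ0] at h1
    have h2 : Δ ^ 2 / ζ ≤ Δ ^ 2 / δ := by
      rcases hδ0.eq_or_lt with h0 | h0
      · rw [hδΔ h0.symm]; simp
      · gcongr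
    have h3 : ‖G‖ * q ≤ ‖G‖ ^ 2 / (2 * ζ) + ζ * q ^ 2 / 2 := by
      have e : ‖G‖ ^ 2 / (2 * ζ) + ζ * q ^ 2 / 2 - ‖G‖ * q = (‖G‖ - ζ * q) ^ 2 / (2 * ζ) := by
        field_simp; ring
      have : 0 ≤ (‖G‖ - ζ * q) ^ 2 / (2 * ζ) := by positivity
      linarith
    have h4 : ‖G‖ ^ 2 / (2 * ζ) + ζ * ‖h‖ ^ 2 / 4 ≤ -inner ℝ G h + Δ ^ 2 / ζ := by
      have e : -inner ℝ G h + Δ ^ 2 / ζ - (‖G‖ ^ 2 / (2 * ζ) + ζ * ‖h‖ ^ 2 / 4)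
        = (2 * Δ ^ 2 + ζ ^ 2 * ‖h‖ ^ 2 / 2
          - (‖G‖ ^ 2 + 2 * (ζ * inner ℝ G h) + (ζ * ‖h‖) ^ 2)) / (2 * ζ) := by
        field_simp; ring
      have : 0 ≤ (2 * Δ ^ 2 + ζ ^ 2 * ‖h‖ ^ 2 / 2
          - (‖G‖ ^ 2 + 2 * (ζ * inner ℝ G h) + (ζ * ‖h‖) ^ 2)) / (2 * ζ) :=
        div_nonneg (by linarith) (by positivity)
      linarith
    linarith

end Param

/-! ### The estimating sequence -/

/-- Clarkson's inequality for the powers of the norm of a Euclidean space. -/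
lemma norm_midpoint_pow_le (a b : Vec d) {i : ℕ} (hi : 2 ≤ i) :
    ‖(1 / 2 : ℝ) • (a + b)‖ ^ i + ‖(1 / 2 : ℝ) • (a - b)‖ ^ i ≤ (‖a‖ ^ i + ‖b‖ ^ i) / 2 := by
  have hpow : ∀ z : Vec d, ‖z‖ ^ i = (‖z‖ ^ 2) ^ ((i : ℝ) / 2) := by
    intro z
    rw [← Real.rpow_natCast ‖z‖ 2, ← Real.rpow_mul (norm_nonneg _), ← Real.rpow_natCast]
    congr 1; push_cast; ring
  have hi' : (1 : ℝ) ≤ (i : ℝ) / 2 := by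
    have : (2 : ℝ) ≤ i := by exact_mod_cast hi
    linarith
  have h1 : ‖(1 / 2 : ℝ) • (a + b)‖ ^ 2 + ‖(1 / 2 : ℝ) • (a - b)‖ ^ 2
      = (1 / 2) * ‖a‖ ^ 2 + (1 / 2) * ‖b‖ ^ 2 := by
    rw [norm_smul, norm_smul, mul_pow, mul_pow, norm_add_sq_real, norm_sub_sq_real]
    norm_num; ring
  have h2 := Real.add_rpow_le_rpow_add (sq_nonneg ‖(1 / 2 : ℝ) • (a + b)‖)
    (sq_nonneg ‖(1 / 2 : ℝ) • (a - b)‖) hi'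
  have h3 := (convexOn_rpow hi').2 (Set.mem_Ici.2 (sq_nonneg ‖a‖)) (Set.mem_Ici.2 (sq_nonneg ‖b‖))
    (by norm_num : (0 : ℝ) ≤ 1 / 2) (by norm_num : (0 : ℝ) ≤ 1 / 2) (by norm_num)
  simp only [smul_eq_mul] at h3
  rw [h1] at h2
  rw [hpow, hpow (_ • (a - b)), hpow a, hpow b]
  linarith

lemma sum_alpha_div_bigA (p t : ℕ) :
    ∑ j ∈ Finset.range (t + 1), alpha p j / bigA p j = (bigA p t)⁻¹ := by
  induction t with
  | zero => simp [alpha_zero, bigA_zero]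
  | succ t ih =>
    rw [Finset.sum_range_succ, ih, ← inv_bigA_succ_mul, div_eq_mul_inv]
    ring

/-- The weight carried by `x_t` is `(1 - α_t) / A_t`, which is `1 / A_{t-1}` for `t ≥ 1` and 0 for
`t = 0`. It is the coefficient with which `x_t` enters `v_t / A_t`. -/
lemma sum_alpha_div_bigA' (p t : ℕ) :
    ∑ j ∈ Finset.range t, alpha p j / bigA p j = (bigA p t)⁻¹ * (1 - alpha p t) := by
  cases t with
  | zero => simp [alpha_zero]
  | succ t => rw [sum_alpha_div_bigA, inv_bigA_succ_mul]

namespace Param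

variable (Q : Param)

lemma kappa_eq (ρ : ℝ) (i t : ℕ) :
    Q.kappa ρ i t
      = Q.aK i * (alpha Q.p t ^ i * (bigA Q.p t)⁻¹ * Q.level (Q.deltaBar ρ t) i) := by
  rw [kappa, level, div_eq_mul_inv]

/-- The constants of the method have the right signs. -/
structure Nonneg : Prop where
  two_le : 2 ≤ Q.p
  M_nonneg : 0 ≤ Q.M
  τ_nonneg : 0 ≤ Q.τ
  σ_nonneg : ∀ i ∈ Finset.Icc 1 Q.p, 0 ≤ Q.σ i
  four_le : ∀ i ∈ Finset.Icc 3 Q.p, 4 ≤ Q.η i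
  two_le_aD : 2 ≤ Q.aD
  aL_pos : 0 < Q.aL
  -- One factor `2^i` comes from `pow_mul_sq_le`, the other from the halving in the uniform
  -- convexity of `ψ_t`; `i!` cancels the one in `ψ_t`.
  aK_ge : ∀ i ∈ Finset.Icc 2 (Q.p + 1), Q.modelCoeff i * 4 ^ i * (i.factorial : ℝ) ≤ Q.aK i

variable {Q}

lemma Nonneg.σ_one (h : Q.Nonneg) : 0 ≤ Q.σ 1 :=
  h.σ_nonneg 1 (Finset.mem_Icc.2 ⟨le_rfl, by have := h.two_le; omega⟩)

lemma Nonneg.σ_two (h : Q.Nonneg) : 0 ≤ Q.σ 2 :=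
  h.σ_nonneg 2 (Finset.mem_Icc.2 ⟨by omega, h.two_le⟩)

lemma Nonneg.aK_nonneg (h : Q.Nonneg) {i : ℕ} (hi : i ∈ Finset.Icc 2 (Q.p + 1)) :
    0 ≤ Q.aK i := by
  refine le_trans ?_ (h.aK_ge i hi)
  have := Q.modelCoeff_nonneg h.four_le hi
  positivity

lemma Nonneg.two_σ_le_deltaBar (h : Q.Nonneg) {ρ : ℝ} (hρ : 0 < ρ) (t : ℕ) :
    2 * Q.σ 2 ≤ Q.deltaBar ρ t := by
  have h1 := h.σ_two
  have h2 := h.σ_one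
  have h3 := h.τ_nonneg
  have h4 := h.two_le_aD
  unfold deltaBar
  have h5 : 0 ≤ (Q.σ 1 + Q.τ) / ρ * ((t : ℝ) + Q.p + 1) ^ ((3 : ℝ) / 2) := by positivity
  exact mul_le_mul h4 (by linarith) h1 (by linarith)

lemma Nonneg.deltaBar_nonneg (h : Q.Nonneg) {ρ : ℝ} (hρ : 0 < ρ) (t : ℕ) :
    0 ≤ Q.deltaBar ρ t := by
  have := h.two_σ_le_deltaBar hρ t
  linarith [h.σ_two]

lemma Nonneg.deltaBar_mono (h : Q.Nonneg) {ρ : ℝ} (hρ : 0 < ρ) (t : ℕ) :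
    Q.deltaBar ρ t ≤ Q.deltaBar ρ (t + 1) := by
  have h2 := h.σ_one
  have h3 := h.τ_nonneg
  have h4 := h.two_le_aD
  unfold deltaBar
  gcongr
  simp

lemma Nonneg.lam_nonneg (h : Q.Nonneg) {ρ : ℝ} (hρ : 0 < ρ) (t : ℕ) : 0 ≤ Q.lam ρ t := by
  have h2 := h.σ_one
  have h4 := h.aL_pos
  unfold lam
  positivity

lemma Nonneg.lam_mono (h : Q.Nonneg) {ρ : ℝ} (hρ : 0 < ρ) (t : ℕ) :
    Q.lam ρ t ≤ Q.lam ρ (t + 1) := by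
  have h2 := h.σ_one
  have h4 := h.aL_pos
  unfold lam
  gcongr
  simp

lemma Nonneg.level_nonneg (h : Q.Nonneg) {ρ : ℝ} (hρ : 0 < ρ) (t : ℕ) {i : ℕ}
    (hi : i ∈ Finset.Icc 2 (Q.p + 1)) : 0 ≤ Q.level (Q.deltaBar ρ t) i :=
  Q.level_nonneg (h.deltaBar_nonneg hρ t) h.M_nonneg h.σ_nonneg hi

lemma Nonneg.kappa_nonneg (h : Q.Nonneg) {ρ : ℝ} (hρ : 0 < ρ) (t : ℕ) {i : ℕ}
    (hi : i ∈ Finset.Icc 2 (Q.p + 1)) : 0 ≤ Q.kappa ρ i t := by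
  rw [kappa_eq]
  exact mul_nonneg (h.aK_nonneg hi) (mul_nonneg (mul_nonneg (pow_nonneg (alpha_pos _ _).le _)
    (inv_bigA_pos _ _).le) (h.level_nonneg hρ t hi))

lemma Nonneg.kappa_mono (h : Q.Nonneg) {ρ : ℝ} (hρ : 0 < ρ) (t : ℕ) {i : ℕ}
    (hi : i ∈ Finset.Icc 2 (Q.p + 1)) : Q.kappa ρ i t ≤ Q.kappa ρ i (t + 1) := by
  rw [kappa_eq, kappa_eq]
  have h1 : Q.level (Q.deltaBar ρ t) i ≤ Q.level (Q.deltaBar ρ (t + 1)) i := by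
    unfold level
    split_ifs
    · exact h.deltaBar_mono hρ t
    · exact le_rfl
    · exact le_rfl
  refine mul_le_mul_of_nonneg_left ?_ (h.aK_nonneg hi)
  exact mul_le_mul (alpha_pow_mul_inv_bigA_mono (Finset.mem_Icc.1 hi).2 t) h1
    (h.level_nonneg hρ t hi)
    (mul_nonneg (pow_nonneg (alpha_pos _ _).le _) (inv_bigA_pos _ _).le)

variable (Q)

lemma psi_eq (f : Vec d → ℝ) (ρ : ℝ) (x₀ : Vec d) (x gx : ℕ → Vec d) (t : ℕ) (u : Vec d) :
    Q.psi f ρ x₀ x gx t u = Q.lam ρ t / 2 * ‖u - x₀‖ ^ 2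
      + ∑ i ∈ Finset.Icc 2 (Q.p + 1), Q.kappa ρ i t / (Nat.factorial i : ℝ) * ‖u - x₀‖ ^ i
      + ∑ j ∈ Finset.range t, alpha Q.p j / bigA Q.p j *
          (f (x (j + 1)) + inner ℝ (gx j) (u - x (j + 1))) := by
  induction t with
  | zero => simp [psi]
  | succ t ih =>
    rw [psi, ih, Finset.sum_range_succ]
    simp only [sub_div, sub_mul, Finset.sum_sub_distrib]
    ring

variable {Q}

/-- The minimizer is compared with the midpoint `m` of `u` and `y`. Clarkson's inequality quantifies
the convexity of every power of the norm, while the linear models are affine and average exactly. -/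
lemma Nonneg.psi_growth (h : Q.Nonneg) {f : Vec d → ℝ} {ρ : ℝ} (hρ : 0 < ρ) {x₀ : Vec d}
    {x gx : ℕ → Vec d} {t : ℕ} {y : Vec d} (hy : IsMinOn (Q.psi f ρ x₀ x gx t) Set.univ y)
    (u : Vec d) :
    Q.psi f ρ x₀ x gx t y + Q.lam ρ t / 4 * ‖u - y‖ ^ 2
      + ∑ i ∈ Finset.Icc 2 (Q.p + 1),
          Q.kappa ρ i t / (Nat.factorial i : ℝ) * (2 * ((1 / 2) ^ i * ‖u - y‖ ^ i))
      ≤ Q.psi f ρ x₀ x gx t u := by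
  set m : Vec d := (1 / 2 : ℝ) • (u + y) with hm
  have h1 : Q.psi f ρ x₀ x gx t y ≤ Q.psi f ρ x₀ x gx t m := hy (Set.mem_univ m)
  have e1 : m - x₀ = (1 / 2 : ℝ) • ((u - x₀) + (y - x₀)) := by
    rw [hm]; module
  have e2 : (1 / 2 : ℝ) • (u - y) = (1 / 2 : ℝ) • ((u - x₀) - (y - x₀)) := by
    module
  have hhalf : ∀ i : ℕ, ‖(1 / 2 : ℝ) • (u - y)‖ ^ i = (1 / 2) ^ i * ‖u - y‖ ^ i := by
    intro i; rw [norm_smul, mul_pow]; norm_num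
  have hpow : ∀ i, 2 ≤ i → ‖m - x₀‖ ^ i + (1 / 2) ^ i * ‖u - y‖ ^ i
      ≤ (‖u - x₀‖ ^ i + ‖y - x₀‖ ^ i) / 2 := by
    intro i hi
    rw [← hhalf, e1, e2]
    exact norm_midpoint_pow_le _ _ hi
  have h2 : Q.lam ρ t / 2 * (‖m - x₀‖ ^ 2 + (1 / 2) ^ 2 * ‖u - y‖ ^ 2)
      ≤ Q.lam ρ t / 2 * ((‖u - x₀‖ ^ 2 + ‖y - x₀‖ ^ 2) / 2) :=
    mul_le_mul_of_nonneg_left (hpow 2 le_rfl) (by have := h.lam_nonneg hρ t; positivity)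
  have h3 : ∑ i ∈ Finset.Icc 2 (Q.p + 1), Q.kappa ρ i t / (Nat.factorial i : ℝ) *
        (‖m - x₀‖ ^ i + (1 / 2) ^ i * ‖u - y‖ ^ i)
      ≤ ∑ i ∈ Finset.Icc 2 (Q.p + 1), Q.kappa ρ i t / (Nat.factorial i : ℝ) *
        ((‖u - x₀‖ ^ i + ‖y - x₀‖ ^ i) / 2) :=
    Finset.sum_le_sum fun i hi => mul_le_mul_of_nonneg_left (hpow i (Finset.mem_Icc.1 hi).1)
      (by have := h.kappa_nonneg hρ t hi; positivity)
  have h4 : ∑ j ∈ Finset.range t, alpha Q.p j / bigA Q.p j *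
        (f (x (j + 1)) + inner ℝ (gx j) (m - x (j + 1)))
      = (∑ j ∈ Finset.range t, alpha Q.p j / bigA Q.p j *
          (f (x (j + 1)) + inner ℝ (gx j) (u - x (j + 1)))
        + ∑ j ∈ Finset.range t, alpha Q.p j / bigA Q.p j *
          (f (x (j + 1)) + inner ℝ (gx j) (y - x (j + 1)))) / 2 := by
    rw [← Finset.sum_add_distrib, Finset.sum_div]
    refine Finset.sum_congr rfl fun j _ => ?_
    have : m - x (j + 1) = (1 / 2 : ℝ) • ((u - x (j + 1)) + (y - x (j + 1))) := by
      rw [hm]; module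
    rw [this, real_inner_smul_right, inner_add_right]
    ring
  simp only [mul_add, add_div, Finset.sum_add_distrib] at h2 h3
  rw [psi_eq, psi_eq Q f ρ x₀ x gx t m, h4] at h1
  rw [psi_eq, psi_eq Q f ρ x₀ x gx t u]
  have e3 : ∀ w : Vec d, ∑ i ∈ Finset.Icc 2 (Q.p + 1), Q.kappa ρ i t / (Nat.factorial i : ℝ) *
      (‖w‖ ^ i / 2) = (∑ i ∈ Finset.Icc 2 (Q.p + 1), Q.kappa ρ i t / (Nat.factorial i : ℝ) *
      ‖w‖ ^ i) / 2 := by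
    intro w
    rw [Finset.sum_div]
    exact Finset.sum_congr rfl fun _ _ => by ring
  have e4 : ∑ i ∈ Finset.Icc 2 (Q.p + 1), Q.kappa ρ i t / (Nat.factorial i : ℝ) *
      (2 * ((1 / 2) ^ i * ‖u - y‖ ^ i)) = 2 * ∑ i ∈ Finset.Icc 2 (Q.p + 1),
        Q.kappa ρ i t / (Nat.factorial i : ℝ) * ((1 / 2) ^ i * ‖u - y‖ ^ i) := by
    rw [Finset.mul_sum]
    exact Finset.sum_congr rfl fun _ _ => by ring
  rw [e3, e3] at h3
  rw [e4]
  linarith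

/-- The rule of the method only covers `y_{t+1}`; for `t = 0` minimality holds because `ψ_0` is
nonnegative and vanishes at `y_0 = x_0`. -/
lemma Nonneg.isMinOn_psi (h : Q.Nonneg) {f : Vec d → ℝ} {ρ : ℝ} (hρ : 0 < ρ) {x₀ : Vec d}
    {x y gv gx : ℕ → Vec d}
    {H : ℕ → (i : ℕ) → ContinuousMultilinearMap ℝ (fun _ : Fin i => Vec d) ℝ}
    (hT : Q.IsTrajectory f ρ x₀ x y gv gx H) (t : ℕ) :
    IsMinOn (Q.psi f ρ x₀ x gx t) Set.univ (y t) := by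
  cases t with
  | succ t => exact hT.y_step t
  | zero =>
    intro u _
    have h0 : Q.psi f ρ x₀ x gx 0 (y 0) = 0 := by
      rw [psi_eq, hT.y_zero]
      simp only [sub_self, norm_zero, Finset.range_zero, Finset.sum_empty]
      rw [Finset.sum_eq_zero]
      · simp
      · intro i hi
        rw [Finset.mem_Icc] at hi
        rw [zero_pow (by omega), mul_zero]
    change Q.psi f ρ x₀ x gx 0 (y 0) ≤ Q.psi f ρ x₀ x gx 0 u
    rw [h0, psi_eq, Finset.range_zero, Finset.sum_empty, add_zero]
    have h1 : 0 ≤ Q.lam ρ 0 / 2 * ‖u - x₀‖ ^ 2 := by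
      have := h.lam_nonneg hρ 0
      positivity
    refine add_nonneg h1 (Finset.sum_nonneg fun i hi => ?_)
    have := h.kappa_nonneg hρ 0 hi
    positivity

lemma Nonneg.psi_succ_ge (h : Q.Nonneg) (f : Vec d → ℝ) {ρ : ℝ} (hρ : 0 < ρ) (x₀ : Vec d)
    (x gx : ℕ → Vec d) (t : ℕ) (u : Vec d) :
    Q.psi f ρ x₀ x gx t u +
      alpha Q.p t / bigA Q.p t * (f (x (t + 1)) + inner ℝ (gx t) (u - x (t + 1)))
      ≤ Q.psi f ρ x₀ x gx (t + 1) u := by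
  rw [psi]
  have h1 : 0 ≤ (Q.lam ρ (t + 1) - Q.lam ρ t) / 2 * ‖u - x₀‖ ^ 2 := by
    have := sub_nonneg.2 (h.lam_mono hρ t)
    positivity
  have h2 : 0 ≤ ∑ i ∈ Finset.Icc 2 (Q.p + 1),
      (Q.kappa ρ i (t + 1) - Q.kappa ρ i t) / (Nat.factorial i : ℝ) * ‖u - x₀‖ ^ i :=
    Finset.sum_nonneg fun i hi => by
      have := sub_nonneg.2 (h.kappa_mono hρ t hi)
      positivity
  linarith

/-- The error of iteration `j` caused by the noise `n` of the gradient at `x_{j+1}` and by the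
inexactness `Δ` of the model. -/
def stepError (Q : Param) (ρ : ℝ) (j : ℕ) (n : Vec d) (Δ : ℝ) : ℝ :=
  (alpha Q.p j / bigA Q.p j) ^ 2 * ‖n‖ ^ 2 / Q.lam ρ j
    + (bigA Q.p j)⁻¹ * (Δ ^ 2 / Q.deltaBar ρ j)

/-- Young's inequality, with the degenerate case `l = 0` covered by `b = 0`. It lets `λ_t` absorb
the noise. -/
lemma mul_norm_mul_le_of_eq_zero {a b l w : ℝ} (hl : 0 ≤ l) (h : l = 0 → b = 0) :
    a * b * w ≤ l / 4 * w ^ 2 + a ^ 2 * b ^ 2 / l := by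
  rcases hl.eq_or_lt with h0 | h0
  · rw [h h0.symm, ← h0]; simp
  · have e : l / 4 * w ^ 2 + a ^ 2 * b ^ 2 / l - a * b * w = (l * w - 2 * a * b) ^ 2 / (4 * l) := by
      field_simp; ring
    have : 0 ≤ (l * w - 2 * a * b) ^ 2 / (4 * l) := by positivity
    linarith

/-- The estimating sequence dominates the weighted function values up to the accumulated errors. -/
lemma Nonneg.weighted_value_le_psi (h : Q.Nonneg) {f : Vec d → ℝ} {L ρ : ℝ} (hρ : 0 < ρ)
    (hf : HasLipschitzDeriv Q.p L f) (hL : 0 ≤ L) (hLM : L ≤ Q.M)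
    (hconv : ∀ a b, f a + inner ℝ (gradient f a) (b - a) ≤ f b)
    {x₀ : Vec d} {x y gv gx : ℕ → Vec d}
    {H : ℕ → (i : ℕ) → ContinuousMultilinearMap ℝ (fun _ : Fin i => Vec d) ℝ}
    (hT : Q.IsTrajectory f ρ x₀ x y gv gx H)
    (hH : ∀ t, Q.InexactDerivs f (H t) (Q.vPoint x y t) (x (t + 1)))
    {n : ℕ → Vec d} {Δ : ℕ → ℝ} (hn : ∀ t, n t = gx t - gradient f (x (t + 1)))
    (hΔ : ∀ t, Δ t = Q.τ + ‖gv t - gradient f (Q.vPoint x y t)‖)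
    (hn0 : ∀ t, Q.lam ρ t = 0 → n t = 0) (hΔ0 : ∀ t, Q.deltaBar ρ t = 0 → Δ t = 0) (t : ℕ) :
    (∑ j ∈ Finset.range t, alpha Q.p j / bigA Q.p j) * f (x t)
      ≤ Q.psi f ρ x₀ x gx t (y t) + ∑ j ∈ Finset.range t, (Q.stepError ρ j (n j) (Δ j)
        - alpha Q.p j / bigA Q.p j * inner ℝ (n j) (y j - x (j + 1))) := by
  induction t with
  | zero =>
    simp only [Finset.range_zero, Finset.sum_empty, zero_mul, add_zero]
    rw [psi_eq, Finset.range_zero, Finset.sum_empty, add_zero]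
    have h1 : 0 ≤ Q.lam ρ 0 / 2 * ‖y 0 - x₀‖ ^ 2 := by
      have := h.lam_nonneg hρ 0
      positivity
    refine add_nonneg h1 (Finset.sum_nonneg fun i hi => ?_)
    have := h.kappa_nonneg hρ 0 hi
    positivity
  | succ t ih =>
    rw [sum_alpha_div_bigA, Finset.sum_range_succ]
    rw [sum_alpha_div_bigA'] at ih
    set E := ∑ j ∈ Finset.range t, (Q.stepError ρ j (n j) (Δ j)
        - alpha Q.p j / bigA Q.p j * inner ℝ (n j) (y j - x (j + 1)))
    set α := alpha Q.p t with hα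
    set W := (bigA Q.p t)⁻¹ with hW
    have hα0 : 0 < α := alpha_pos _ _
    have hα1 : 0 ≤ 1 - α := by rw [hα, one_sub_alpha]; positivity
    have hW0 : 0 < W := inv_bigA_pos _ _
    set G := gradient f (x (t + 1)) with hG
    set w := ‖y (t + 1) - y t‖ with hw
    have hw0 : 0 ≤ w := norm_nonneg _
    have s1 := h.psi_succ_ge f hρ x₀ x gx t (y (t + 1))
    have s2 := h.psi_growth hρ (h.isMinOn_psi hρ hT t) (y (t + 1))
    have s3 := mul_le_mul_of_nonneg_left (hconv (x (t + 1)) (x t)) (mul_nonneg hW0.le hα1)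
    -- The choice `q = α_t ‖y_{t+1} - y_t‖` matches the loss in `s8`.
    have s4 := mul_le_mul_of_nonneg_left (Q.norm_gradient_mul_le h.two_le hf hL hLM h.σ_nonneg
      h.four_le (h.two_σ_le_deltaBar hρ t) (hH t) (hT.x_step t) (hΔ t) (hΔ0 t)
      (mul_nonneg hα0.le hw0)) hW0.le
    have s5 : W * ∑ i ∈ Finset.Icc 2 (Q.p + 1), Q.modelCoeff i * Q.level (Q.deltaBar ρ t) i *
        (2 ^ i * (α * w) ^ i) / 2
        ≤ ∑ i ∈ Finset.Icc 2 (Q.p + 1),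
          Q.kappa ρ i t / (Nat.factorial i : ℝ) * (2 * ((1 / 2) ^ i * w ^ i)) := by
      rw [Finset.mul_sum]
      refine Finset.sum_le_sum fun i hi => ?_
      rw [kappa_eq]
      have h1 := h.aK_ge i hi
      have h2 := h.level_nonneg hρ t hi
      have h3 := Q.modelCoeff_nonneg h.four_le hi
      have h4 : (0 : ℝ) < i.factorial := by positivity
      have h6 : Q.modelCoeff i * 4 ^ i ≤ Q.aK i / i.factorial := by
        rwa [le_div_iff₀ h4]
      have h5 : (2 : ℝ) ^ i = 4 ^ i * (1 / 2) ^ i := by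
        rw [← mul_pow]; norm_num
      calc _ = Q.modelCoeff i * 4 ^ i *
            (W * Q.level (Q.deltaBar ρ t) i * (α ^ i * w ^ i) * (1 / 2) ^ i / 2) := by
            rw [h5, mul_pow]; ring
        _ ≤ Q.aK i / i.factorial *
            (W * Q.level (Q.deltaBar ρ t) i * (α ^ i * w ^ i) * (1 / 2) ^ i / 2) := by
            gcongr
        _ ≤ Q.aK i / i.factorial *
            (W * Q.level (Q.deltaBar ρ t) i * (α ^ i * w ^ i) * (1 / 2) ^ i * 2) := by
            have := h.aK_nonneg hi
            have : 0 ≤ W * Q.level (Q.deltaBar ρ t) i * (α ^ i * w ^ i) * (1 / 2) ^ i := by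
              positivity
            gcongr
            linarith
        _ = _ := by ring
    have s6 := mul_norm_mul_le_of_eq_zero (a := α / bigA Q.p t) (b := ‖n t‖) (w := w)
      (h.lam_nonneg hρ t) (fun h0 => by rw [hn0 t h0, norm_zero])
    have ea : α / bigA Q.p t = α * W := div_eq_mul_inv _ _
    have s7 : -(α * W * ‖n t‖ * w) ≤ α * W * inner ℝ (n t) (y (t + 1) - y t) := by
      have := neg_le_of_abs_le (abs_real_inner_le_norm (n t) (y (t + 1) - y t))
      have := mul_le_mul_of_nonneg_left this (mul_nonneg hα0.le hW0.le)
      linarith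
    have s8 : -(α * W * ‖G‖ * w) ≤ α * W * inner ℝ G (y (t + 1) - y t) := by
      have := neg_le_of_abs_le (abs_real_inner_le_norm G (y (t + 1) - y t))
      have := mul_le_mul_of_nonneg_left this (mul_nonneg hα0.le hW0.le)
      linarith
    -- The part of the noise along `y_{t+1} - y_t` depends on the noise itself and is paid by `λ_t`;
    -- the part along `y_t - x_{t+1}` is kept, since both points precede the oracle call.
    have s9 : inner ℝ (gx t) (y (t + 1) - x (t + 1)) = inner ℝ (n t) (y (t + 1) - y t)
        + inner ℝ (n t) (y t - x (t + 1)) + inner ℝ G (y (t + 1) - x (t + 1)) := by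
      rw [hn t, ← inner_add_right, sub_add_sub_cancel, inner_sub_left]
      ring
    -- By the definition of `v_t`, the convexity inequality at `x_t` and the new linear model at
    -- `y_{t+1}` combine into the progress term at `v_t` and a remainder along `y_{t+1} - y_t`.
    have s10 : W * (1 - α) * inner ℝ G (x t - x (t + 1))
        + α * W * inner ℝ G (y (t + 1) - x (t + 1))
        = W * inner ℝ G (Q.vPoint x y t - x (t + 1)) + α * W * inner ℝ G (y (t + 1) - y t) := by
      have : Q.vPoint x y t = (1 - α) • x t + α • y t := rfl
      rw [this]
      simp only [inner_sub_right, inner_add_right, real_inner_smul_right]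
      ring
    have s11 : Q.stepError ρ t (n t) (Δ t) = (α * W) ^ 2 * ‖n t‖ ^ 2 / Q.lam ρ t
        + W * (Δ t ^ 2 / Q.deltaBar ρ t) := by
      rw [stepError, ← ea]
    rw [ea] at s1 s6 ⊢
    rw [s9] at s1
    rw [s11]
    linarith

/-- The fundamental estimate along one trajectory of the inner method. -/
lemma Nonneg.weighted_gap_le (h : Q.Nonneg) {f : Vec d → ℝ} {L ρ : ℝ} (hρ : 0 < ρ)
    (hf : HasLipschitzDeriv Q.p L f) (hL : 0 ≤ L) (hLM : L ≤ Q.M)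
    (hconv : ∀ a b, f a + inner ℝ (gradient f a) (b - a) ≤ f b)
    {x₀ : Vec d} {x y gv gx : ℕ → Vec d}
    {H : ℕ → (i : ℕ) → ContinuousMultilinearMap ℝ (fun _ : Fin i => Vec d) ℝ}
    (hT : Q.IsTrajectory f ρ x₀ x y gv gx H)
    (hH : ∀ t, Q.InexactDerivs f (H t) (Q.vPoint x y t) (x (t + 1)))
    {n : ℕ → Vec d} {Δ : ℕ → ℝ} (hn : ∀ t, n t = gx t - gradient f (x (t + 1)))
    (hΔ : ∀ t, Δ t = Q.τ + ‖gv t - gradient f (Q.vPoint x y t)‖)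
    (hn0 : ∀ t, Q.lam ρ t = 0 → n t = 0) (hΔ0 : ∀ t, Q.deltaBar ρ t = 0 → Δ t = 0) (t : ℕ)
    (xs : Vec d) :
    (∑ j ∈ Finset.range t, alpha Q.p j / bigA Q.p j) * (f (x t) - f xs)
        + Q.lam ρ t / 4 * ‖xs - y t‖ ^ 2
      ≤ Q.lam ρ t / 2 * ‖x₀ - xs‖ ^ 2
        + ∑ i ∈ Finset.Icc 2 (Q.p + 1), Q.kappa ρ i t / (Nat.factorial i : ℝ) * ‖x₀ - xs‖ ^ i
        + ∑ j ∈ Finset.range t, (Q.stepError ρ j (n j) (Δ j)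
          + alpha Q.p j / bigA Q.p j * inner ℝ (n j) (xs - y j)) := by
  have h1 := h.weighted_value_le_psi hρ hf hL hLM hconv hT hH hn hΔ hn0 hΔ0 t
  -- The quadratic growth term stays in the final estimate: it later provides the square
  -- integrability of `y_t`.
  have h2 := h.psi_growth hρ (h.isMinOn_psi hρ hT t) xs
  have h3 : 0 ≤ ∑ i ∈ Finset.Icc 2 (Q.p + 1),
      Q.kappa ρ i t / (Nat.factorial i : ℝ) * (2 * ((1 / 2) ^ i * ‖xs - y t‖ ^ i)) :=
    Finset.sum_nonneg fun i hi => by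
      have := h.kappa_nonneg hρ t hi
      positivity
  rw [psi_eq Q f ρ x₀ x gx t xs, norm_sub_rev xs x₀] at h2
  have h4 : ∑ j ∈ Finset.range t, alpha Q.p j / bigA Q.p j *
        (f (x (j + 1)) + inner ℝ (gx j) (xs - x (j + 1)))
      ≤ (∑ j ∈ Finset.range t, alpha Q.p j / bigA Q.p j) * f xs
        + ∑ j ∈ Finset.range t, alpha Q.p j / bigA Q.p j * inner ℝ (n j) (xs - x (j + 1)) := by
    rw [Finset.sum_mul, ← Finset.sum_add_distrib]
    refine Finset.sum_le_sum fun j _ => ?_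
    rw [← mul_add]
    refine mul_le_mul_of_nonneg_left ?_ (div_nonneg (alpha_pos _ _).le (bigA_pos _ _).le)
    have := hconv (x (j + 1)) xs
    rw [hn j, inner_sub_left]
    linarith
  -- The noise in the value estimate and the noise in `ψ_t(x⋆)` add up so that `x_{j+1}` cancels,
  -- leaving `⟨n_j, x⋆ - y_j⟩`.
  have h5 : ∑ j ∈ Finset.range t, (Q.stepError ρ j (n j) (Δ j)
          + alpha Q.p j / bigA Q.p j * inner ℝ (n j) (xs - y j))
      = ∑ j ∈ Finset.range t, (Q.stepError ρ j (n j) (Δ j)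
        - alpha Q.p j / bigA Q.p j * inner ℝ (n j) (y j - x (j + 1)))
        + ∑ j ∈ Finset.range t, alpha Q.p j / bigA Q.p j * inner ℝ (n j) (xs - x (j + 1)) := by
    rw [← Finset.sum_add_distrib]
    refine Finset.sum_congr rfl fun j _ => ?_
    simp only [inner_sub_right]
    ring
  rw [h5, mul_sub]
  linarith

end Param

/-! ### Strong convexity -/

lemma add_inner_gradient_le_of_convexOn {f : Vec d → ℝ} (hf : ConvexOn ℝ Set.univ f)
    (hd : Differentiable ℝ f) (a b : Vec d) :
    f a + inner ℝ (gradient f a) (b - a) ≤ f b := by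
  have hl : HasDerivAt (fun s : ℝ => AffineMap.lineMap a b s) (b - a) 0 :=
    AffineMap.hasDerivAt_lineMap
  have h1 : HasDerivAt (fun s : ℝ => f (AffineMap.lineMap a b s))
      (inner ℝ (gradient f a) (b - a)) 0 := by
    have h2 := (hd (AffineMap.lineMap a b (0 : ℝ))).hasFDerivAt.comp_hasDerivAt 0 hl
    rw [gradient, InnerProductSpace.toDual_symm_apply]
    rwa [AffineMap.lineMap_apply_zero] at h2
  have h2 : ConvexOn ℝ Set.univ (fun s : ℝ => f (AffineMap.lineMap a b s)) :=
    hf.comp_affineMap (AffineMap.lineMap a b)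
  have h3 := h2.le_slope_of_hasDerivAt (Set.mem_univ 0) (Set.mem_univ 1) zero_lt_one h1
  simp only [slope_def_field, AffineMap.lineMap_apply_one, AffineMap.lineMap_apply_zero, sub_zero,
    div_one] at h3
  linarith

/-- Strong convexity at the midpoint, where `f` is at least its minimum. The constant is `μ/4`
rather than the optimal `μ/2`, which is enough here. -/
lemma sq_norm_sub_le_of_strongConvexOn {f : Vec d → ℝ} {μ : ℝ}
    (hf : StrongConvexOn Set.univ μ f) {xs : Vec d} (hxs : ∀ x, f xs ≤ f x) (x : Vec d) :
    μ / 4 * ‖x - xs‖ ^ 2 ≤ f x - f xs := by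
  have h := hf.2 (Set.mem_univ x) (Set.mem_univ xs) (by norm_num : (0 : ℝ) ≤ 1 / 2)
    (by norm_num : (0 : ℝ) ≤ 1 / 2) (by norm_num)
  have h1 := hxs ((1 / 2 : ℝ) • x + (1 / 2 : ℝ) • xs)
  simp only [smul_eq_mul] at h
  linarith

/-! ### Stochastic gradients -/

section StochGrad

variable {Ω : Type*} {m : MeasurableSpace Ω} [mΩ : MeasurableSpace Ω] {P : Measure Ω}
  {f : Vec d → ℝ} {σ₁ : ℝ} {q g : Ω → Vec d}

lemma IsStochGrad.integrable_sq (h : IsStochGrad P f σ₁ m q g) :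
    Integrable (fun w => ‖g w - gradient f (q w)‖ ^ 2) P :=
  h.1.integrable_norm_pow (by norm_num)

variable [IsProbabilityMeasure P]

/-- `Y` is known given `m`, so it comes out of the conditional expectation of the error, which is
zero. Square integrability of both factors makes the product integrable. -/
lemma IsStochGrad.integral_inner_eq_zero (h : IsStochGrad P f σ₁ m q g) (hm : m ≤ mΩ)
    {Y : Ω → Vec d} (hY : StronglyMeasurable[m] Y) (hY2 : MemLp Y 2 P) :
    Integrable (fun w => inner ℝ (g w - gradient f (q w)) (Y w)) P ∧
      ∫ w, inner ℝ (g w - gradient f (q w)) (Y w) ∂P = 0 := by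
  have hi : Integrable (fun w => inner ℝ (g w - gradient f (q w)) (Y w)) P :=
    (h.1.norm.integrable_mul hY2.norm).mono' (h.1.1.inner hY2.1)
      (Filter.Eventually.of_forall fun w => norm_inner_le_norm _ _)
  refine ⟨hi, ?_⟩
  have h1 := condExp_bilin_of_stronglyMeasurable_right (m := m) (μ := P) (innerSL ℝ)
    (f := fun w => g w - gradient f (q w)) (g := Y) hY hi (h.1.integrable (by norm_num))
  rw [← integral_condExp hm]
  have h2 : P[fun w => inner ℝ (g w - gradient f (q w)) (Y w) | m] =ᵐ[P] 0 := by
    refine h1.trans ?_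
    filter_upwards [h.2.1] with w hw
    rw [hw]; simp
  rw [integral_congr_ae h2]; simp

lemma IsStochGrad.integral_mul_sq_le (h : IsStochGrad P f σ₁ m q g) (hm : m ≤ mΩ)
    {φ : Ω → ℝ} {c : ℝ} (hφ : StronglyMeasurable[m] φ) (hφ0 : ∀ w, 0 ≤ φ w) (hφc : ∀ w, φ w ≤ c) :
    Integrable (fun w => φ w * ‖g w - gradient f (q w)‖ ^ 2) P ∧
      ∫ w, φ w * ‖g w - gradient f (q w)‖ ^ 2 ∂P ≤ ∫ w, φ w * σ₁ ^ 2 ∂P := by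
  have hb : ∀ᵐ w ∂P, ‖φ w‖ ≤ c := Filter.Eventually.of_forall fun w => by
    rw [Real.norm_eq_abs, abs_of_nonneg (hφ0 w)]; exact hφc w
  have hi : Integrable (fun w => φ w * ‖g w - gradient f (q w)‖ ^ 2) P :=
    h.integrable_sq.bdd_mul (hφ.mono hm).aestronglyMeasurable hb
  refine ⟨hi, ?_⟩
  have h1 := condExp_mul_of_stronglyMeasurable_left (m := m) (μ := P) hφ hi h.integrable_sq
  rw [← integral_condExp hm]
  have h3 : P[fun w => φ w * ‖g w - gradient f (q w)‖ ^ 2 | m] ≤ᵐ[P] fun w => φ w * σ₁ ^ 2 := by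
    filter_upwards [h1, h.2.2] with w hw hw2
    have : (fun w => φ w * ‖g w - gradient f (q w)‖ ^ 2)
        = (φ * fun w => ‖g w - gradient f (q w)‖ ^ 2) := rfl
    rw [this, hw]
    exact mul_le_mul_of_nonneg_left hw2 (hφ0 w)
  refine integral_mono_ae integrable_condExp ?_ h3
  exact (integrable_const (σ₁ ^ 2)).bdd_mul (hφ.mono hm).aestronglyMeasurable hb

/-- Needed because for `σ_1 = 0` the parameter `λ_t` vanishes and can absorb nothing. -/
lemma IsStochGrad.ae_eq_zero (h : IsStochGrad P f 0 m q g) (hm : m ≤ mΩ) :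
    ∀ᵐ w ∂P, g w - gradient f (q w) = 0 := by
  have h1 := (h.integral_mul_sq_le hm (φ := fun _ => 1) (c := 1) stronglyMeasurable_const
    (fun _ => zero_le_one) (fun _ => le_rfl)).2
  simp only [one_mul] at h1
  have h2 : ∫ w, ‖g w - gradient f (q w)‖ ^ 2 ∂P = 0 :=
    le_antisymm (by simpa using h1) (integral_nonneg fun _ => by positivity)
  rw [integral_eq_zero_iff_of_nonneg (fun _ => by positivity) h.integrable_sq] at h2
  filter_upwards [h2] with w hw
  simpa using hw

end StochGrad

/-! ### The accumulated error -/

namespace Param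

variable (Q : Param)

/-- The factor of `ρ ‖n‖²` in the error of iteration `j`. -/
def noiseWeight (j : ℕ) : ℝ :=
  (alpha Q.p j / bigA Q.p j) ^ 2 / (Q.aL * Q.σ 1 * ((j : ℝ) + Q.p + 1) ^ ((Q.p : ℝ) + 1 / 2))

/-- The factor of `ρ Δ²` in the error of iteration `j`. -/
def modelWeight (j : ℕ) : ℝ :=
  (bigA Q.p j)⁻¹ / (Q.aD * (Q.σ 1 + Q.τ) * ((j : ℝ) + Q.p + 1) ^ ((3 : ℝ) / 2))

/-- The contribution of the regularizers to the estimate of one run of the inner method. -/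
def regTerm (ρ r : ℝ) (t : ℕ) : ℝ :=
  Q.lam ρ t / 2 * r ^ 2
    + ∑ i ∈ Finset.Icc 2 (Q.p + 1), Q.kappa ρ i t / (Nat.factorial i : ℝ) * r ^ i

variable {Q}

lemma Nonneg.noiseWeight_nonneg (h : Q.Nonneg) (j : ℕ) : 0 ≤ Q.noiseWeight j := by
  have := h.σ_one
  have := h.aL_pos
  unfold noiseWeight; positivity

lemma Nonneg.modelWeight_nonneg (h : Q.Nonneg) (j : ℕ) : 0 ≤ Q.modelWeight j := by
  have := h.σ_one
  have := h.τ_nonneg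
  have := h.two_le_aD
  have := (inv_bigA_pos Q.p j).le
  unfold modelWeight; positivity

/-- Both `λ_j` and the stochastic part of `δ̄_j` are proportional to `1/ρ`. Dropping the `σ_2` part
of `δ̄_j` leaves an error equal to `ρ` times deterministic weights, so that the random factor `ρ`
separates from the noise. -/
lemma Nonneg.stepError_le (h : Q.Nonneg) {ρ : ℝ} (hρ : 0 < ρ) (j : ℕ) (n : Vec d) {Δ : ℝ}
    (hΔ : Q.σ 1 + Q.τ = 0 → Δ = 0) :
    Q.stepError ρ j n Δ ≤ ρ * (Q.noiseWeight j * ‖n‖ ^ 2 + Q.modelWeight j * Δ ^ 2) := by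
  have h1 := h.σ_one
  have h2 := h.τ_nonneg
  have h3 := h.two_le_aD
  have hW := inv_bigA_pos Q.p j
  have e1 : (alpha Q.p j / bigA Q.p j) ^ 2 * ‖n‖ ^ 2 / Q.lam ρ j
      = ρ * (Q.noiseWeight j * ‖n‖ ^ 2) := by
    unfold lam noiseWeight
    simp only [div_eq_mul_inv, mul_inv, inv_inv]
    ring
  have e2 : (bigA Q.p j)⁻¹ * (Δ ^ 2 / Q.deltaBar ρ j) ≤ ρ * (Q.modelWeight j * Δ ^ 2) := by
    rcases (add_nonneg h1 h2).eq_or_lt with h0 | h0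
    · rw [hΔ h0.symm]; simp
    · have hN : 0 < ((j : ℝ) + Q.p + 1) ^ ((3 : ℝ) / 2) := by positivity
      have h4 : Q.aD * ((Q.σ 1 + Q.τ) / ρ * ((j : ℝ) + Q.p + 1) ^ ((3 : ℝ) / 2))
          ≤ Q.deltaBar ρ j := by
        unfold deltaBar
        have := h.σ_two
        gcongr
        linarith
      have h5 : 0 < Q.aD * ((Q.σ 1 + Q.τ) / ρ * ((j : ℝ) + Q.p + 1) ^ ((3 : ℝ) / 2)) := by
        positivity
      calc _ ≤ (bigA Q.p j)⁻¹ * (Δ ^ 2 /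
            (Q.aD * ((Q.σ 1 + Q.τ) / ρ * ((j : ℝ) + Q.p + 1) ^ ((3 : ℝ) / 2)))) := by
            gcongr
        _ = _ := by
            unfold modelWeight
            simp only [div_eq_mul_inv, mul_inv, inv_inv]
            ring
  rw [stepError, e1, mul_add]
  linarith

lemma Nonneg.regTerm_nonneg (h : Q.Nonneg) {ρ r : ℝ} (hρ : 0 < ρ) (hr : 0 ≤ r) (t : ℕ) :
    0 ≤ Q.regTerm ρ r t := by
  unfold regTerm
  have h1 := h.lam_nonneg hρ t
  refine add_nonneg (by positivity) (Finset.sum_nonneg fun i hi => ?_)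
  have := h.kappa_nonneg hρ t hi
  positivity

/-- Supplies a constant bound on an event where `ρ` is bounded below and the distance above. -/
lemma Nonneg.regTerm_le (h : Q.Nonneg) {ρ ρ' r r' : ℝ} (hρ : 0 < ρ') (hρ' : ρ' ≤ ρ)
    (hr : 0 ≤ r) (hr' : r ≤ r') (t : ℕ) : Q.regTerm ρ r t ≤ Q.regTerm ρ' r' t := by
  have h1 := h.σ_one
  have h2 := h.τ_nonneg
  have h3 := h.two_le_aD
  have h4 := h.aL_pos
  have e1 : Q.lam ρ t ≤ Q.lam ρ' t := by
    unfold lam; gcongr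
  have e2 : Q.deltaBar ρ t ≤ Q.deltaBar ρ' t := by
    unfold deltaBar; gcongr
  have e3 : ∀ i ∈ Finset.Icc 2 (Q.p + 1), Q.kappa ρ i t ≤ Q.kappa ρ' i t := by
    intro i hi
    rw [kappa_eq, kappa_eq]
    have : Q.level (Q.deltaBar ρ t) i ≤ Q.level (Q.deltaBar ρ' t) i := by
      unfold level
      split_ifs
      · exact e2
      · exact le_rfl
      · exact le_rfl
    have h5 := h.aK_nonneg hi
    have h6 := (inv_bigA_pos Q.p t).le
    have h7 := (alpha_pos Q.p t).le
    gcongr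
  have h5 := h.lam_nonneg hρ t
  unfold regTerm
  refine add_le_add (by gcongr) (Finset.sum_le_sum fun i hi => ?_)
  have h6 := e3 i hi
  have h7 := h.kappa_nonneg hρ t hi
  gcongr

variable (Q)

lemma measurable_lam (t : ℕ) : Measurable fun ρ : ℝ => Q.lam ρ t := by
  unfold lam; fun_prop

lemma measurable_kappa (i t : ℕ) : Measurable fun ρ : ℝ => Q.kappa ρ i t := by
  unfold kappa deltaBar
  split_ifs <;> fun_prop

lemma measurable_regTerm (t : ℕ) : Measurable fun a : ℝ × ℝ => Q.regTerm a.1 a.2 t := by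
  unfold regTerm
  have h1 : Measurable fun a : ℝ × ℝ => Q.lam a.1 t := (Q.measurable_lam t).comp measurable_fst
  have h2 : ∀ i, Measurable fun a : ℝ × ℝ => Q.kappa a.1 i t :=
    fun i => (Q.measurable_kappa i t).comp measurable_fst
  refine Measurable.add ((h1.div_const 2).mul (measurable_snd.pow_const 2)) ?_
  refine Finset.measurable_sum _ fun i _ => ?_
  exact ((h2 i).div_const _).mul (measurable_snd.pow_const i)

end Param

/-! ### The inner method in expectation -/

section Run

variable {Ω : Type*} [mΩ : MeasurableSpace Ω] {P : Measure Ω}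
  {Q : Param} {f : Vec d → ℝ} {xs : Vec d} {μ L C R : ℝ} {z₀ : Vec d}
  {z : ℕ → Ω → Vec d} {ρ : ℕ → Ω → ℝ} {x y gv gx : ℕ → ℕ → Ω → Vec d}
  {H : ℕ → ℕ → Ω → (i : ℕ) → ContinuousMultilinearMap ℝ (fun _ : Fin i => Vec d) ℝ}
  {F G : ℕ → ℕ → MeasurableSpace Ω}

lemma IsRestartedRun.F_mono (hrun : IsRestartedRun P Q f xs μ L C R z₀ z ρ x y gv gx H F G)
    (s t : ℕ) : F s 0 ≤ F s t := by
  induction t with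
  | zero => exact le_rfl
  | succ t ih => exact ih.trans ((hrun.F_le_G s t).trans (hrun.G_le_F s t))

variable [IsProbabilityMeasure P]

/-- The fundamental estimate holds along almost every trajectory of each restart. -/
lemma IsRestartedRun.ae_weighted_gap_le
    (hrun : IsRestartedRun P Q f xs μ L C R z₀ z ρ x y gv gx H F G) (h : Q.Nonneg)
    (hf : HasLipschitzDeriv Q.p L f) (hL : 0 ≤ L) (hLM : L ≤ Q.M)
    (hconv : ∀ a b, f a + inner ℝ (gradient f a) (b - a) ≤ f b) (s : ℕ) :
    ∀ᵐ w ∂P, ∀ t, (∑ j ∈ Finset.range t, alpha Q.p j / bigA Q.p j) * (f (x s t w) - f xs)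
        + Q.lam (ρ s w) t / 4 * ‖xs - y s t w‖ ^ 2
      ≤ Q.regTerm (ρ s w) ‖z s w - xs‖ t
        + ∑ j ∈ Finset.range t, (ρ s w *
          (Q.noiseWeight j * ‖gx s j w - gradient f (x s (j + 1) w)‖ ^ 2
            + Q.modelWeight j * (2 * Q.τ ^ 2 + 2 *
              ‖gv s j w - gradient f (Q.vPoint (fun k => x s k w) (fun k => y s k w) j)‖ ^ 2))
          + alpha Q.p j / bigA Q.p j *
            inner ℝ (gx s j w - gradient f (x s (j + 1) w)) (xs - y s j w)) := by
  -- Almost surely the errors vanish whenever the parameters dividing them do, as the deterministic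
  -- estimate demands.
  have hgx0 : ∀ᵐ w ∂P, ∀ t, Q.σ 1 = 0 → gx s t w - gradient f (x s (t + 1) w) = 0 := by
    rw [ae_all_iff]
    intro t
    by_cases h0 : Q.σ 1 = 0
    · have h1 := hrun.grad_x s t
      rw [h0] at h1
      filter_upwards [h1.ae_eq_zero (hrun.G_le s t)] with w hw _ using hw
    · exact Filter.Eventually.of_forall fun w h1 => absurd h1 h0
  have hgv0 : ∀ᵐ w ∂P, ∀ t, Q.σ 1 = 0 →
      gv s t w - gradient f (Q.vPoint (fun k => x s k w) (fun k => y s k w) t) = 0 := by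
    rw [ae_all_iff]
    intro t
    by_cases h0 : Q.σ 1 = 0
    · have h1 := hrun.grad_v s t
      rw [h0] at h1
      filter_upwards [h1.ae_eq_zero (hrun.F_le s t)] with w hw _ using hw
    · exact Filter.Eventually.of_forall fun w h1 => absurd h1 h0
  have hder := ae_all_iff.2 (hrun.derivs s)
  filter_upwards [hgx0, hgv0, hder, hrun.trajectory s, hrun.ρ_pos s] with w hx0 hv0 hH hT hρ t
  have hσ1 := h.σ_one
  have hτ := h.τ_nonneg
  have hΔ0 : ∀ j, Q.σ 1 + Q.τ = 0 → Q.τ +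
      ‖gv s j w - gradient f (Q.vPoint (fun k => x s k w) (fun k => y s k w) j)‖ = 0 := by
    intro j h0
    have h1 : Q.σ 1 = 0 := by linarith
    have h2 : Q.τ = 0 := by linarith
    rw [hv0 j h1, h2]; simp
  have hN : ∀ (j : ℕ) (e : ℝ), 0 < ((j : ℝ) + Q.p + 1) ^ e := fun j e => by positivity
  have key := h.weighted_gap_le hρ hf hL hLM hconv hT hH (fun _ => rfl) (fun _ => rfl)
    (fun j h0 => by
      refine hx0 j ?_
      by_contra h1
      have h2 : 0 < Q.σ 1 := lt_of_le_of_ne hσ1 (Ne.symm h1)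
      have h3 := h.aL_pos
      have h4 := hN j ((Q.p : ℝ) + 1 / 2)
      have : 0 < Q.lam (ρ s w) j := by unfold Param.lam; positivity
      exact this.ne' h0)
    (fun j h0 => by
      refine hΔ0 j ?_
      by_contra h1
      have h2 : 0 < Q.σ 1 + Q.τ := lt_of_le_of_ne (add_nonneg hσ1 hτ) (Ne.symm h1)
      have h3 := h.two_le_aD
      have h4 := hN j ((3 : ℝ) / 2)
      have h5 := h.σ_two
      have : 0 < Q.deltaBar (ρ s w) j := by unfold Param.deltaBar; positivity
      exact this.ne' h0) t xs
  refine key.trans (add_le_add le_rfl (Finset.sum_le_sum fun j _ => add_le_add ?_ le_rfl))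
  refine (h.stepError_le hρ j _ (hΔ0 j)).trans ?_
  have h1 := h.noiseWeight_nonneg j
  have h2 := h.modelWeight_nonneg j
  refine mul_le_mul_of_nonneg_left (add_le_add le_rfl (mul_le_mul_of_nonneg_left ?_ h2)) hρ.le
  nlinarith [sq_nonneg (Q.τ -
    ‖gv s j w - gradient f (Q.vPoint (fun k => x s k w) (fun k => y s k w) j)‖)]

end Run

namespace Param

/-- The accumulated noise factor of `t` iterations. -/
def noiseTerm (Q : Param) (t : ℕ) : ℝ :=
  ∑ j ∈ Finset.range t, (Q.noiseWeight j * Q.σ 1 ^ 2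
    + Q.modelWeight j * (2 * Q.τ ^ 2 + 2 * Q.σ 1 ^ 2))

end Param

section Run

variable {Ω : Type*} [mΩ : MeasurableSpace Ω] {P : Measure Ω} [IsProbabilityMeasure P]
  {Q : Param} {f : Vec d → ℝ} {xs : Vec d} {μ L C R : ℝ} {z₀ : Vec d}
  {z : ℕ → Ω → Vec d} {ρ : ℕ → Ω → ℝ} {x y gv gx : ℕ → ℕ → Ω → Vec d}
  {H : ℕ → ℕ → Ω → (i : ℕ) → ContinuousMultilinearMap ℝ (fun _ : Fin i => Vec d) ℝ}
  {F G : ℕ → ℕ → MeasurableSpace Ω}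

/-- On an event of the initial history on which the distance parameter and the initial distance are
bounded, the expected gap after `T` iterations is bounded by the regularizers and the noise. -/
lemma IsRestartedRun.lintegral_gap_le
    (hrun : IsRestartedRun P Q f xs μ L C R z₀ z ρ x y gv gx H F G) (h : Q.Nonneg)
    (hf : HasLipschitzDeriv Q.p L f) (hL : 0 ≤ L) (hLM : L ≤ Q.M)
    (hconv : ∀ a b, f a + inner ℝ (gradient f a) (b - a) ≤ f b) (hmin : ∀ x, f xs ≤ f x) (s : ℕ)
    {B : Set Ω} (hB : MeasurableSet[F s 0] B) {N : ℝ} (hN : 0 < N)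
    (hBN : ∀ w ∈ B, N⁻¹ ≤ ρ s w ∧ ρ s w ≤ N ∧ ‖z s w - xs‖ ≤ N) {T : ℕ} (hT : 1 ≤ T)
    {b : Ω → ℝ} (hbi : IntegrableOn b B P)
    (hb : ∀ w ∈ B, Q.regTerm (ρ s w) ‖z s w - xs‖ T + ρ s w * Q.noiseTerm T
      ≤ (∑ j ∈ Finset.range T, alpha Q.p j / bigA Q.p j) * b w) :
    ∫⁻ w in B, ENNReal.ofReal (f (x s T w) - f xs) ∂P ≤ ∫⁻ w in B, ENNReal.ofReal (b w) ∂P := by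
  have hgap := hrun.ae_weighted_gap_le h hf hL hLM hconv s
  set nx : ℕ → Ω → Vec d := fun j w => gx s j w - gradient f (x s (j + 1) w) with hnx
  set nv : ℕ → Ω → Vec d := fun j w => gv s j w -
    gradient f (Q.vPoint (fun k => x s k w) (fun k => y s k w) j) with hnv
  -- Cutting off by an event of the initial history preserves measurability with respect to every
  -- later history, and makes the random factors bounded.
  set φ : Ω → ℝ := B.indicator (ρ s) with hφ
  set Y : ℕ → Ω → Vec d := fun j => B.indicator (fun w => xs - y s j w) with hY
  have hBm : MeasurableSet B := hrun.F_le s 0 _ hB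
  have hφm : StronglyMeasurable[F s 0] φ := (hrun.ρ_meas s).indicator hB
  have hφ0 : ∀ w, 0 ≤ φ w := by
    intro w
    by_cases hw : w ∈ B
    · simp only [hφ, Set.indicator_of_mem hw]
      exact (inv_pos.2 hN).le.trans (hBN w hw).1
    · simp [hφ, Set.indicator_of_notMem hw]
  have hφN : ∀ w, φ w ≤ N := by
    intro w
    by_cases hw : w ∈ B
    · simp only [hφ, Set.indicator_of_mem hw]
      exact (hBN w hw).2.1
    · simp only [hφ, Set.indicator_of_notMem hw]
      exact hN.le
  have hYm : ∀ j, StronglyMeasurable[F s j] (Y j) := fun j =>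
    (stronglyMeasurable_const.sub (hrun.y_meas s j)).indicator (hrun.F_mono s j _ hB)
  have I1 : ∀ j, Integrable (fun w => φ w * ‖nx j w‖ ^ 2) P ∧
      ∫ w, φ w * ‖nx j w‖ ^ 2 ∂P ≤ ∫ w, φ w * Q.σ 1 ^ 2 ∂P := fun j =>
    (hrun.grad_x s j).integral_mul_sq_le (hrun.G_le s j)
      (hφm.mono ((hrun.F_mono s j).trans (hrun.F_le_G s j))) hφ0 hφN
  have I2 : ∀ j, Integrable (fun w => φ w * ‖nv j w‖ ^ 2) P ∧
      ∫ w, φ w * ‖nv j w‖ ^ 2 ∂P ≤ ∫ w, φ w * Q.σ 1 ^ 2 ∂P := fun j =>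
    (hrun.grad_v s j).integral_mul_sq_le (hrun.F_le s j) (hφm.mono (hrun.F_mono s j)) hφ0 hφN
  have hφi : Integrable φ P := by
    refine (integrable_const N).mono' (hφm.mono (hrun.F_le s 0)).aestronglyMeasurable
      (Filter.Eventually.of_forall fun w => ?_)
    rw [Real.norm_eq_abs, abs_of_nonneg (hφ0 w)]; exact hφN w
  set E : ℕ → Ω → ℝ := fun j w => Q.noiseWeight j * (φ w * ‖nx j w‖ ^ 2)
    + Q.modelWeight j * (2 * Q.τ ^ 2 * φ w + 2 * (φ w * ‖nv j w‖ ^ 2)) with hE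
  have hEi : ∀ j, Integrable (E j) P := fun j =>
    ((I1 j).1.const_mul _).add (((hφi.const_mul _).add ((I2 j).1.const_mul _)).const_mul _)
  -- the fundamental estimate, multiplied by the indicator of `B`
  have hpt : ∀ᵐ w ∂P, ∀ t, (∑ j ∈ Finset.range t, alpha Q.p j / bigA Q.p j) *
        B.indicator (fun w => f (x s t w) - f xs) w + Q.lam N t / 4 * ‖Y t w‖ ^ 2
      ≤ B.indicator (fun w => Q.regTerm (ρ s w) ‖z s w - xs‖ t) w
        + ∑ j ∈ Finset.range t,
          (E j w + alpha Q.p j / bigA Q.p j * inner ℝ (nx j w) (Y j w)) := by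
    filter_upwards [hgap] with w hw t
    by_cases hwB : w ∈ B
    · simp only [hE, hY, hφ, Set.indicator_of_mem hwB]
      have h1 := hBN w hwB
      have h2 : 0 < ρ s w := (inv_pos.2 hN).trans_le h1.1
      have h3 : Q.lam N t ≤ Q.lam (ρ s w) t := by
        have := h.σ_one
        have := h.aL_pos
        have := h1.2.1
        unfold Param.lam; gcongr
      have h4 : Q.lam N t / 4 * ‖xs - y s t w‖ ^ 2 ≤ Q.lam (ρ s w) t / 4 * ‖xs - y s t w‖ ^ 2 := by
        gcongr
      have h5 := hw t
      refine le_trans (add_le_add le_rfl h4) (h5.trans (le_of_eq ?_))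
      congr 1
      refine Finset.sum_congr rfl fun j _ => ?_
      simp only [hnx, hnv]
      ring
    · simp [hE, hY, hφ, Set.indicator_of_notMem hwB]
  have hgap0 : ∀ t w, 0 ≤ B.indicator (fun w => f (x s t w) - f xs) w := fun t w =>
    Set.indicator_nonneg (fun w _ => sub_nonneg.2 (hmin _)) w
  have hα0 : ∀ j, 0 ≤ alpha Q.p j / bigA Q.p j :=
    fun j => div_nonneg (alpha_pos _ _).le (bigA_pos _ _).le
  have hreg : ∀ t w, B.indicator (fun w => Q.regTerm (ρ s w) ‖z s w - xs‖ t) w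
      ≤ Q.regTerm N⁻¹ N t := by
    intro t w
    by_cases hwB : w ∈ B
    · have h1 := hBN w hwB
      simp only [Set.indicator_of_mem hwB]
      exact h.regTerm_le (inv_pos.2 hN) h1.1 (norm_nonneg _) h1.2.2 t
    · simp only [Set.indicator_of_notMem hwB]
      exact h.regTerm_nonneg (inv_pos.2 hN) hN.le t
  -- The martingale property needs `Y_t` in `L²`, which is not assumed. The pathwise estimate at
  -- time `t` bounds `λ_t ‖Y_t‖² / 4` by quantities involving only cross terms with index below `t`,
  -- so a strong induction works. If `σ_1 = 0` this bound is void, but then the noise is zero.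
  have hcross : ∀ t, Integrable (fun w => inner ℝ (nx t w) (Y t w)) P ∧
      ∫ w, inner ℝ (nx t w) (Y t w) ∂P = 0 := by
    by_cases hσ : Q.σ 1 = 0
    · intro t
      have h1 := hrun.grad_x s t
      rw [hσ] at h1
      have h2 : (fun w => inner ℝ (nx t w) (Y t w)) =ᵐ[P] fun _ => (0 : ℝ) := by
        filter_upwards [h1.ae_eq_zero (hrun.G_le s t)] with w hw
        simp only [hnx]
        rw [hw, inner_zero_left]
      exact ⟨(integrable_zero _ _ _).congr h2.symm, by rw [integral_congr_ae h2]; simp⟩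
    · intro t
      induction t using Nat.strong_induction_on with
      | _ t ih =>
        refine (hrun.grad_x s t).integral_inner_eq_zero (hrun.G_le s t)
          ((hYm t).mono (hrun.F_le_G s t)) ?_
        have hYm' : AEStronglyMeasurable (Y t) P :=
          ((hYm t).mono (hrun.F_le s t)).aestronglyMeasurable
        rw [memLp_two_iff_integrable_sq_norm hYm']
        have hlam : 0 < Q.lam N t := by
          have h1 : 0 < Q.σ 1 := lt_of_le_of_ne h.σ_one (Ne.symm hσ)
          have h2 := h.aL_pos
          have h3 : 0 < ((t : ℝ) + Q.p + 1) ^ ((Q.p : ℝ) + 1 / 2) := by positivity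
          unfold Param.lam; positivity
        have hdom : Integrable (fun w => 4 / Q.lam N t * (Q.regTerm N⁻¹ N t
            + ∑ j ∈ Finset.range t,
              (E j w + alpha Q.p j / bigA Q.p j * inner ℝ (nx j w) (Y j w)))) P :=
          ((integrable_const _).add (integrable_finsetSum _ fun j hj =>
            (hEi j).add ((ih j (Finset.mem_range.1 hj)).1.const_mul _))).const_mul _
        refine hdom.mono' (hYm'.norm.pow 2) ?_
        filter_upwards [hpt] with w hw
        have h1 := hw t
        have h2 : 0 ≤ (∑ j ∈ Finset.range t, alpha Q.p j / bigA Q.p j) *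
            B.indicator (fun w => f (x s t w) - f xs) w :=
          mul_nonneg (Finset.sum_nonneg fun j _ => hα0 j) (hgap0 t w)
        have h3 := hreg t w
        rw [Real.norm_eq_abs, abs_of_nonneg (sq_nonneg _)]
        calc ‖Y t w‖ ^ 2 = 4 / Q.lam N t * (Q.lam N t / 4 * ‖Y t w‖ ^ 2) := by
              field_simp
          _ ≤ _ := by
              refine mul_le_mul_of_nonneg_left ?_ (by positivity)
              linarith
  have hSi : ∀ j, Integrable
      (fun w => E j w + alpha Q.p j / bigA Q.p j * inner ℝ (nx j w) (Y j w)) P :=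
    fun j => (hEi j).add ((hcross j).1.const_mul _)
  have hregi : Integrable (B.indicator fun w => Q.regTerm (ρ s w) ‖z s w - xs‖ T) P := by
    refine (integrable_const (Q.regTerm N⁻¹ N T)).mono' ?_ (Filter.Eventually.of_forall fun w => ?_)
    · have h1 : Measurable fun w => Q.regTerm (ρ s w) ‖z s w - xs‖ T :=
        (Q.measurable_regTerm T).comp
          (((hrun.ρ_meas s).mono (hrun.F_le s 0)).measurable.prodMk
            ((((hrun.z_meas s).mono (hrun.F_le s 0)).sub stronglyMeasurable_const).norm.measurable))
      exact (h1.indicator hBm).aestronglyMeasurable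
    · rw [Real.norm_eq_abs, abs_of_nonneg]
      · exact hreg T w
      · refine Set.indicator_nonneg (fun w hw => ?_) w
        exact h.regTerm_nonneg ((inv_pos.2 hN).trans_le (hBN w hw).1) (norm_nonneg _) T
  set W := ∑ j ∈ Finset.range T, alpha Q.p j / bigA Q.p j with hW
  have hW0 : 0 < W := by
    obtain ⟨t, rfl⟩ : ∃ t, T = t + 1 := ⟨T - 1, by omega⟩
    rw [hW, sum_alpha_div_bigA]
    exact inv_bigA_pos _ _
  have hup : ∀ᵐ w ∂P, W * B.indicator (fun w => f (x s T w) - f xs) w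
      ≤ B.indicator (fun w => Q.regTerm (ρ s w) ‖z s w - xs‖ T) w + ∑ j ∈ Finset.range T,
          (E j w + alpha Q.p j / bigA Q.p j * inner ℝ (nx j w) (Y j w)) := by
    filter_upwards [hpt] with w hw
    have h1 := hw T
    have h2 : 0 ≤ Q.lam N T / 4 * ‖Y T w‖ ^ 2 := by
      have := h.lam_nonneg hN T
      positivity
    linarith
  have hupi := hregi.add (integrable_finsetSum (Finset.range T) fun j _ => hSi j)
  have hfm : Measurable fun w => f (x s T w) - f xs :=
    ((hf.differentiable (by have := h.two_le; omega)).continuous.measurable.comp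
      ((hrun.x_meas s T).mono (hrun.F_le s T)).measurable).sub_const _
  have hfi : Integrable (fun w => W * B.indicator (fun w => f (x s T w) - f xs) w) P := by
    refine hupi.mono' ((hfm.indicator hBm).const_mul W).aestronglyMeasurable ?_
    filter_upwards [hup] with w hw
    rw [Real.norm_eq_abs, abs_of_nonneg (mul_nonneg hW0.le (hgap0 T w))]
    exact hw
  have hEint : ∀ j, ∫ w, (E j w + alpha Q.p j / bigA Q.p j * inner ℝ (nx j w) (Y j w)) ∂P
      ≤ (∫ w, φ w ∂P) * (Q.noiseWeight j * Q.σ 1 ^ 2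
        + Q.modelWeight j * (2 * Q.τ ^ 2 + 2 * Q.σ 1 ^ 2)) := by
    intro j
    rw [integral_add (hEi j) ((hcross j).1.const_mul _), integral_const_mul, (hcross j).2,
      mul_zero, add_zero]
    simp only [hE]
    have h0 : Integrable (fun w => 2 * Q.τ ^ 2 * φ w + 2 * (φ w * ‖nv j w‖ ^ 2)) P :=
      (hφi.const_mul _).add ((I2 j).1.const_mul _)
    rw [integral_add ((I1 j).1.const_mul _) (h0.const_mul _), integral_const_mul,
      integral_const_mul, integral_add (hφi.const_mul _) ((I2 j).1.const_mul _),
      integral_const_mul, integral_const_mul]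
    have h1 := (I1 j).2
    have h2 := (I2 j).2
    rw [integral_mul_const] at h1 h2
    have h3 := mul_le_mul_of_nonneg_left h1 (h.noiseWeight_nonneg j)
    have h4 := mul_le_mul_of_nonneg_left h2 (h.modelWeight_nonneg j)
    linarith
  have hbi' : Integrable (B.indicator b) P := hbi.integrable_indicator hBm
  have hint : ∫ w, B.indicator (fun w => f (x s T w) - f xs) w ∂P ≤ ∫ w, B.indicator b w ∂P := by
    have h1 := integral_mono_ae hfi hupi hup
    rw [integral_const_mul] at h1
    simp only [Pi.add_apply] at h1
    rw [integral_add hregi (integrable_finsetSum (Finset.range T) fun j _ => hSi j),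
      integral_finsetSum _ fun j _ => hSi j] at h1
    have h2 := Finset.sum_le_sum fun j (_ : j ∈ Finset.range T) => hEint j
    rw [← Finset.mul_sum] at h2
    change _ ≤ (∫ w, φ w ∂P) * Q.noiseTerm T at h2
    have h3 : ∫ w, (B.indicator (fun w => Q.regTerm (ρ s w) ‖z s w - xs‖ T) w
        + φ w * Q.noiseTerm T) ∂P ≤ ∫ w, W * B.indicator b w ∂P := by
      refine integral_mono (hregi.add (hφi.mul_const _)) (hbi'.const_mul _) fun w => ?_
      by_cases hwB : w ∈ B
      · simp only [hφ, Set.indicator_of_mem hwB]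
        exact hb w hwB
      · simp [hφ, Set.indicator_of_notMem hwB]
    rw [integral_add hregi (hφi.mul_const _), integral_mul_const, integral_const_mul] at h3
    exact le_of_mul_le_mul_left (by linarith) hW0
  have hfi' : Integrable (B.indicator fun w => f (x s T w) - f xs) P := by
    have := hfi.const_mul W⁻¹
    refine this.congr (Filter.Eventually.of_forall fun w => ?_)
    simp only
    rw [inv_mul_cancel_left₀ hW0.ne']
  have hb0 : ∀ w ∈ B, 0 ≤ b w := by
    intro w hw
    have h1 := (inv_pos.2 hN).trans_le (hBN w hw).1
    have h2 : 0 ≤ W * b w := by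
      refine le_trans (add_nonneg (h.regTerm_nonneg h1 (norm_nonneg _) T)
        (mul_nonneg h1.le ?_)) (hb w hw)
      refine Finset.sum_nonneg fun j _ => ?_
      have := h.noiseWeight_nonneg j
      have := h.modelWeight_nonneg j
      positivity
    exact nonneg_of_mul_nonneg_right h2 hW0
  rw [integral_indicator hBm, integral_indicator hBm] at hint
  rw [← ofReal_integral_eq_lintegral_ofReal, ← ofReal_integral_eq_lintegral_ofReal]
  · exact ENNReal.ofReal_le_ofReal hint
  · exact hbi
  · exact (ae_restrict_iff' hBm).2 (Filter.Eventually.of_forall hb0)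
  · exact (integrable_indicator_iff hBm).1 hfi'
  · exact Filter.Eventually.of_forall fun w => sub_nonneg.2 (hmin _)

end Run

/-! ### The rate of the inner method -/

lemma rpow_add_half_eq {N : ℝ} (hN : 0 < N) (p : ℕ) :
    N ^ ((p : ℝ) + 1 / 2) = N ^ (p + 1) / √N := by
  rw [Real.sqrt_eq_rpow, ← Real.rpow_natCast, ← Real.rpow_sub hN]
  congr 1; push_cast; ring

lemma rpow_three_half_eq {N : ℝ} (hN : 0 < N) : N ^ ((3 : ℝ) / 2) = N ^ 2 / √N := by
  rw [Real.sqrt_eq_rpow, ← Real.rpow_natCast, ← Real.rpow_sub hN]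
  congr 1; push_cast; norm_num

/-- A constant for the rate of the inner method. -/
def rateConst (p : ℕ) (aD aL : ℝ) (aK : ℕ → ℝ) : ℝ :=
  ((p : ℝ) + 2) * ((p : ℝ) + 1) ^ (p + 1) * aL
    + ((p : ℝ) + 2) * ((p : ℝ) + 1) ^ (p + 1) * (aD + 1) * ∑ i ∈ Finset.Icc 2 (p + 1), aK i
    + ((p : ℝ) + 1) ^ (p + 1) * (((p : ℝ) + 1) ^ 2 / aL + 2 / aD)

namespace Param

/-- The error of the inner method after `T` iterations, up to constants. -/
def rate (Q : Param) (ρ r T : ℝ) : ℝ :=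
  (Q.σ 1 + Q.τ) * (ρ + r ^ 2 / ρ) / √T
    + ∑ i ∈ Finset.Icc 2 Q.p, Q.σ i * r ^ i / T ^ i + Q.M * r ^ (Q.p + 1) / T ^ (Q.p + 1)

variable {Q : Param}

lemma Nonneg.rate_parts (h : Q.Nonneg) {ρ r T : ℝ} (hρ : 0 < ρ) (hr : 0 ≤ r) (hT : 0 < T) :
    0 ≤ Q.rate ρ r T ∧ Q.σ 1 * (r ^ 2 / ρ) / √T ≤ Q.rate ρ r T ∧
    (Q.σ 1 + Q.τ) * ρ / √T ≤ Q.rate ρ r T ∧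
    Q.σ 2 * r ^ 2 / T ^ 2 + (Q.σ 1 + Q.τ) * (r ^ 2 / ρ) / √T ≤ Q.rate ρ r T ∧
    (∀ i ∈ Finset.Icc 2 Q.p, Q.σ i * r ^ i / T ^ i ≤ Q.rate ρ r T) ∧
    Q.M * r ^ (Q.p + 1) / T ^ (Q.p + 1) ≤ Q.rate ρ r T := by
  have h1 := h.σ_one
  have h2 := h.τ_nonneg
  have h3 := h.M_nonneg
  have hs : 0 < √T := Real.sqrt_pos.2 hT
  have e1 : (Q.σ 1 + Q.τ) * (ρ + r ^ 2 / ρ) / √T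
      = (Q.σ 1 + Q.τ) * ρ / √T + (Q.σ 1 * (r ^ 2 / ρ) / √T + Q.τ * (r ^ 2 / ρ) / √T) := by ring
  have p1 : 0 ≤ (Q.σ 1 + Q.τ) * ρ / √T := by positivity
  have p2 : 0 ≤ Q.σ 1 * (r ^ 2 / ρ) / √T := by positivity
  have p3 : 0 ≤ Q.τ * (r ^ 2 / ρ) / √T := by positivity
  have p4 : 0 ≤ Q.M * r ^ (Q.p + 1) / T ^ (Q.p + 1) := by positivity
  have p5 : ∀ i ∈ Finset.Icc 2 Q.p, 0 ≤ Q.σ i * r ^ i / T ^ i := fun i hi => by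
    rw [Finset.mem_Icc] at hi
    have := h.σ_nonneg i (Finset.mem_Icc.2 ⟨by omega, hi.2⟩)
    positivity
  have p6 : ∀ i ∈ Finset.Icc 2 Q.p, Q.σ i * r ^ i / T ^ i
      ≤ ∑ i ∈ Finset.Icc 2 Q.p, Q.σ i * r ^ i / T ^ i := fun i hi =>
    Finset.single_le_sum p5 hi
  have p7 := Finset.sum_nonneg p5
  have p8 := p6 2 (Finset.mem_Icc.2 ⟨le_rfl, h.two_le⟩)
  have e2 : (Q.σ 1 + Q.τ) * (r ^ 2 / ρ) / √T
      = Q.σ 1 * (r ^ 2 / ρ) / √T + Q.τ * (r ^ 2 / ρ) / √T := by ring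
  unfold rate
  rw [e1, e2]
  refine ⟨by linarith, by linarith, by linarith, by linarith, fun i hi => ?_, by linarith⟩
  have := p6 i hi
  linarith

/-- The regularizers carry the index `t + 1` but the weight of `x_{t+1}` is `1 / A_t`; the ratio
costs `p + 2`. Otherwise `α ≤ (p+1)/T` produces the powers of `T`, and the exponents `p + 1/2` and
`3/2` in the parameters are those that leave `T^(-1/2)`. -/
lemma Nonneg.regTerm_le_rate (h : Q.Nonneg) {ρ r : ℝ} (hρ : 0 < ρ) (hr : 0 ≤ r) (t : ℕ) :
    Q.regTerm ρ r (t + 1) ≤ (bigA Q.p t)⁻¹ *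
      ((((Q.p : ℝ) + 2) * ((Q.p : ℝ) + 1) ^ (Q.p + 1) * Q.aL
        + ((Q.p : ℝ) + 2) * ((Q.p : ℝ) + 1) ^ (Q.p + 1) * (Q.aD + 1) *
          ∑ i ∈ Finset.Icc 2 (Q.p + 1), Q.aK i) * Q.rate ρ r ((t + 1 : ℕ) : ℝ)) := by
  set T : ℝ := ((t + 1 : ℕ) : ℝ) with hTdef
  have hT : 0 < T := by rw [hTdef]; positivity
  set N : ℝ := ((t + 1 : ℕ) : ℝ) + Q.p + 1 with hN
  have hTN : T ≤ N := by
    rw [hN]; linarith [Nat.cast_nonneg (α := ℝ) Q.p]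
  have hN0 : 0 < N := hT.trans_le hTN
  have hsT : 0 < √T := Real.sqrt_pos.2 hT
  have hsN : √T ≤ √N := Real.sqrt_le_sqrt hTN
  set W := (bigA Q.p t)⁻¹ with hW
  have hW0 : 0 < W := inv_bigA_pos _ _
  have hW1 : (bigA Q.p (t + 1))⁻¹ ≤ ((Q.p : ℝ) + 2) * W := inv_bigA_succ_le _ _
  set P1 : ℝ := ((Q.p : ℝ) + 1) ^ (Q.p + 1) with hP1
  have hP10 : 0 < P1 := by positivity
  obtain ⟨r0, r1, -, r2, r3, r4⟩ := h.rate_parts hρ hr hT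
  set S := Q.rate ρ r T
  have haL := h.aL_pos
  have haD := h.two_le_aD
  have hσ1 := h.σ_one
  have hτ := h.τ_nonneg
  have a1 : Q.lam ρ (t + 1) / 2 * r ^ 2 ≤ W * (((Q.p : ℝ) + 2) * P1 * Q.aL * S) := by
    have b1 : N ^ (Q.p + 1) ≤ P1 * (((Q.p : ℝ) + 2) * W) :=
      (pow_le_inv_bigA Q.p (t + 1)).trans (by gcongr)
    have b2 : N ^ ((Q.p : ℝ) + 1 / 2) ≤ P1 * (((Q.p : ℝ) + 2) * W) / √T := by
      rw [rpow_add_half_eq hN0]; gcongr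
    have b3 : 0 ≤ Q.lam ρ (t + 1) * r ^ 2 := by
      have := h.lam_nonneg hρ (t + 1)
      positivity
    calc _ ≤ Q.lam ρ (t + 1) * r ^ 2 := by linarith
      _ = Q.aL * (Q.σ 1 / ρ * N ^ ((Q.p : ℝ) + 1 / 2)) * r ^ 2 := rfl
      _ ≤ Q.aL * (Q.σ 1 / ρ * (P1 * (((Q.p : ℝ) + 2) * W) / √T)) * r ^ 2 := by gcongr
      _ = W * (((Q.p : ℝ) + 2) * P1 * Q.aL * (Q.σ 1 * (r ^ 2 / ρ) / √T)) := by ring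
      _ ≤ _ := by gcongr
  have hα : alpha Q.p (t + 1) ≤ ((Q.p : ℝ) + 1) / T := alpha_le_div (by omega)
  have hα0 := (alpha_pos Q.p (t + 1)).le
  have hq1 : (1 : ℝ) ≤ (Q.p : ℝ) + 1 := by linarith [Nat.cast_nonneg (α := ℝ) Q.p]
  have a2 : ∀ i ∈ Finset.Icc 2 (Q.p + 1),
      alpha Q.p (t + 1) ^ i * Q.level (Q.deltaBar ρ (t + 1)) i * r ^ i ≤ P1 * (Q.aD + 1) * S := by
    intro i hi
    have hi' := Finset.mem_Icc.1 hi
    have c1 : ((Q.p : ℝ) + 1) ^ i ≤ P1 := pow_le_pow_right₀ hq1 hi'.2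
    have c2 : alpha Q.p (t + 1) ^ i ≤ P1 / T ^ i := by
      calc _ ≤ (((Q.p : ℝ) + 1) / T) ^ i := by gcongr
        _ = ((Q.p : ℝ) + 1) ^ i / T ^ i := div_pow _ _ _
        _ ≤ _ := by gcongr
    have c5 : P1 * S ≤ P1 * (Q.aD + 1) * S := by
      have : 0 ≤ P1 * S := by positivity
      nlinarith
    unfold level
    split_ifs with e1 e2
    · subst e1
      have c3 : alpha Q.p (t + 1) ^ 2 * N ^ ((3 : ℝ) / 2) ≤ P1 / √T := by
        have : alpha Q.p (t + 1) = ((Q.p : ℝ) + 1) / N := rfl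
        rw [this, rpow_three_half_eq hN0, div_pow]
        calc _ = ((Q.p : ℝ) + 1) ^ 2 / √N := by field_simp
          _ ≤ _ := by gcongr
      have hσ2 := h.σ_two
      calc _ = Q.aD * (alpha Q.p (t + 1) ^ 2 * (Q.σ 2 * r ^ 2)
            + (alpha Q.p (t + 1) ^ 2 * N ^ ((3 : ℝ) / 2)) * ((Q.σ 1 + Q.τ) * (r ^ 2 / ρ))) := by
            unfold deltaBar; ring
        _ ≤ Q.aD * (P1 / T ^ 2 * (Q.σ 2 * r ^ 2) + P1 / √T * ((Q.σ 1 + Q.τ) * (r ^ 2 / ρ))) := by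
            gcongr
        _ = P1 * Q.aD * (Q.σ 2 * r ^ 2 / T ^ 2 + (Q.σ 1 + Q.τ) * (r ^ 2 / ρ) / √T) := by ring
        _ ≤ P1 * Q.aD * S := by gcongr
        _ ≤ _ := by gcongr; linarith
    · subst e2
      have hM := h.M_nonneg
      calc _ ≤ P1 / T ^ (Q.p + 1) * Q.M * r ^ (Q.p + 1) := by gcongr
        _ = P1 * (Q.M * r ^ (Q.p + 1) / T ^ (Q.p + 1)) := by ring
        _ ≤ P1 * S := by gcongr
        _ ≤ _ := c5
    · have hσi := h.σ_nonneg i (Finset.mem_Icc.2 ⟨by omega, by omega⟩)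
      calc _ ≤ P1 / T ^ i * Q.σ i * r ^ i := by gcongr
        _ = P1 * (Q.σ i * r ^ i / T ^ i) := by ring
        _ ≤ P1 * S := by
            gcongr
            exact r3 i (Finset.mem_Icc.2 ⟨by omega, by omega⟩)
        _ ≤ _ := c5
  have a3 : ∑ i ∈ Finset.Icc 2 (Q.p + 1),
      Q.kappa ρ i (t + 1) / (Nat.factorial i : ℝ) * r ^ i
      ≤ ∑ i ∈ Finset.Icc 2 (Q.p + 1), Q.aK i * ((((Q.p : ℝ) + 2) * W) * (P1 * (Q.aD + 1) * S)) := by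
    refine Finset.sum_le_sum fun i hi => ?_
    have hk := h.kappa_nonneg hρ (t + 1) hi
    have hf1 : (1 : ℝ) ≤ (i.factorial : ℝ) := by
      exact_mod_cast Nat.one_le_iff_ne_zero.2 (Nat.factorial_ne_zero i)
    have hle : Q.kappa ρ i (t + 1) / (Nat.factorial i : ℝ) ≤ Q.kappa ρ i (t + 1) :=
      div_le_self hk hf1
    have ha := h.aK_nonneg hi
    have hl := h.level_nonneg hρ (t + 1) hi
    have hWs := (inv_bigA_pos Q.p (t + 1)).le
    calc _ ≤ Q.kappa ρ i (t + 1) * r ^ i := by gcongr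
      _ = Q.aK i * ((bigA Q.p (t + 1))⁻¹ *
          (alpha Q.p (t + 1) ^ i * Q.level (Q.deltaBar ρ (t + 1)) i * r ^ i)) := by
          rw [kappa_eq]; ring
      _ ≤ _ := by
          have := a2 i hi
          gcongr
  rw [← Finset.sum_mul] at a3
  unfold regTerm
  calc _ ≤ _ := add_le_add a1 a3
    _ = _ := by ring

/-- Each iteration contributes at most order `N^(p - 1/2)` with `N = t + p + 1`; summing the `t + 1`
of them gives `N^(p+1) / √T`, that is, `T^(-1/2)` after division by the weight. -/
lemma Nonneg.noiseTerm_le_rate (h : Q.Nonneg) {ρ r : ℝ} (hρ : 0 < ρ) (hr : 0 ≤ r) (t : ℕ) :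
    ρ * Q.noiseTerm (t + 1) ≤ (bigA Q.p t)⁻¹ *
      ((((Q.p : ℝ) + 1) ^ (Q.p + 1) * (((Q.p : ℝ) + 1) ^ 2 / Q.aL + 2 / Q.aD)) *
        Q.rate ρ r ((t + 1 : ℕ) : ℝ)) := by
  set T : ℝ := ((t + 1 : ℕ) : ℝ) with hTdef
  have hT : 0 < T := by rw [hTdef]; positivity
  set N : ℝ := (t : ℝ) + Q.p + 1 with hN
  have hTN : T ≤ N := by
    rw [hN, hTdef]; push_cast; linarith [Nat.cast_nonneg (α := ℝ) Q.p]
  have hN0 : 0 < N := hT.trans_le hTN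
  have hsT : 0 < √T := Real.sqrt_pos.2 hT
  have hsN : √T ≤ √N := Real.sqrt_le_sqrt hTN
  obtain ⟨r0, -, r1, -⟩ := h.rate_parts hρ hr hT
  set S := Q.rate ρ r T
  have haL := h.aL_pos
  have haD := h.two_le_aD
  have haD0 : 0 < Q.aD := by linarith
  have hσ1 := h.σ_one
  have hτ := h.τ_nonneg
  have hp := h.two_le
  have a1 : ∀ j ∈ Finset.range (t + 1), Q.noiseWeight j * Q.σ 1 ^ 2
      + Q.modelWeight j * (2 * Q.τ ^ 2 + 2 * Q.σ 1 ^ 2)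
      ≤ (Q.σ 1 + Q.τ) * (((Q.p : ℝ) + 1) ^ 2 / Q.aL + 2 / Q.aD) * (N ^ Q.p / √N) := by
    intro j hj
    rw [Finset.mem_range] at hj
    set n : ℝ := (j : ℝ) + Q.p + 1 with hn
    have hn0 : 0 < n := by positivity
    have hnN : n ≤ N := by
      have : (j : ℝ) ≤ t := by exact_mod_cast Nat.lt_succ_iff.1 hj
      linarith
    have hW0 := inv_bigA_pos Q.p j
    have hWn : (bigA Q.p j)⁻¹ ≤ n ^ (Q.p + 1) := inv_bigA_le_pow Q.p j
    have hsn : 0 < √n := Real.sqrt_pos.2 hn0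
    have hss : √n * √n = n := Real.mul_self_sqrt hn0.le
    have hmono : n ^ Q.p / √n ≤ N ^ Q.p / √N := by
      have e : ∀ u : ℝ, 0 < u → u ^ Q.p / √u = u ^ ((Q.p : ℝ) - 1 / 2) := by
        intro u hu
        rw [Real.sqrt_eq_rpow, ← Real.rpow_natCast, ← Real.rpow_sub hu]
      rw [e n hn0, e N hN0]
      refine Real.rpow_le_rpow hn0.le hnN ?_
      have : (2 : ℝ) ≤ Q.p := by exact_mod_cast hp
      linarith
    have b1 : Q.noiseWeight j * Q.σ 1 ^ 2
        ≤ Q.σ 1 * (((Q.p : ℝ) + 1) ^ 2 / Q.aL) * (n ^ Q.p / √n) := by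
      have c1 : alpha Q.p j / bigA Q.p j ≤ ((Q.p : ℝ) + 1) * n ^ Q.p := by
        rw [alpha_div_bigA_eq]
        calc _ ≤ alpha Q.p j * n ^ (Q.p + 1) := by
              have := (alpha_pos Q.p j).le
              gcongr
          _ = _ := by
              have : alpha Q.p j = ((Q.p : ℝ) + 1) / n := rfl
              rw [this, pow_succ]; field_simp
      have c0 : 0 ≤ alpha Q.p j / bigA Q.p j := div_nonneg (alpha_pos _ _).le (bigA_pos _ _).le
      have c2 : (alpha Q.p j / bigA Q.p j) ^ 2 / n ^ ((Q.p : ℝ) + 1 / 2)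
          ≤ ((Q.p : ℝ) + 1) ^ 2 * (n ^ Q.p / √n) := by
        rw [rpow_add_half_eq hn0, div_le_iff₀ (by positivity)]
        calc _ ≤ (((Q.p : ℝ) + 1) * n ^ Q.p) ^ 2 := by gcongr
          _ = ((Q.p : ℝ) + 1) ^ 2 * n ^ Q.p * n ^ Q.p := by ring
          _ = ((Q.p : ℝ) + 1) ^ 2 * (n ^ Q.p / √n) * (n ^ (Q.p + 1) / √n) := by
              rw [pow_succ]
              field_simp
              rw [Real.sq_sqrt hn0.le]
              ring
      rcases hσ1.eq_or_lt with h0 | h0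
      · rw [← h0]; simp
      · calc _ = Q.σ 1 / Q.aL * ((alpha Q.p j / bigA Q.p j) ^ 2 / n ^ ((Q.p : ℝ) + 1 / 2)) := by
              have : 0 < n ^ ((Q.p : ℝ) + 1 / 2) := by positivity
              unfold noiseWeight; rw [← hn]; field_simp
          _ ≤ Q.σ 1 / Q.aL * (((Q.p : ℝ) + 1) ^ 2 * (n ^ Q.p / √n)) := by gcongr
          _ = _ := by ring
    have b2 : Q.modelWeight j * (2 * Q.τ ^ 2 + 2 * Q.σ 1 ^ 2)
        ≤ (Q.σ 1 + Q.τ) * (2 / Q.aD) * (n ^ Q.p / √n) := by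
      have c2 : (bigA Q.p j)⁻¹ / n ^ ((3 : ℝ) / 2) ≤ n ^ Q.p / √n := by
        rw [rpow_three_half_eq hn0, div_le_iff₀ (by positivity)]
        calc _ ≤ n ^ (Q.p + 1) := hWn
          _ = n ^ Q.p / √n * (n ^ 2 / √n) := by
              rw [pow_succ]
              field_simp
              rw [Real.sq_sqrt hn0.le]
      rcases (add_nonneg hσ1 hτ).eq_or_lt with h0 | h0
      · have h1 : Q.modelWeight j = 0 := by unfold modelWeight; rw [← h0]; simp
        rw [h1, ← h0]; simp
      · calc _ ≤ Q.modelWeight j * (2 * (Q.σ 1 + Q.τ) ^ 2) := by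
              have := h.modelWeight_nonneg j
              gcongr
              nlinarith
          _ = (Q.σ 1 + Q.τ) * (2 / Q.aD) * ((bigA Q.p j)⁻¹ / n ^ ((3 : ℝ) / 2)) := by
              have : 0 < n ^ ((3 : ℝ) / 2) := by positivity
              unfold modelWeight; rw [← hn]; field_simp
          _ ≤ _ := by gcongr
    have b3 : Q.σ 1 * (((Q.p : ℝ) + 1) ^ 2 / Q.aL) * (n ^ Q.p / √n)
        ≤ (Q.σ 1 + Q.τ) * (((Q.p : ℝ) + 1) ^ 2 / Q.aL) * (n ^ Q.p / √n) := by
      gcongr; linarith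
    calc _ ≤ (Q.σ 1 + Q.τ) * (((Q.p : ℝ) + 1) ^ 2 / Q.aL + 2 / Q.aD) * (n ^ Q.p / √n) := by
          linarith
      _ ≤ _ := by gcongr
  have a2 := Finset.sum_le_sum a1
  rw [Finset.sum_const, Finset.card_range, nsmul_eq_mul] at a2
  have a3 : T * (N ^ Q.p / √N) ≤ ((Q.p : ℝ) + 1) ^ (Q.p + 1) * (bigA Q.p t)⁻¹ / √T := by
    calc T * (N ^ Q.p / √N) ≤ N * (N ^ Q.p / √T) := by gcongr
      _ = N ^ (Q.p + 1) / √T := by ring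
      _ ≤ _ := by
          have := pow_le_inv_bigA Q.p t
          gcongr
  have hW0 := inv_bigA_pos Q.p t
  set c := ((Q.p : ℝ) + 1) ^ 2 / Q.aL + 2 / Q.aD with hc
  have hc0 : 0 ≤ c := by positivity
  calc ρ * Q.noiseTerm (t + 1) ≤ ρ * (T * ((Q.σ 1 + Q.τ) * c * (N ^ Q.p / √N))) := by
        unfold noiseTerm; gcongr
    _ = ρ * ((Q.σ 1 + Q.τ) * c) * (T * (N ^ Q.p / √N)) := by ring
    _ ≤ ρ * ((Q.σ 1 + Q.τ) * c) * (((Q.p : ℝ) + 1) ^ (Q.p + 1) * (bigA Q.p t)⁻¹ / √T) := by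
        gcongr
    _ = (bigA Q.p t)⁻¹ * (((Q.p : ℝ) + 1) ^ (Q.p + 1) * c * ((Q.σ 1 + Q.τ) * ρ / √T)) := by ring
    _ ≤ _ := by gcongr

lemma Nonneg.regTerm_add_noiseTerm_le (h : Q.Nonneg) {ρ r : ℝ} (hρ : 0 < ρ) (hr : 0 ≤ r)
    {T : ℕ} (hT : 1 ≤ T) :
    Q.regTerm ρ r T + ρ * Q.noiseTerm T
      ≤ (∑ j ∈ Finset.range T, alpha Q.p j / bigA Q.p j) *
        (rateConst Q.p Q.aD Q.aL Q.aK * Q.rate ρ r T) := by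
  obtain ⟨t, rfl⟩ : ∃ t, T = t + 1 := ⟨T - 1, by omega⟩
  rw [sum_alpha_div_bigA]
  refine (add_le_add (h.regTerm_le_rate hρ hr t) (h.noiseTerm_le_rate hρ hr t)).trans
    (le_of_eq ?_)
  unfold rateConst
  ring

/-! ### The restart length -/

variable (Q)

/-- The restart length dominates each of the quantities of which it is the maximum. -/
lemma le_restartLength {μ L C r Rc : ℝ} (hC : 0 ≤ C) :
    C ≤ Q.restartLength μ L C r Rc ∧
    C * (Q.τ / (μ * r)) ^ 2 ≤ Q.restartLength μ L C r Rc ∧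
    C * (Q.σ 1 / (μ * r)) ^ 2 ≤ Q.restartLength μ L C r Rc ∧
    (∀ i ∈ Finset.Icc 2 Q.p, C * (Q.σ i * Rc ^ (i - 2) / μ) ^ (1 / (i : ℝ))
      ≤ Q.restartLength μ L C r Rc) ∧
    C * (L * Rc ^ (Q.p - 1) / μ) ^ (1 / ((Q.p : ℝ) + 1)) ≤ Q.restartLength μ L C r Rc := by
  have h1 := Nat.le_ceil (C * max ((Finset.Icc 2 Q.p).fold max 1
      (fun i => (Q.σ i * Rc ^ (i - 2) / μ) ^ (1 / (i : ℝ))))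
    (max ((Q.τ / (μ * r)) ^ 2) (max ((Q.σ 1 / (μ * r)) ^ 2)
      ((L * Rc ^ (Q.p - 1) / μ) ^ (1 / ((Q.p : ℝ) + 1))))))
  have key : ∀ a, a ≤ max ((Finset.Icc 2 Q.p).fold max 1
      (fun i => (Q.σ i * Rc ^ (i - 2) / μ) ^ (1 / (i : ℝ))))
    (max ((Q.τ / (μ * r)) ^ 2) (max ((Q.σ 1 / (μ * r)) ^ 2)
      ((L * Rc ^ (Q.p - 1) / μ) ^ (1 / ((Q.p : ℝ) + 1))))) →
      C * a ≤ Q.restartLength μ L C r Rc := fun a ha =>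
    (mul_le_mul_of_nonneg_left ha hC).trans h1
  refine ⟨?_, key _ ?_, key _ ?_, fun i hi => key _ ?_, key _ ?_⟩
  · rw [← mul_one C]
    convert key 1 ?_ using 1
    · rw [mul_one]
    · exact le_max_of_le_left (Finset.le_fold_max 1 |>.2 (Or.inl le_rfl))
  · exact le_max_of_le_right (le_max_left _ _)
  · exact le_max_of_le_right (le_max_of_le_right (le_max_left _ _))
  · exact le_max_of_le_left ((Finset.le_fold_max _).2 (Or.inr ⟨i, hi, le_rfl⟩))
  · exact le_max_of_le_right (le_max_of_le_right (le_max_right _ _))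

lemma restartLength_le {μ L C r Rc : ℝ} (hC : 0 ≤ C) (hμ : 0 < μ) (hL : 0 ≤ L) (hR : 0 ≤ Rc)
    (hσ : ∀ i ∈ Finset.Icc 1 Q.p, 0 ≤ Q.σ i) :
    (Q.restartLength μ L C r Rc : ℝ) ≤ 1 + C * (1 + ((Q.τ / (μ * r)) ^ 2 + (Q.σ 1 / (μ * r)) ^ 2
      + ∑ i ∈ Finset.Icc 2 Q.p, (Q.σ i * Rc ^ (i - 2) / μ) ^ (1 / (i : ℝ))
      + (L * Rc ^ (Q.p - 1) / μ) ^ (1 / ((Q.p : ℝ) + 1)))) := by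
  have h5 : ∀ i ∈ Finset.Icc 2 Q.p, 0 ≤ (Q.σ i * Rc ^ (i - 2) / μ) ^ (1 / (i : ℝ)) := by
    intro i hi
    rw [Finset.mem_Icc] at hi
    have := hσ i (Finset.mem_Icc.2 ⟨by omega, hi.2⟩)
    positivity
  have h6 := Finset.sum_nonneg h5
  have h7 : 0 ≤ (L * Rc ^ (Q.p - 1) / μ) ^ (1 / ((Q.p : ℝ) + 1)) := by positivity
  have h8 := sq_nonneg (Q.τ / (μ * r))
  have h9 := sq_nonneg (Q.σ 1 / (μ * r))
  have hmax : max ((Finset.Icc 2 Q.p).fold max 1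
      (fun i => (Q.σ i * Rc ^ (i - 2) / μ) ^ (1 / (i : ℝ))))
    (max ((Q.τ / (μ * r)) ^ 2) (max ((Q.σ 1 / (μ * r)) ^ 2)
      ((L * Rc ^ (Q.p - 1) / μ) ^ (1 / ((Q.p : ℝ) + 1)))))
      ≤ 1 + ((Q.τ / (μ * r)) ^ 2 + (Q.σ 1 / (μ * r)) ^ 2
      + ∑ i ∈ Finset.Icc 2 Q.p, (Q.σ i * Rc ^ (i - 2) / μ) ^ (1 / (i : ℝ))
      + (L * Rc ^ (Q.p - 1) / μ) ^ (1 / ((Q.p : ℝ) + 1))) := by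
    refine max_le ((Finset.fold_max_le _).2 ⟨by linarith, fun i hi => ?_⟩)
      (max_le (by linarith) (max_le (by linarith) (by linarith)))
    have := Finset.single_le_sum h5 hi
    linarith
  have hpos : 0 ≤ C * max ((Finset.Icc 2 Q.p).fold max 1
      (fun i => (Q.σ i * Rc ^ (i - 2) / μ) ^ (1 / (i : ℝ))))
    (max ((Q.τ / (μ * r)) ^ 2) (max ((Q.σ 1 / (μ * r)) ^ 2)
      ((L * Rc ^ (Q.p - 1) / μ) ^ (1 / ((Q.p : ℝ) + 1))))) :=
    mul_nonneg hC (h8.trans (le_max_of_le_right (le_max_left _ _)))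
  have h10 := (Nat.ceil_lt_add_one hpos).le
  have h11 := mul_le_mul_of_nonneg_left hmax hC
  unfold restartLength
  linarith

lemma measurable_restartLength (μ L C r : ℝ) :
    Measurable fun Rc : ℝ => Q.restartLength μ L C r Rc := by
  have h1 : ∀ s : Finset ℕ, Measurable fun Rc : ℝ => s.fold max 1
      (fun i => (Q.σ i * Rc ^ (i - 2) / μ) ^ (1 / (i : ℝ))) := by
    intro s
    induction s using Finset.induction_on with
    | empty => simp
    | insert a s ha ih =>
      simp only [Finset.fold_insert ha]
      exact Measurable.max (by fun_prop) ih
  unfold restartLength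
  refine Nat.measurable_ceil.comp (Measurable.const_mul ?_ C)
  refine (h1 _).max (measurable_const.max (measurable_const.max ?_))
  fun_prop

variable {Q}

/-- Raising the hypothesis to the power `i` gives the bound with `C^i`; it is weakened to `√C` so
that all parts of `rate` share one factor. The real `e` equals `i` and allows the exponent to be
written `(p : ℝ) + 1`. -/
lemma div_pow_le_of_le {s r μ C T : ℝ} {i k : ℕ} (hs : 0 ≤ s) (hr : 0 ≤ r) (hμ : 0 < μ)
    (hC : 1 ≤ C) (hT : 0 < T) (hi : 2 ≤ i) (hk : k + 2 = i) {e : ℝ} (he : e = i)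
    (h : C * (s * r ^ k / μ) ^ (1 / e) ≤ T) :
    s * r ^ i / T ^ i ≤ μ * r ^ 2 / √C := by
  have hC0 : 0 < C := by linarith
  have h0 : 0 ≤ s * r ^ k / μ := by positivity
  have h1 : C ^ i * (s * r ^ k / μ) ≤ T ^ i := by
    have h2 := pow_le_pow_left₀ (by positivity) h i
    rwa [mul_pow, he, one_div, Real.rpow_inv_natCast_pow h0 (by omega)] at h2
  have h3 : √C ≤ C ^ i := by
    calc √C ≤ C := Real.sqrt_le_iff.2 ⟨hC0.le, by nlinarith⟩
      _ ≤ C ^ i := le_self_pow₀ hC (by omega)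
  have hsC : 0 < √C := Real.sqrt_pos.2 hC0
  rw [div_le_div_iff₀ (by positivity) hsC]
  have h4 : s * r ^ k * C ^ i ≤ μ * T ^ i := by
    have := mul_le_mul_of_nonneg_left h1 hμ.le
    calc _ = μ * (C ^ i * (s * r ^ k / μ)) := by field_simp
      _ ≤ _ := this
  rw [← hk, pow_add]
  calc s * (r ^ k * r ^ 2) * √C ≤ s * (r ^ k * r ^ 2) * C ^ i := by gcongr
    _ = (s * r ^ k * C ^ i) * r ^ 2 := by ring
    _ ≤ (μ * T ^ i) * r ^ 2 := by gcongr
    _ = _ := by rw [← hk]; ring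

lemma div_sqrt_le_of_le {a b C T : ℝ} (hb : 0 < b) (hC : 0 < C) (hT : 0 < T)
    (h : C * (a / b) ^ 2 ≤ T) : a / √T ≤ b / √C := by
  have hsC : 0 < √C := Real.sqrt_pos.2 hC
  have hsT : 0 < √T := Real.sqrt_pos.2 hT
  rw [div_le_div_iff₀ hsT hsC]
  have h1 : √C * (a / b) ≤ √T := by
    apply Real.le_sqrt_of_sq_le
    rw [mul_pow, Real.sq_sqrt hC.le]; exact h
  calc a * √C = b * (√C * (a / b)) := by field_simp
    _ ≤ _ := by gcongr

/-- With the prescribed restart length the error of the inner method is a small multiple of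
`μ (‖x₀ - x⋆‖² + r²)`. -/
lemma Nonneg.rate_restartLength_le (h : Q.Nonneg) {μ L C cM r Rc ρ : ℝ} (hμ : 0 < μ)
    (hL : 0 ≤ L) (hML : Q.M ≤ cM * L) (hcM : 0 ≤ cM) (hC : 1 ≤ C) (hr : 0 < r) (hRc : 0 ≤ Rc)
    (hρ : 0 < ρ) (hρm : ρ ∈ Set.uIcc Rc r) :
    Q.rate ρ Rc (Q.restartLength μ L C r Rc)
      ≤ (4 + Q.p + cM) / √C * (μ * (Rc ^ 2 + r ^ 2)) := by
  have hC0 : 0 < C := by linarith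
  obtain ⟨t0, t1, t2, t3, t4⟩ := Q.le_restartLength (μ := μ) (L := L) (r := r) (Rc := Rc) hC0.le
  set T : ℝ := (Q.restartLength μ L C r Rc : ℝ)
  have hT : 0 < T := hC0.trans_le t0
  have hsC : 0 < √C := Real.sqrt_pos.2 hC0
  have hsT : 0 < √T := Real.sqrt_pos.2 hT
  have hσ1 := h.σ_one
  have hτ := h.τ_nonneg
  have a1 := div_sqrt_le_of_le (mul_pos hμ hr) hC0 hT t1
  have a2 := div_sqrt_le_of_le (mul_pos hμ hr) hC0 hT t2
  -- This is where `ρ` must lie between the two radii: for `Rc ≤ r` one has `Rc²/ρ ≤ Rc`, and for `r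
  -- ≤ Rc` one has `Rc² r / ρ ≤ Rc²`.
  have a3 : (ρ + Rc ^ 2 / ρ) * r ≤ 2 * (Rc ^ 2 + r ^ 2) := by
    rcases le_total Rc r with hle | hle
    · rw [Set.uIcc_of_le hle] at hρm
      have b1 : Rc ^ 2 / ρ ≤ Rc := by
        rw [div_le_iff₀ hρ]; nlinarith [hρm.1]
      nlinarith [hρm.2, sq_nonneg Rc]
    · rw [Set.uIcc_of_ge hle] at hρm
      have b1 : Rc ^ 2 / ρ * r ≤ Rc ^ 2 := by
        rw [div_mul_eq_mul_div, div_le_iff₀ hρ]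
        exact mul_le_mul_of_nonneg_left hρm.1 (sq_nonneg _)
      nlinarith [hρm.2]
  have a4 : (Q.σ 1 + Q.τ) * (ρ + Rc ^ 2 / ρ) / √T ≤ 4 / √C * (μ * (Rc ^ 2 + r ^ 2)) := by
    have b1 : 0 ≤ ρ + Rc ^ 2 / ρ := by positivity
    calc _ = (Q.τ / √T + Q.σ 1 / √T) * (ρ + Rc ^ 2 / ρ) := by ring
      _ ≤ (μ * r / √C + μ * r / √C) * (ρ + Rc ^ 2 / ρ) := by gcongr
      _ = 2 * μ / √C * ((ρ + Rc ^ 2 / ρ) * r) := by ring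
      _ ≤ 2 * μ / √C * (2 * (Rc ^ 2 + r ^ 2)) := by gcongr
      _ = _ := by ring
  have hb : μ * Rc ^ 2 / √C ≤ 1 / √C * (μ * (Rc ^ 2 + r ^ 2)) := by
    calc _ = 1 / √C * (μ * Rc ^ 2) := by ring
      _ ≤ _ := by
        have := sq_nonneg r
        gcongr
        linarith
  have hb0 : 0 ≤ 1 / √C * (μ * (Rc ^ 2 + r ^ 2)) := by positivity
  have a5 : ∑ i ∈ Finset.Icc 2 Q.p, Q.σ i * Rc ^ i / T ^ i
      ≤ Q.p * (1 / √C * (μ * (Rc ^ 2 + r ^ 2))) := by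
    have b1 : ∀ i ∈ Finset.Icc 2 Q.p, Q.σ i * Rc ^ i / T ^ i
        ≤ 1 / √C * (μ * (Rc ^ 2 + r ^ 2)) := by
      intro i hi
      have hi' := Finset.mem_Icc.1 hi
      exact (div_pow_le_of_le (h.σ_nonneg i (Finset.mem_Icc.2 ⟨by omega, hi'.2⟩)) hRc hμ hC hT
        hi'.1 (by omega) rfl (t3 i hi)).trans hb
    refine (Finset.sum_le_sum b1).trans ?_
    rw [Finset.sum_const, nsmul_eq_mul]
    refine mul_le_mul_of_nonneg_right ?_ hb0
    rw [Nat.card_Icc]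
    exact_mod_cast (by omega : Q.p + 1 - 2 ≤ Q.p)
  have a6 : Q.M * Rc ^ (Q.p + 1) / T ^ (Q.p + 1) ≤ cM * (1 / √C * (μ * (Rc ^ 2 + r ^ 2))) := by
    have hp := h.two_le
    have b1 := (div_pow_le_of_le (i := Q.p + 1) hL hRc hμ hC hT (by omega) (by omega)
      (by push_cast; ring) t4).trans hb
    calc _ ≤ cM * L * Rc ^ (Q.p + 1) / T ^ (Q.p + 1) := by gcongr
      _ = cM * (L * Rc ^ (Q.p + 1) / T ^ (Q.p + 1)) := by ring
      _ ≤ _ := by gcongr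
  unfold rate
  calc _ ≤ _ := add_le_add (add_le_add a4 a5) a6
    _ = _ := by ring

end Param

section Run

variable {Ω : Type*} [mΩ : MeasurableSpace Ω] {P : Measure Ω} [IsProbabilityMeasure P]
  {Q : Param} {f : Vec d → ℝ} {xs : Vec d} {μ L C R : ℝ} {z₀ : Vec d}
  {z : ℕ → Ω → Vec d} {ρ : ℕ → Ω → ℝ} {x y gv gx : ℕ → ℕ → Ω → Vec d}
  {H : ℕ → ℕ → Ω → (i : ℕ) → ContinuousMultilinearMap ℝ (fun _ : Fin i => Vec d) ℝ}
  {F G : ℕ → ℕ → MeasurableSpace Ω}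

/-! ### One restart in expectation -/

/-- One restart reduces the expected gap to a small multiple of the squared radii. -/
lemma IsRestartedRun.lintegral_restart_le
    (hrun : IsRestartedRun P Q f xs μ L C R z₀ z ρ x y gv gx H F G) (h : Q.Nonneg)
    (hf : HasLipschitzDeriv Q.p L f) (hL : 0 ≤ L) (hLM : L ≤ Q.M) {cM : ℝ} (hML : Q.M ≤ cM * L)
    (hcM : 0 ≤ cM) (hμ : 0 < μ) (hC1 : 1 ≤ C)
    (hC : rateConst Q.p Q.aD Q.aL Q.aK * ((4 + Q.p + cM) / √C) ≤ 1 / 32) (hR : 0 < R)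
    (hconv : ∀ a b, f a + inner ℝ (gradient f a) (b - a) ≤ f b) (hmin : ∀ x, f xs ≤ f x) (s : ℕ)
    (hI : Integrable (fun w => ‖z s w - xs‖ ^ 2) P) :
    ∫⁻ w, ENNReal.ofReal (f (z (s + 1) w) - f xs) ∂P
      ≤ ∫⁻ w, ENNReal.ofReal (μ / 32 * (‖z s w - xs‖ ^ 2 + (R / 2 ^ s) ^ 2)) ∂P := by
  set r := R / 2 ^ s with hr
  have hr0 : 0 < r := by positivity
  have hzm : Measurable[F s 0] fun w => ‖z s w - xs‖ :=
    ((hrun.z_meas s).sub stronglyMeasurable_const).norm.measurable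
  have hρm : Measurable[F s 0] (ρ s) := (hrun.ρ_meas s).measurable
  -- An event of the initial history, of full measure, on which the almost sure constraints on `ρ`
  -- hold at every point.
  set D : Set Ω := {w | 0 < ρ s w} ∩ {w | min ‖z s w - xs‖ r ≤ ρ s w} ∩
    {w | ρ s w ≤ max ‖z s w - xs‖ r} with hD
  have hDm : MeasurableSet[F s 0] D :=
    ((measurableSet_lt measurable_const hρm).inter
      (measurableSet_le (hzm.min measurable_const) hρm)).inter
      (measurableSet_le hρm (hzm.max measurable_const))
  have hDae : ∀ᵐ w ∂P, w ∈ D := by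
    filter_upwards [hrun.ρ_pos s, hrun.ρ_mem s] with w h1 h2
    exact ⟨⟨h1, h2.1⟩, h2.2⟩
  -- The first label fixes the restart length, the second bounds `ρ`, `1/ρ` and the distance. Its
  -- level sets cut `D` into countably many pieces to which `lintegral_gap_le` applies; nonnegative
  -- integrals can then be summed without integrability of the gap.
  set θ : Ω → ℕ × ℕ := fun w => (Q.restartLength μ L C r ‖z s w - xs‖,
    ⌈max (ρ s w) (max (ρ s w)⁻¹ ‖z s w - xs‖)⌉₊) with hθ
  have hθm : Measurable[F s 0] θ :=
    ((Q.measurable_restartLength μ L C r).comp hzm).prodMk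
      (Nat.measurable_ceil.comp (hρm.max (hρm.inv.max hzm)))
  set B : ℕ × ℕ → Set Ω := fun k => D ∩ θ ⁻¹' {k} with hB
  have hBm : ∀ k, MeasurableSet[F s 0] (B k) := fun k =>
    hDm.inter (hθm (MeasurableSet.singleton k))
  have hBd : Pairwise (Function.onFun Disjoint B) := by
    intro k l hkl
    refine Set.disjoint_left.2 fun w hk hl => hkl ?_
    exact (hk.2 : θ w = k).symm.trans hl.2
  have hBU : ⋃ k, B k = D := by
    ext w
    simp [hB]
  have hsplit : ∀ u : Ω → ENNReal, ∫⁻ w, u w ∂P = ∑' k, ∫⁻ w in B k, u w ∂P := by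
    intro u
    rw [← lintegral_iUnion (fun k => hrun.F_le s 0 _ (hBm k)) hBd, hBU,
      Measure.restrict_eq_self_of_ae_mem hDae]
  rw [hsplit, hsplit fun w => ENNReal.ofReal (μ / 32 * (‖z s w - xs‖ ^ 2 + r ^ 2))]
  refine ENNReal.tsum_le_tsum fun k => ?_
  have hzk : ∫⁻ w in B k, ENNReal.ofReal (f (z (s + 1) w) - f xs) ∂P
      = ∫⁻ w in B k, ENNReal.ofReal (f (x s k.1 w) - f xs) ∂P := by
    refine setLIntegral_congr_fun_ae (hrun.F_le s 0 _ (hBm k)) ?_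
    filter_upwards [hrun.z_succ s] with w hw hwB
    have h1 : Q.restartLength μ L C r ‖z s w - xs‖ = k.1 := congrArg Prod.fst (hwB.2 : θ w = k)
    rw [hw, ← hr, h1]
  rw [hzk]
  by_cases hk : 1 ≤ k.1
  swap
  · have hempty : B k = ∅ := by
      refine Set.eq_empty_of_forall_notMem fun w hw => hk ?_
      have h1 : Q.restartLength μ L C r ‖z s w - xs‖ = k.1 := congrArg Prod.fst (hw.2 : θ w = k)
      have h2 := (Q.le_restartLength (μ := μ) (L := L) (r := r) (Rc := ‖z s w - xs‖)
        (by linarith : 0 ≤ C)).1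
      rw [h1] at h2
      exact_mod_cast hC1.trans h2
    rw [hempty]; simp
  refine hrun.lintegral_gap_le h hf hL hLM hconv hmin s (hBm k) (N := (k.2 : ℝ) + 1)
    (by positivity) ?_ hk ?_ ?_
  · intro w hw
    have h1 : ⌈max (ρ s w) (max (ρ s w)⁻¹ ‖z s w - xs‖)⌉₊ = k.2 :=
      congrArg Prod.snd (hw.2 : θ w = k)
    have h2 := Nat.le_ceil (max (ρ s w) (max (ρ s w)⁻¹ ‖z s w - xs‖))
    rw [h1] at h2
    have hρ : 0 < ρ s w := hw.1.1.1
    have h3 : (ρ s w)⁻¹ ≤ (k.2 : ℝ) + 1 := by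
      have := (le_max_of_le_right (le_max_left _ _)).trans h2
      linarith
    refine ⟨(inv_le_comm₀ hρ (by positivity)).1 h3, ?_, ?_⟩
    · have := (le_max_left _ _).trans h2
      linarith
    · have := (le_max_of_le_right (le_max_right _ _)).trans h2
      linarith
  · exact ((hI.add (integrable_const (r ^ 2))).const_mul (μ / 32)).integrableOn
  · intro w hw
    have hρ : 0 < ρ s w := hw.1.1.1
    have h1 : Q.restartLength μ L C r ‖z s w - xs‖ = k.1 := congrArg Prod.fst (hw.2 : θ w = k)
    have h2 := h.rate_restartLength_le hμ hL hML hcM hC1 hr0 (norm_nonneg (z s w - xs)) hρ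
      ⟨hw.1.1.2, hw.1.2⟩
    rw [h1] at h2
    refine (h.regTerm_add_noiseTerm_le hρ (norm_nonneg _) hk).trans
      (mul_le_mul_of_nonneg_left ?_ (Finset.sum_nonneg fun j _ =>
        div_nonneg (alpha_pos _ _).le (bigA_pos _ _).le))
    have hK : 0 ≤ rateConst Q.p Q.aD Q.aL Q.aK := by
      have haD := h.two_le_aD
      have haL := h.aL_pos
      have := Finset.sum_nonneg fun i (hi : i ∈ Finset.Icc 2 (Q.p + 1)) => h.aK_nonneg hi
      unfold rateConst
      positivity
    calc _ ≤ rateConst Q.p Q.aD Q.aL Q.aK *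
          ((4 + Q.p + cM) / √C * (μ * (‖z s w - xs‖ ^ 2 + r ^ 2))) := by gcongr
      _ = rateConst Q.p Q.aD Q.aL Q.aK * ((4 + Q.p + cM) / √C) *
          (μ * (‖z s w - xs‖ ^ 2 + r ^ 2)) := by ring
      _ ≤ 1 / 32 * (μ * (‖z s w - xs‖ ^ 2 + r ^ 2)) := by gcongr
      _ = _ := by ring

lemma IsRestartedRun.integral_restart_le
    (hrun : IsRestartedRun P Q f xs μ L C R z₀ z ρ x y gv gx H F G) (h : Q.Nonneg)
    (hf : HasLipschitzDeriv Q.p L f) (hL : 0 ≤ L) (hLM : L ≤ Q.M) {cM : ℝ} (hML : Q.M ≤ cM * L)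
    (hcM : 0 ≤ cM) (hμ : 0 < μ) (hC1 : 1 ≤ C)
    (hC : rateConst Q.p Q.aD Q.aL Q.aK * ((4 + Q.p + cM) / √C) ≤ 1 / 32) (hR : 0 < R)
    (hconv : ∀ a b, f a + inner ℝ (gradient f a) (b - a) ≤ f b) (hmin : ∀ x, f xs ≤ f x)
    (hgrow : ∀ x, μ / 4 * ‖x - xs‖ ^ 2 ≤ f x - f xs) (s : ℕ)
    (hI : Integrable (fun w => ‖z s w - xs‖ ^ 2) P)
    (hE : ∫ w, ‖z s w - xs‖ ^ 2 ∂P ≤ (1 / 4) ^ s * R ^ 2) :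
    Integrable (fun w => f (z (s + 1) w)) P ∧
    ∫ w, f (z (s + 1) w) ∂P - f xs ≤ (1 / 2) ^ (2 * (s + 1) + 1) * μ * R ^ 2 ∧
    Integrable (fun w => ‖z (s + 1) w - xs‖ ^ 2) P ∧
    ∫ w, ‖z (s + 1) w - xs‖ ^ 2 ∂P ≤ (1 / 4) ^ (s + 1) * R ^ 2 := by
  have key := hrun.lintegral_restart_le h hf hL hLM hML hcM hμ hC1 hC hR hconv hmin s hI
  have hzm : StronglyMeasurable (z (s + 1)) := (hrun.z_meas (s + 1)).mono (hrun.F_le _ _)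
  have hfm : Measurable fun w => f (z (s + 1) w) - f xs :=
    ((hf.differentiable (by have := h.two_le; omega)).continuous.measurable.comp
      hzm.measurable).sub_const _
  have hbi : Integrable (fun w => μ / 32 * (‖z s w - xs‖ ^ 2 + (R / 2 ^ s) ^ 2)) P :=
    (hI.add (integrable_const _)).const_mul _
  have hb0 : 0 ≤ᵐ[P] fun w => μ / 32 * (‖z s w - xs‖ ^ 2 + (R / 2 ^ s) ^ 2) :=
    Filter.Eventually.of_forall fun w => by positivity
  have hg0 : ∀ w, 0 ≤ f (z (s + 1) w) - f xs := fun w => sub_nonneg.2 (hmin _)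
  rw [← ofReal_integral_eq_lintegral_ofReal hbi hb0] at key
  have hgi : Integrable (fun w => f (z (s + 1) w) - f xs) P :=
    (lintegral_ofReal_ne_top_iff_integrable hfm.aestronglyMeasurable
      (Filter.Eventually.of_forall hg0)).1 (key.trans_lt ENNReal.ofReal_lt_top).ne
  rw [← ofReal_integral_eq_lintegral_ofReal hgi (Filter.Eventually.of_forall hg0),
    ENNReal.ofReal_le_ofReal_iff (integral_nonneg_of_ae hb0), integral_const_mul,
    integral_add hI (integrable_const _), integral_const] at key
  have hr2 : (R / 2 ^ s) ^ 2 = (1 / 4) ^ s * R ^ 2 := by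
    rw [div_pow, ← pow_mul, mul_comm s 2, pow_mul, one_div, inv_pow]
    norm_num
    ring
  -- Both squared radii have mean at most `4^(-s) R²`, whence `2 · μ/32`. The growth constant `μ/4`
  -- then gives the contraction factor exactly `1/4`, which explains the threshold `1/32`.
  have hE2 : ∫ w, (f (z (s + 1) w) - f xs) ∂P ≤ μ / 16 * ((1 / 4) ^ s * R ^ 2) := by
    rw [hr2] at key
    simp only [probReal_univ, one_smul] at key
    have := mul_le_mul_of_nonneg_left hE (by positivity : 0 ≤ μ / 32)
    linarith
  have hfi : Integrable (fun w => f (z (s + 1) w)) P := by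
    refine (hgi.add (integrable_const (f xs))).congr (Filter.Eventually.of_forall fun w => ?_)
    simp
  have hni : Integrable (fun w => ‖z (s + 1) w - xs‖ ^ 2) P := by
    refine (hgi.const_mul (4 / μ)).mono'
      ((hzm.sub stronglyMeasurable_const).norm.pow 2).aestronglyMeasurable
      (Filter.Eventually.of_forall fun w => ?_)
    rw [Real.norm_eq_abs, abs_of_nonneg (sq_nonneg _)]
    calc _ = 4 / μ * (μ / 4 * ‖z (s + 1) w - xs‖ ^ 2) := by field_simp
      _ ≤ _ := by gcongr; exact hgrow _
  have hq : (0 : ℝ) ≤ (1 / 4) ^ s * R ^ 2 := by positivity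
  refine ⟨hfi, ?_, hni, ?_⟩
  · have h1 : ∫ w, (f (z (s + 1) w) - f xs) ∂P = ∫ w, f (z (s + 1) w) ∂P - f xs := by
      rw [integral_sub hfi (integrable_const _)]; simp
    rw [← h1]
    have h2 : (1 / 2 : ℝ) ^ (2 * (s + 1) + 1) = (1 / 4) ^ s / 8 := by
      rw [pow_succ, pow_mul, pow_succ]; norm_num; ring
    rw [h2]
    have : 0 ≤ μ * ((1 / 4) ^ s * R ^ 2) := by positivity
    linarith
  · have h1 : μ / 4 * ∫ w, ‖z (s + 1) w - xs‖ ^ 2 ∂P ≤ μ / 16 * ((1 / 4) ^ s * R ^ 2) := by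
      rw [← integral_const_mul]
      exact (integral_mono (hni.const_mul _) hgi fun w => hgrow _).trans hE2
    have h2 : ∫ w, ‖z (s + 1) w - xs‖ ^ 2 ∂P
        = 4 / μ * (μ / 4 * ∫ w, ‖z (s + 1) w - xs‖ ^ 2 ∂P) := by field_simp
    rw [h2]
    calc _ ≤ 4 / μ * (μ / 16 * ((1 / 4) ^ s * R ^ 2)) := by gcongr
      _ = _ := by field_simp; ring

end Run

/-! ### The total number of iterations -/

/-- For `Rc ≥ r` the ratio of the two sides is governed by `(Rc/r)^(k/e) ≤ (Rc/r)²`. Thus the second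
moment of the random radius controls every part of the restart length. -/
lemma rpow_radius_le {a μ r Rc : ℝ} (ha : 0 ≤ a) (hμ : 0 < μ) (hr : 0 < r) (hRc : 0 ≤ Rc)
    {k e : ℕ} (he : e ≠ 0) (hk : k ≤ 2 * e) :
    (a * Rc ^ k / μ) ^ (1 / (e : ℝ))
      ≤ (a * r ^ k / μ) ^ (1 / (e : ℝ)) * (1 + Rc ^ 2 / r ^ 2) := by
  have h0 : 0 ≤ (a * r ^ k / μ) ^ (1 / (e : ℝ)) := by positivity
  rcases le_total Rc r with hle | hle
  · calc _ ≤ (a * r ^ k / μ) ^ (1 / (e : ℝ)) * 1 := by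
          rw [mul_one]; gcongr
      _ ≤ _ := by
          gcongr
          have : 0 ≤ Rc ^ 2 / r ^ 2 := by positivity
          linarith
  · have hu : 1 ≤ Rc / r := (one_le_div hr).2 hle
    have e1 : a * Rc ^ k / μ = a * r ^ k / μ * (Rc / r) ^ k := by
      rw [div_pow]; field_simp
    rw [e1, Real.mul_rpow (by positivity) (by positivity)]
    refine mul_le_mul_of_nonneg_left ?_ h0
    calc ((Rc / r) ^ k) ^ (1 / (e : ℝ)) ≤ (((Rc / r) ^ 2) ^ e) ^ (1 / (e : ℝ)) := by
          rw [← pow_mul]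
          gcongr
      _ = (Rc / r) ^ 2 := by
          rw [one_div, Real.pow_rpow_inv_natCast (by positivity) he]
      _ ≤ _ := by rw [div_pow]; linarith

/-- The decay per restart is `2^(-k/e) ≤ 2^(-1/3) ≤ 4/5`. The condition `e ≤ 3k` holds for `k = i -
2`, `e = i` once `i ≥ 3`, and for `k = p - 1`, `e = p + 1` once `p ≥ 2`. -/
lemma rpow_geometric_le {a μ R : ℝ} (ha : 0 ≤ a) (hμ : 0 < μ) (hR : 0 ≤ R)
    {k e : ℕ} (he : e ≠ 0) (hk : e ≤ 3 * k) (s : ℕ) :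
    (a * (R / 2 ^ s) ^ k / μ) ^ (1 / (e : ℝ))
      ≤ (a * R ^ k / μ) ^ (1 / (e : ℝ)) * (4 / 5) ^ s := by
  have e1 : a * (R / 2 ^ s) ^ k / μ = a * R ^ k / μ * ((1 / 2) ^ k) ^ s := by
    rw [div_pow, ← pow_mul, ← pow_mul, mul_comm s k, one_div, inv_pow]; field_simp
  rw [e1, Real.mul_rpow (by positivity) (by positivity)]
  refine mul_le_mul_of_nonneg_left ?_ (by positivity)
  have h1 : (1 / 2 : ℝ) ^ k ≤ (4 / 5) ^ e := by
    calc (1 / 2 : ℝ) ^ k ≤ ((4 / 5) ^ 3) ^ k := by gcongr; norm_num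
      _ = (4 / 5) ^ (3 * k) := by rw [pow_mul]
      _ ≤ _ := pow_le_pow_of_le_one (by norm_num) (by norm_num) hk
  calc (((1 / 2 : ℝ) ^ k) ^ s) ^ (1 / (e : ℝ)) ≤ (((4 / 5) ^ e) ^ s) ^ (1 / (e : ℝ)) := by gcongr
    _ = (((4 / 5 : ℝ) ^ s) ^ e) ^ (1 / (e : ℝ)) := by rw [← pow_mul, ← pow_mul, mul_comm]
    _ = _ := by rw [one_div, Real.pow_rpow_inv_natCast (by positivity) he]

lemma sum_geometric_le (S : ℕ) : ∑ s ∈ Finset.range S, (4 / 5 : ℝ) ^ s ≤ 5 := by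
  rw [geom_sum_eq (by norm_num)]
  have : (0 : ℝ) ≤ (4 / 5) ^ S := by positivity
  rw [div_le_iff_of_neg (by norm_num)]
  linarith

lemma sum_four_pow_le (S : ℕ) : ∑ s ∈ Finset.range S, (4 : ℝ) ^ s ≤ 4 ^ S := by
  rw [geom_sum_eq (by norm_num)]
  have : (0 : ℝ) ≤ 4 ^ S := by positivity
  rw [div_le_iff₀ (by norm_num)]
  linarith

/-- The number of restarts that a given accuracy requires. -/
lemma exists_restarts {y v : ℝ} (hy : 1 ≤ y) (hyv : y ≤ 2 * v) (hv : 2 ≤ v) :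
    ∃ S : ℕ, 1 ≤ S ∧ y < 4 ^ S ∧ (4 : ℝ) ^ S ≤ 4 * y ∧ (S : ℝ) ≤ 3 * Real.log v := by
  obtain ⟨n, hn1, hn2⟩ := exists_nat_pow_near hy (by norm_num : (1 : ℝ) < 4)
  have h1 : (4 : ℝ) ^ (n + 1) ≤ 4 * y := by rw [pow_succ]; linarith
  refine ⟨n + 1, by omega, hn2, h1, ?_⟩
  -- As `v ≥ 2`, `4 y ≤ 8 v ≤ v^4`. Taking logarithms absorbs the additive constant of the restart
  -- count into `log v`.
  have h2 : (4 : ℝ) ^ (n + 1) ≤ v ^ 4 := by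
    have : 8 * v ≤ v ^ 4 := by
      have h8 : (2 : ℝ) ^ 3 ≤ v ^ 3 := pow_le_pow_left₀ (by norm_num) hv 3
      nlinarith
    linarith
  have h3 := Real.log_le_log (by positivity) h2
  rw [Real.log_pow, Real.log_pow, show (4 : ℝ) = 2 ^ 2 by norm_num, Real.log_pow] at h3
  have h4 := Real.log_two_gt_d9
  have h5 : (0 : ℝ) ≤ ((n + 1 : ℕ) : ℝ) := Nat.cast_nonneg _
  push_cast at h3 h5 ⊢
  nlinarith

section Count

variable {Ω : Type*} [mΩ : MeasurableSpace Ω] {P : Measure Ω} [IsProbabilityMeasure P]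

/-- The bound of the radius-dependent part of the restart length. -/
def radiusTerm (Q : Param) (μ L r : ℝ) : ℝ :=
  ∑ i ∈ Finset.Icc 2 Q.p, (Q.σ i * r ^ (i - 2) / μ) ^ (1 / (i : ℝ))
    + (L * r ^ (Q.p - 1) / μ) ^ (1 / ((Q.p : ℝ) + 1))

lemma radiusTerm_le (Q : Param) {μ L r Rc : ℝ} (hμ : 0 < μ) (hL : 0 ≤ L) (hr : 0 < r)
    (hRc : 0 ≤ Rc) (hσ : ∀ i ∈ Finset.Icc 1 Q.p, 0 ≤ Q.σ i) :
    radiusTerm Q μ L Rc ≤ radiusTerm Q μ L r * (1 + Rc ^ 2 / r ^ 2) := by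
  unfold radiusTerm
  rw [add_mul, Finset.sum_mul]
  refine add_le_add (Finset.sum_le_sum fun i hi => ?_) ?_
  · rw [Finset.mem_Icc] at hi
    exact rpow_radius_le (hσ i (Finset.mem_Icc.2 ⟨by omega, hi.2⟩)) hμ hr hRc (by omega) (by omega)
  · have := rpow_radius_le (e := Q.p + 1) (k := Q.p - 1) hL hμ hr hRc (by omega) (by omega)
    push_cast at this
    exact this

/-- The order-2 part has exponent 0 in the radius, so it is repeated `S` times; the remaining parts
form geometric series of sum at most 5. -/
lemma sum_radiusTerm_le (Q : Param) (hp : 2 ≤ Q.p) {μ L R : ℝ} (hμ : 0 < μ) (hL : 0 ≤ L)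
    (hR : 0 ≤ R) (hσ : ∀ i ∈ Finset.Icc 1 Q.p, 0 ≤ Q.σ i) (S : ℕ) :
    ∑ s ∈ Finset.range S, radiusTerm Q μ L (R / 2 ^ s) ≤ S * √(Q.σ 2 / μ)
      + 5 * (∑ i ∈ Finset.Icc 3 Q.p, (Q.σ i * R ^ (i - 2) / μ) ^ (1 / (i : ℝ))
        + (L * R ^ (Q.p - 1) / μ) ^ (1 / ((Q.p : ℝ) + 1))) := by
  set U := ∑ i ∈ Finset.Icc 3 Q.p, (Q.σ i * R ^ (i - 2) / μ) ^ (1 / (i : ℝ))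
        + (L * R ^ (Q.p - 1) / μ) ^ (1 / ((Q.p : ℝ) + 1)) with hU
  have hU0 : 0 ≤ U := by
    refine add_nonneg (Finset.sum_nonneg fun i hi => ?_) (by positivity)
    rw [Finset.mem_Icc] at hi
    have := hσ i (Finset.mem_Icc.2 ⟨by omega, hi.2⟩)
    positivity
  have h1 : ∀ s ∈ Finset.range S, radiusTerm Q μ L (R / 2 ^ s)
      ≤ √(Q.σ 2 / μ) + U * (4 / 5) ^ s := by
    intro s _
    unfold radiusTerm
    rw [← Finset.add_sum_Ioc_eq_sum_Icc hp, add_assoc]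
    refine add_le_add ?_ ?_
    · rw [Real.sqrt_eq_rpow]; simp
    · rw [hU, add_mul, Finset.sum_mul]
      refine add_le_add (Finset.sum_le_sum fun i hi => ?_) ?_
      · have hi' : 3 ≤ i ∧ i ≤ Q.p := Finset.mem_Icc.1 hi
        exact rpow_geometric_le (hσ i (Finset.mem_Icc.2 ⟨by omega, hi'.2⟩)) hμ hR (by omega)
          (by omega) s
      · have := rpow_geometric_le (e := Q.p + 1) (k := Q.p - 1) hL hμ hR (by omega) (by omega) s
        push_cast at this
        exact this
  refine (Finset.sum_le_sum h1).trans ?_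
  rw [Finset.sum_add_distrib, Finset.sum_const, Finset.card_range, nsmul_eq_mul, ← Finset.mul_sum]
  have := mul_le_mul_of_nonneg_left (sum_geometric_le S) hU0
  linarith

/-- The expected total number of iterations of `S` restarts. -/
lemma integral_sum_restartLength_le (Q : Param) (hp : 2 ≤ Q.p) {μ L C R : ℝ} (hμ : 0 < μ)
    (hL : 0 ≤ L) (hC : 0 ≤ C) (hR : 0 < R) (hσ : ∀ i ∈ Finset.Icc 1 Q.p, 0 ≤ Q.σ i)
    (hτ : 0 ≤ Q.τ) {Rc : ℕ → Ω → ℝ} (hRm : ∀ s, Measurable (Rc s)) (hR0 : ∀ s w, 0 ≤ Rc s w)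
    (hI : ∀ s, Integrable (fun w => Rc s w ^ 2) P)
    (hE : ∀ s, ∫ w, Rc s w ^ 2 ∂P ≤ (1 / 4) ^ s * R ^ 2) (S : ℕ) :
    Integrable (fun w => ∑ s ∈ Finset.range S,
      (Q.restartLength μ L C (R / 2 ^ s) (Rc s w) : ℝ)) P ∧
    ∫ w, ∑ s ∈ Finset.range S, (Q.restartLength μ L C (R / 2 ^ s) (Rc s w) : ℝ) ∂P
      ≤ (1 + C) * S + C * ((Q.τ + Q.σ 1) ^ 2 / (μ ^ 2 * R ^ 2) * 4 ^ S
        + 2 * (S * √(Q.σ 2 / μ)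
      + 5 * (∑ i ∈ Finset.Icc 3 Q.p, (Q.σ i * R ^ (i - 2) / μ) ^ (1 / (i : ℝ))
        + (L * R ^ (Q.p - 1) / μ) ^ (1 / ((Q.p : ℝ) + 1))))) := by
  have hσ1 := hσ 1 (Finset.mem_Icc.2 ⟨le_rfl, by omega⟩)
  have hrad0 : ∀ r : ℝ, 0 ≤ r → 0 ≤ radiusTerm Q μ L r := by
    intro r hr
    refine add_nonneg (Finset.sum_nonneg fun i hi => ?_) (by positivity)
    rw [Finset.mem_Icc] at hi
    have := hσ i (Finset.mem_Icc.2 ⟨by omega, hi.2⟩)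
    positivity
  set b : ℕ → Ω → ℝ := fun s w => (1 + C) + C * ((Q.τ + Q.σ 1) ^ 2 / (μ ^ 2 * R ^ 2) * 4 ^ s
    + radiusTerm Q μ L (R / 2 ^ s) * (1 + 4 ^ s / R ^ 2 * Rc s w ^ 2)) with hb
  have hr2 : ∀ s : ℕ, (R / 2 ^ s) ^ 2 = R ^ 2 / 4 ^ s := by
    intro s
    rw [div_pow, ← pow_mul, mul_comm s 2, pow_mul]; norm_num
  have hle : ∀ s w, (Q.restartLength μ L C (R / 2 ^ s) (Rc s w) : ℝ) ≤ b s w := by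
    intro s w
    refine (Q.restartLength_le hC hμ hL (hR0 s w) hσ).trans ?_
    have h1 := radiusTerm_le Q hμ hL (by positivity : 0 < R / 2 ^ s) (hR0 s w) hσ
    have h2 : (Q.τ / (μ * (R / 2 ^ s))) ^ 2 + (Q.σ 1 / (μ * (R / 2 ^ s))) ^ 2
        ≤ (Q.τ + Q.σ 1) ^ 2 / (μ ^ 2 * R ^ 2) * 4 ^ s := by
      have e : ∀ u : ℝ, (u / (μ * (R / 2 ^ s))) ^ 2 = u ^ 2 / (μ ^ 2 * R ^ 2) * 4 ^ s := by
        intro u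
        rw [div_pow, mul_pow, hr2]; field_simp
      rw [e, e, ← add_mul, ← add_div]
      gcongr
      nlinarith
    rw [hr2] at h1
    have e3 : Rc s w ^ 2 / (R ^ 2 / 4 ^ s) = 4 ^ s / R ^ 2 * Rc s w ^ 2 := by field_simp
    rw [e3] at h1
    unfold radiusTerm at h1
    have h3 : 1 + ((Q.τ / (μ * (R / 2 ^ s))) ^ 2 + (Q.σ 1 / (μ * (R / 2 ^ s))) ^ 2
        + ∑ i ∈ Finset.Icc 2 Q.p, (Q.σ i * Rc s w ^ (i - 2) / μ) ^ (1 / (i : ℝ))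
        + (L * Rc s w ^ (Q.p - 1) / μ) ^ (1 / ((Q.p : ℝ) + 1)))
        ≤ 1 + ((Q.τ + Q.σ 1) ^ 2 / (μ ^ 2 * R ^ 2) * 4 ^ s
          + radiusTerm Q μ L (R / 2 ^ s) * (1 + 4 ^ s / R ^ 2 * Rc s w ^ 2)) := by
      unfold radiusTerm
      linarith
    have := mul_le_mul_of_nonneg_left h3 hC
    simp only [hb]
    linarith
  have hbin : ∀ s, Integrable (fun w => 1 + 4 ^ s / R ^ 2 * Rc s w ^ 2) P := fun s =>
    (integrable_const _).add ((hI s).const_mul _)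
  have hbi : ∀ s, Integrable (b s) P := fun s =>
    (integrable_const _).add (((integrable_const _).add ((hbin s).const_mul _)).const_mul _)
  have hti : ∀ s, Integrable
      (fun w => (Q.restartLength μ L C (R / 2 ^ s) (Rc s w) : ℝ)) P := by
    intro s
    refine (hbi s).mono' ?_ (Filter.Eventually.of_forall fun w => ?_)
    · exact (measurable_from_nat.comp
        ((Q.measurable_restartLength μ L C _).comp (hRm s))).aestronglyMeasurable
    · rw [Real.norm_eq_abs, abs_of_nonneg (Nat.cast_nonneg _)]
      exact hle s w
  refine ⟨integrable_finsetSum _ fun s _ => hti s, ?_⟩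
  rw [integral_finsetSum _ fun s _ => hti s]
  have h1 : ∀ s ∈ Finset.range S,
      ∫ w, (Q.restartLength μ L C (R / 2 ^ s) (Rc s w) : ℝ) ∂P
      ≤ (1 + C) + C * ((Q.τ + Q.σ 1) ^ 2 / (μ ^ 2 * R ^ 2) * 4 ^ s
        + 2 * radiusTerm Q μ L (R / 2 ^ s)) := by
    intro s _
    refine (integral_mono (hti s) (hbi s) (hle s)).trans ?_
    have e0 : Integrable (fun w => (Q.τ + Q.σ 1) ^ 2 / (μ ^ 2 * R ^ 2) * 4 ^ s
      + radiusTerm Q μ L (R / 2 ^ s) * (1 + 4 ^ s / R ^ 2 * Rc s w ^ 2)) P :=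
      (integrable_const _).add ((hbin s).const_mul _)
    simp only [hb]
    rw [integral_add (integrable_const _) (e0.const_mul _), integral_const_mul,
      integral_add (integrable_const _) ((hbin s).const_mul _),
      integral_const_mul (radiusTerm Q μ L (R / 2 ^ s)),
      integral_add (integrable_const _) ((hI s).const_mul _),
      integral_const_mul ((4 : ℝ) ^ s / R ^ 2)]
    simp only [integral_const, probReal_univ, one_smul]
    -- The mean of `Rc² / r²` is at most 1, so the random radius costs a factor 2.
    have h2 : (4 : ℝ) ^ s / R ^ 2 * ∫ w, Rc s w ^ 2 ∂P ≤ 1 := by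
      calc _ ≤ (4 : ℝ) ^ s / R ^ 2 * ((1 / 4) ^ s * R ^ 2) := by
            gcongr; exact hE s
        _ = 1 := by
            rw [one_div, inv_pow]; field_simp
    have h3 := mul_le_mul_of_nonneg_left h2 (hrad0 (R / 2 ^ s) (by positivity))
    have h4 : (Q.τ + Q.σ 1) ^ 2 / (μ ^ 2 * R ^ 2) * 4 ^ s + radiusTerm Q μ L (R / 2 ^ s) *
        (1 + 4 ^ s / R ^ 2 * ∫ w, Rc s w ^ 2 ∂P)
        ≤ (Q.τ + Q.σ 1) ^ 2 / (μ ^ 2 * R ^ 2) * 4 ^ s + 2 * radiusTerm Q μ L (R / 2 ^ s) := by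
      linarith
    have := mul_le_mul_of_nonneg_left h4 hC
    linarith
  refine (Finset.sum_le_sum h1).trans ?_
  rw [Finset.sum_add_distrib, Finset.sum_const, Finset.card_range, nsmul_eq_mul, ← Finset.mul_sum,
    Finset.sum_add_distrib, ← Finset.mul_sum, ← Finset.mul_sum]
  have h2 := sum_radiusTerm_le Q hp hμ hL hR.le hσ S
  have h3 := mul_le_mul_of_nonneg_left (sum_four_pow_le S)
    (by positivity : 0 ≤ (Q.τ + Q.σ 1) ^ 2 / (μ ^ 2 * R ^ 2))
  have h4 : (Q.τ + Q.σ 1) ^ 2 / (μ ^ 2 * R ^ 2) * ∑ s ∈ Finset.range S, (4 : ℝ) ^ s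
      + 2 * ∑ s ∈ Finset.range S, radiusTerm Q μ L (R / 2 ^ s)
      ≤ (Q.τ + Q.σ 1) ^ 2 / (μ ^ 2 * R ^ 2) * 4 ^ S
        + 2 * (S * √(Q.σ 2 / μ)
      + 5 * (∑ i ∈ Finset.Icc 3 Q.p, (Q.σ i * R ^ (i - 2) / μ) ^ (1 / (i : ℝ))
        + (L * R ^ (Q.p - 1) / μ) ^ (1 / ((Q.p : ℝ) + 1)))) := by
    linarith
  have := mul_le_mul_of_nonneg_left h4 hC
  linarith

end Count

end TensorRestart

end

/-! ### Choice of the constants and conclusion. -/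

theorem theorem4 (p : ℕ) (hp : 2 ≤ p) (η : ℕ → ℝ) (hη : ∀ i ∈ Finset.Icc 3 p, 4 ≤ η i)
    (cM : ℝ) (hcM : 1 ≤ cM) :
    -- all sufficiently large constants in the parameters of the inner method are admissible
    ∃ a₀ : ℝ, 0 < a₀ ∧ ∀ (aD aL : ℝ) (aK : ℕ → ℝ), a₀ ≤ aD → a₀ ≤ aL →
      (∀ i ∈ Finset.Icc 2 (p + 1), a₀ ≤ aK i) →
    -- all sufficiently large constants in the restart lengths are admissible
    ∃ C₀ : ℝ, 0 < C₀ ∧ ∀ C : ℝ, C₀ ≤ C →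
    ∃ K : ℝ, 0 < K ∧
    ∀ (d : ℕ) (f : TensorRestart.Vec d → ℝ) (μ L M τ R : ℝ) (σ : ℕ → ℝ)
      (xstar z₀ : TensorRestart.Vec d),
      0 < μ → StrongConvexOn Set.univ μ f →
      0 ≤ L → TensorRestart.HasLipschitzDeriv p L f →
      (∀ x, f xstar ≤ f x) →
      L ≤ M → M ≤ cM * L → 0 ≤ τ → (∀ i ∈ Finset.Icc 1 p, 0 ≤ σ i) →
      0 < R → ‖z₀ - xstar‖ ≤ R →
    ∀ (Ω : Type*) [MeasurableSpace Ω] (P : Measure Ω) [IsProbabilityMeasure P]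
      (z : ℕ → Ω → TensorRestart.Vec d) (ρ : ℕ → Ω → ℝ)
      (x y gv gx : ℕ → ℕ → Ω → TensorRestart.Vec d)
      (H : ℕ → ℕ → Ω → (i : ℕ) →
        ContinuousMultilinearMap ℝ (fun _ : Fin i => TensorRestart.Vec d) ℝ)
      (F G : ℕ → ℕ → MeasurableSpace Ω),
      TensorRestart.IsRestartedRun P ⟨p, M, τ, σ, η, aD, aL, aK⟩ f xstar μ L C R z₀
        z ρ x y gv gx H F G →
      (∀ s : ℕ, Integrable (fun w => ‖z s w - xstar‖ ^ 2) P ∧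
        ∫ w, ‖z s w - xstar‖ ^ 2 ∂P ≤ (1 / 4) ^ s * R ^ 2) ∧
      (∀ s : ℕ, 1 ≤ s → Integrable (fun w => f (z s w)) P ∧
        ∫ w, f (z s w) ∂P - f xstar ≤ (1 / 2) ^ (2 * s + 1) * μ * R ^ 2) ∧
      (μ * R ^ 2 ≤ 2 * (f z₀ - f xstar) →
        ∀ ε : ℝ, 0 < ε → ε ≤ μ * R ^ 2 → 2 * ε ≤ f z₀ - f xstar →
        ∃ S : ℕ,
          Integrable (fun w => f (z S w)) P ∧ ∫ w, f (z S w) ∂P - f xstar ≤ ε ∧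
          Integrable (fun w => ∑ s ∈ Finset.range S,
            (TensorRestart.Param.restartLength ⟨p, M, τ, σ, η, aD, aL, aK⟩ μ L C
              (R / 2 ^ s) ‖z s w - xstar‖ : ℝ)) P ∧
          ∫ w, ∑ s ∈ Finset.range S,
            (TensorRestart.Param.restartLength ⟨p, M, τ, σ, η, aD, aL, aK⟩ μ L C
              (R / 2 ^ s) ‖z s w - xstar‖ : ℝ) ∂P
            ≤ K * ((τ + σ 1) ^ 2 / (μ * ε)
                + (√(σ 2 / μ) + 1) * Real.log ((f z₀ - f xstar) / ε)
                + ∑ i ∈ Finset.Icc 3 p, (σ i * R ^ (i - 2) / μ) ^ (1 / (i : ℝ))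
                + (L * R ^ (p - 1) / μ) ^ (1 / ((p : ℝ) + 1)))) := by
  -- The coefficients of the model depend only on `p` and `η`, so the other parameters are filled
  -- with zeros and the threshold stays independent of the problem.
  set c : ℕ → ℝ := fun i =>
    TensorRestart.Param.modelCoeff ⟨p, 0, 0, 0, η, 0, 0, 0⟩ i * 4 ^ i * (i.factorial : ℝ) with hc
  have hc0 : ∀ i ∈ Finset.Icc 2 (p + 1), 0 ≤ c i := by
    intro i hi
    have := TensorRestart.Param.modelCoeff_nonneg ⟨p, 0, 0, 0, η, 0, 0, 0⟩ hη hi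
    simp only [hc]
    positivity
  refine ⟨2 + ∑ i ∈ Finset.Icc 2 (p + 1), c i,
    by linarith [Finset.sum_nonneg hc0], fun aD aL aK haD haL haK => ?_⟩
  have hsum := Finset.sum_nonneg hc0
  set K₁ := TensorRestart.rateConst p aD aL aK * (4 + p + cM) with hK₁
  -- `√C ≥ 32 K₁` makes the error of a restart at most `1/32` of `μ` times the squared radii. In `3
  -- + 10 C`, the 3 comes from `S ≤ 3 log v`, and `10 = 2 · 5` from the doubled radius and the
  -- geometric series.
  refine ⟨max 1 ((32 * K₁) ^ 2), by positivity, fun C hC => ⟨3 + 10 * C, ?_, ?_⟩⟩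
  · linarith [(le_max_left _ _).trans hC]
  intro d f μ L M τ R σ xstar z₀ hμ hsc hL hf hmin hLM hML hτ hσ hR hz₀ Ω _ P _ z ρ x y gv gx H F G
    hrun
  set Q : TensorRestart.Param := ⟨p, M, τ, σ, η, aD, aL, aK⟩ with hQ
  have hC1 : 1 ≤ C := (le_max_left _ _).trans hC
  have h : Q.Nonneg :=
    { two_le := hp
      M_nonneg := hL.trans hLM
      τ_nonneg := hτ
      σ_nonneg := hσ
      four_le := hη
      two_le_aD := by linarith
      aL_pos := by linarith
      aK_ge := fun i hi => by
        have h1 := Finset.single_le_sum hc0 hi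
        have h2 := haK i hi
        change c i ≤ aK i
        linarith }
  have hCK : TensorRestart.rateConst Q.p Q.aD Q.aL Q.aK * ((4 + Q.p + cM) / √C) ≤ 1 / 32 := by
    have hs : 0 < √C := Real.sqrt_pos.2 (by linarith)
    have h1 : 32 * K₁ ≤ √C := Real.le_sqrt_of_sq_le ((le_max_right _ _).trans hC)
    rw [← mul_div_assoc, div_le_iff₀ hs]
    change K₁ ≤ _
    linarith
  have hconv := TensorRestart.add_inner_gradient_le_of_convexOn
    (strongConvexOn_zero.1 (hsc.mono hμ.le)) (hf.differentiable (by omega))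
  have hgrow := TensorRestart.sq_norm_sub_le_of_strongConvexOn hsc hmin
  have step := hrun.integral_restart_le h hf hL hLM hML (by linarith) hμ hC1 hCK hR hconv hmin hgrow
  have hdist : ∀ s : ℕ, Integrable (fun w => ‖z s w - xstar‖ ^ 2) P ∧
      ∫ w, ‖z s w - xstar‖ ^ 2 ∂P ≤ (1 / 4) ^ s * R ^ 2 := by
    intro s
    induction s with
    | zero =>
      simp only [hrun.z_zero]
      refine ⟨integrable_const _, ?_⟩
      simp only [integral_const, probReal_univ, one_smul, pow_zero, one_mul]
      gcongr
    | succ s ih => exact (step s ih.1 ih.2).2.2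
  have hval : ∀ s : ℕ, 1 ≤ s → Integrable (fun w => f (z s w)) P ∧
      ∫ w, f (z s w) ∂P - f xstar ≤ (1 / 2) ^ (2 * s + 1) * μ * R ^ 2 := by
    intro s hs
    obtain ⟨k, rfl⟩ : ∃ k, s = k + 1 := ⟨s - 1, by omega⟩
    have := step k (hdist k).1 (hdist k).2
    exact ⟨this.1, this.2.1⟩
  refine ⟨hdist, hval, fun hgap ε hε hεR hεf => ?_⟩
  set v := (f z₀ - f xstar) / ε with hv
  -- `4^S > μ R² / ε` gives the accuracy, and `4^S ≤ 4 μ R² / ε` keeps the gradient part of the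
  -- count of order `1/(μ ε)`.
  obtain ⟨S, hS1, hS2, hS3, hS4⟩ := TensorRestart.exists_restarts (y := μ * R ^ 2 / ε) (v := v)
    ((one_le_div hε).2 hεR)
    (by rw [hv, ← mul_div_assoc]; gcongr)
    (by rw [hv, le_div_iff₀ hε]; exact hεf)
  have hcount := TensorRestart.integral_sum_restartLength_le (P := P) Q hp hμ hL
    (by linarith : 0 ≤ C) hR hσ hτ (Rc := fun s w => ‖z s w - xstar‖)
    (fun s => (((hrun.z_meas s).mono (hrun.F_le s 0)).sub
      stronglyMeasurable_const).norm.measurable)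
    (fun s w => norm_nonneg _) (fun s => (hdist s).1) (fun s => (hdist s).2) S
  refine ⟨S, (hval S hS1).1, (hval S hS1).2.trans ?_, hcount.1, hcount.2.trans ?_⟩
  · rw [div_lt_iff₀ hε] at hS2
    have h1 : (1 / 2 : ℝ) ^ (2 * S + 1) = (4 ^ S)⁻¹ / 2 := by
      rw [pow_succ, pow_mul, ← inv_pow]; norm_num; ring
    rw [h1]
    have h2 : (4 ^ S : ℝ)⁻¹ * (μ * R ^ 2) ≤ ε := by
      rw [inv_mul_le_iff₀ (by positivity)]; exact hS2.le
    linarith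
  · have hσ1 := h.σ_one
    have hlog : 0 ≤ Real.log v := by
      have : (0 : ℝ) ≤ S := Nat.cast_nonneg S
      linarith
    set X := ∑ i ∈ Finset.Icc 3 p, (σ i * R ^ (i - 2) / μ) ^ (1 / (i : ℝ)) with hX
    set Z := (L * R ^ (p - 1) / μ) ^ (1 / ((p : ℝ) + 1)) with hZ
    have hX0 : 0 ≤ X := by
      refine Finset.sum_nonneg fun i hi => ?_
      rw [Finset.mem_Icc] at hi
      have := hσ i (Finset.mem_Icc.2 ⟨by omega, hi.2⟩)
      positivity
    have hZ0 : 0 ≤ Z := by positivity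
    have hV0 : 0 ≤ (τ + σ 1) ^ 2 / (μ * ε) := by positivity
    have hq := Real.sqrt_nonneg (σ 2 / μ)
    have a1 : (τ + σ 1) ^ 2 / (μ ^ 2 * R ^ 2) * 4 ^ S ≤ 4 * ((τ + σ 1) ^ 2 / (μ * ε)) := by
      calc _ ≤ (τ + σ 1) ^ 2 / (μ ^ 2 * R ^ 2) * (4 * (μ * R ^ 2 / ε)) := by gcongr
        _ = _ := by field_simp
    have a2 : (S : ℝ) * √(σ 2 / μ) ≤ 3 * (√(σ 2 / μ) * Real.log v) := by
      calc _ ≤ 3 * Real.log v * √(σ 2 / μ) := by gcongr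
        _ = _ := by ring
    have hC0 : 0 ≤ C := by linarith
    have a3 : (1 + C) * (S : ℝ) ≤ (1 + C) * (3 * Real.log v) := by gcongr
    change (1 + C) * (S : ℝ) + C * ((τ + σ 1) ^ 2 / (μ ^ 2 * R ^ 2) * 4 ^ S
      + 2 * (S * √(σ 2 / μ) + 5 * (X + Z))) ≤ _
    have a4 : C * ((τ + σ 1) ^ 2 / (μ ^ 2 * R ^ 2) * 4 ^ S
        + 2 * (S * √(σ 2 / μ) + 5 * (X + Z)))
        ≤ C * (4 * ((τ + σ 1) ^ 2 / (μ * ε)) + 2 * (3 * (√(σ 2 / μ) * Real.log v) + 5 * (X + Z))) := by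
      gcongr
    have b1 := mul_nonneg hC0 hV0
    have b2 := mul_nonneg hC0 (mul_nonneg hq hlog)
    have b3 := mul_nonneg hC0 hlog
    have b4 := mul_nonneg hq hlog
    linarith
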